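/- Let $\mathbb T$ be the circle group with normalised Haar measure, $\zeta=e^{2\pi i\theta}\in\mathbb T$, and let $D(\mathbb T)=\mathbb T\times\mathbb Z$ be the Drinfeld double of $\mathbb T$. Its dual group is $\mathbb Z\times\mathbb T$, and its $R$-matrix is the bicharacter $\widehat R\bigl((m,z),(n,w)\bigr)=z^{n}$ on $(\mathbb Z\times\mathbb T)\times(\mathbb Z\times\mathbb T)$, that is, $\widehat R=W^{\mathbb T}_{[23]}$, where $W^{\mathbb T}(z,n)=z^n$. Let $M=N=L^\infty(\mathbb T)$, acting by multiplication on $L^2(\mathbb T)$. Let $D(\mathbb T)$ act on $M$ by $\alpha^M(f)\bigl((\mu,k),\lambda\bigr)=f(\lambda\mu)$ (translation by $\mathbb T$, trivial action of $\mathbb Z$) and on $N$ by $\alpha^N(f)\bigl((\mu,k),\lambda\bigr)=f(\zeta^k\lambda)$ (rotation by $\zeta$, trivial action of $\mathbb T$). These actions are implemented, in the sense $\alpha(f)(g,\cdot)=U_g^*fU_g$, by the unitary representations $(U^M_{(\mu,k)}\xi)(\lambda)=\xi(\lambda\mu^{-1})$ and $(U^N_{(\mu,k)}\xi)(\lambda)=\xi(\zeta^{-k}\lambda)$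 on $L^2(\mathbb T)$. Let $\phi_M,\phi_N$ be the representations of $C^*(D(\mathbb T))=C_0(\mathbb Z\times\mathbb T)$ on $L^2(\mathbb T)$ corresponding to $U^M,U^N$. The braided tensor products with respect to $\widehat R$ are $$M\,\overline\boxtimes\,N=\overline{\operatorname{span}}^{\,\sigma\text{-weak}}\{\mathcal X (m\otimes 1)\mathcal X^*(1\otimes n): m\in M,\ n\in N\}\subseteq B(L^2(\mathbb T)\otimes L^2(\mathbb T)),\qquad \mathcal X=(\phi_M\otimes\phi_N)(\widehat R),$$ and $N\,\overline\boxtimes\,M$, defined in the same way with the roles of $M$ and $N$ (and of $\phi_M$ and $\phi_N$) exchanged. Then $M\,\overline\boxtimes\,N$ is equal to the von Neumann algebra tensor product $M\,\bar\otimes\,N=L^\infty(\mathbb T)\,\bar\otimes\,L^\infty(\mathbb T)$, while $N\,\overline\boxtimes\,M$ is a von Neumann algebra isomorphic to the crossed product $\mathbb Z\ltimes N$ of $N$ by the rotation by $\zeta$. In particular, if $\zeta=e^{2\pi i x}$ with $x\in\mathbb R\setminus\mathbb Q$, then $N\,\overline\boxtimes\,M$ is the injective $\mathrm{II}_1$ factor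 (that is, it is an injective factor of type $\mathrm{II}_1$ acting on a separable Hilbert space), and $M\,\overline\boxtimes\,N\not\cong N\,\overline\boxtimes\,M$. -/

import Mathlib

open MeasureTheory AddCircle
open scoped ENNReal TensorProduct ComplexInnerProductSpace ZeroAtInfty BoundedContinuousFunction

noncomputable section
namespace Braided

/-! ### Hilbert space tensor products, ultraweak closures, von Neumann algebras -/

section Operators
variable {H K : Type*} [NormedAddCommGroup H] [InnerProductSpace ℂ H]
  [NormedAddCommGroup K] [InnerProductSpace ℂ K]

/-- The Hilbert space tensor product `H ⊗ K`. -/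
abbrev HilbertTensor (H K : Type*) [NormedAddCommGroup H] [InnerProductSpace ℂ H]
    [NormedAddCommGroup K] [InnerProductSpace ℂ K] : Type _ :=
  UniformSpace.Completion (H ⊗[ℂ] K)

/-- The bounded operator `S ⊗ T` on `H ⊗ K`. -/
def opTensor (S : H →L[ℂ] H) (T : K →L[ℂ] K) : HilbertTensor H K →L[ℂ] HilbertTensor H K :=
  ((UniformSpace.Completion.toComplL (𝕜 := ℂ) (E := H ⊗[ℂ] K)).comp
    (TensorProduct.mapL S T)).extend (UniformSpace.Completion.toComplL (𝕜 := ℂ) (E := H ⊗[ℂ] K))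

theorem opTensor_tmul (S : H →L[ℂ] H) (T : K →L[ℂ] K) (ξ : H) (η : K) :
    opTensor S T ((ξ ⊗ₜ[ℂ] η : H ⊗[ℂ] K) : HilbertTensor H K) =
      ((S ξ ⊗ₜ[ℂ] T η : H ⊗[ℂ] K) : HilbertTensor H K) := by
  unfold opTensor
  have := ContinuousLinearMap.extend_eq ((UniformSpace.Completion.toComplL (𝕜 := ℂ) (E := H ⊗[ℂ] K)).comp
    (TensorProduct.mapL S T)) (e := UniformSpace.Completion.toComplL (𝕜 := ℂ) (E := H ⊗[ℂ] K))
    UniformSpace.Completion.denseRange_coe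
    (UniformSpace.Completion.isUniformInducing_coe _) (ξ ⊗ₜ[ℂ] η)
  simpa using this

/-- The `σ`-weak (ultraweak, `σ`-WOT) topology on `B(H)`: the weakest topology for which all functionals
`T ↦ ∑ n, ⟪ξ n, T (η n)⟫` with square summable `ξ`, `η` are continuous. -/
abbrev ultraweakTopology (H : Type*) [NormedAddCommGroup H] [InnerProductSpace ℂ H] :
    TopologicalSpace (H →L[ℂ] H) :=
  ⨅ (ξ : lp (fun _ : ℕ => H) 2) (η : lp (fun _ : ℕ => H) 2),
    TopologicalSpace.induced (fun T : H →L[ℂ] H => ∑' n, ⟪ξ n, T (η n)⟫) inferInstance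

/-- The `σ`-weakly closed linear span of a set of operators. -/
def ultraweakSpan (S : Set (H →L[ℂ] H)) : Set (H →L[ℂ] H) :=
  @closure _ (ultraweakTopology H) (Submodule.span ℂ S : Set (H →L[ℂ] H))

variable [CompleteSpace H] [CompleteSpace K]

/-- The von Neumann algebra generated by a set `S` of operators: the bicommutant of `S ∪ S*`. -/
def generatedVN (S : Set (H →L[ℂ] H)) : VonNeumannAlgebra H where
  toStarSubalgebra := StarSubalgebra.centralizer ℂ
    (StarSubalgebra.centralizer ℂ S : Set (H →L[ℂ] H))
  centralizer_centralizer' := by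
    change Set.centralizer (Set.centralizer
      ((StarSubalgebra.centralizer ℂ (StarSubalgebra.centralizer ℂ S : Set (H →L[ℂ] H)) :
        StarSubalgebra ℂ (H →L[ℂ] H)) : Set (H →L[ℂ] H))) =
      ((StarSubalgebra.centralizer ℂ (StarSubalgebra.centralizer ℂ S : Set (H →L[ℂ] H)) :
        StarSubalgebra ℂ (H →L[ℂ] H)) : Set (H →L[ℂ] H))
    rw [StarSubalgebra.coe_centralizer_centralizer, Set.centralizer_centralizer_centralizer]

theorem coe_generatedVN (S : Set (H →L[ℂ] H)) :
    (generatedVN S : Set (H →L[ℂ] H)) = (S ∪ star S).centralizer.centralizer := by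
  rw [← StarSubalgebra.coe_centralizer_centralizer (R := ℂ)]
  rfl
/-- The von Neumann algebra tensor product. -/
def vnTensor (M : VonNeumannAlgebra H) (N : VonNeumannAlgebra K) :
    VonNeumannAlgebra (HilbertTensor H K) :=
  generatedVN {T | ∃ m ∈ M, ∃ n ∈ N, T = opTensor m n}

/-- `P` is a factor of type `II₁`: its centre is trivial, it is finite (isometries are unitary), and it
has no minimal projections. -/
structure IsTypeIIOneFactor (P : VonNeumannAlgebra H) : Prop where
  nontrivial : Nontrivial H
  center : ∀ z ∈ P, z ∈ P.commutant → ∃ c : ℂ, z = c • (1 : H →L[ℂ] H)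
  finite : ∀ v ∈ P, star v * v = 1 → v * star v = 1
  no_minimal : ∀ p ∈ P, IsStarProjection p → p ≠ 0 → ∃ x ∈ P, ∀ c : ℂ, p * x * p ≠ c • p

/-- `P` is injective: there is a norm one projection of `B(H)` onto `P`. -/
def IsInjectiveVN (P : VonNeumannAlgebra H) : Prop :=
  ∃ E : (H →L[ℂ] H) →ₗ[ℂ] (H →L[ℂ] H),
    (∀ x, E x ∈ P) ∧ (∀ x ∈ P, E x = x) ∧ ∀ x, ‖E x‖ ≤ ‖x‖

end Operators

/-! ### The algebra `L^∞(𝕋)` acting on `L²(𝕋)` -/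

section Circle

/-- The circle group, written additively as `ℝ / ℤ`. -/
abbrev 𝕋 : Type := AddCircle (1 : ℝ)
/-- `L²(𝕋)` for the normalised Haar measure. -/
abbrev L2T : Type := Lp ℂ 2 (haarAddCircle (T := (1 : ℝ)))
/-- (Classes of) essentially bounded functions on `𝕋`. -/
abbrev LinfFun : Type := Lp ℂ ∞ (haarAddCircle (T := (1 : ℝ)))

/-- The operator of multiplication by `f` on `L²(𝕋)`. -/
def mulOp (f : LinfFun) : L2T →L[ℂ] L2T :=
  (ContinuousLinearMap.mul ℂ ℂ).holderL haarAddCircle ∞ 2 2 f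

theorem coeFn_mulOp (f : LinfFun) (ξ : L2T) : mulOp f ξ =ᵐ[haarAddCircle] fun x => f x * ξ x :=
  ContinuousLinearMap.coeFn_holder (r := 2) (ContinuousLinearMap.mul ℂ ℂ) f ξ

theorem mulOp_comm (f g : LinfFun) : mulOp f * mulOp g = mulOp g * mulOp f := by
  ext1 ξ
  apply Lp.ext
  filter_upwards [coeFn_mulOp f (mulOp g ξ), coeFn_mulOp g (mulOp f ξ), coeFn_mulOp f ξ,
    coeFn_mulOp g ξ] with x h1 h2 h3 h4
  simp only [mul_apply_eq_comp]
  rw [h1, h2, h3, h4]; ring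

theorem star_mulOp (f : LinfFun) : star (mulOp f) = mulOp (star f) := by
  rw [ContinuousLinearMap.star_eq_adjoint, eq_comm, ContinuousLinearMap.eq_adjoint_iff]
  intro ξ η
  rw [L2.inner_def, L2.inner_def]
  apply integral_congr_ae
  filter_upwards [coeFn_mulOp (star f) ξ, coeFn_mulOp f η, Lp.coeFn_star f] with x h1 h2 h3
  rw [h1, h2, h3]
  simp [mul_comm, mul_assoc]
  rw [mul_left_comm]

theorem norm_sq_L2 (h : L2T) : ‖h‖ ^ 2 = ∫ x, ‖h x‖ ^ 2 ∂(haarAddCircle (T := (1 : ℝ))) := by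
  have := L2.inner_def (𝕜 := ℂ) h h
  simp only [inner_self_eq_norm_sq_to_K] at this
  have h2 : ∫ x, ((‖h x‖ : ℂ)) ^ 2 ∂(haarAddCircle (T := (1 : ℝ))) =
      ((∫ x, ‖h x‖ ^ 2 ∂(haarAddCircle (T := (1 : ℝ))) : ℝ) : ℂ) := by
    rw [← integral_complex_ofReal]
    simp
  have h3 : ((‖h‖ : ℂ)) ^ 2 = ((∫ x, ‖h x‖ ^ 2 ∂(haarAddCircle (T := (1 : ℝ))) : ℝ) : ℂ) :=
    this.trans h2
  exact_mod_cast h3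

theorem mem_range_mulOp_of_commute (T : L2T →L[ℂ] L2T)
    (hT : ∀ f : LinfFun, mulOp f * T = T * mulOp f) : T ∈ Set.range mulOp := by
  set μ := haarAddCircle (T := (1 : ℝ)) with hμ
  set g : L2T := T (fourierLp 2 0) with hg
  have hone : (fourierLp 2 0 : L2T) =ᵐ[μ] fun _ => 1 := by
    filter_upwards [coeFn_fourierLp (T := (1 : ℝ)) 2 0] with x hx
    rw [hx, fourier_zero]
  have hmul1 (f : LinfFun) : mulOp f (fourierLp 2 0) =ᵐ[μ] f := by
    filter_upwards [coeFn_mulOp f (fourierLp 2 0), hone] with x h1 h2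
    rw [h1, h2, mul_one]
  have key (f : LinfFun) : T (mulOp f (fourierLp 2 0)) = mulOp f g :=
    (DFunLike.congr_fun (hT f) (fourierLp 2 0)).symm
  -- the function `T 1` is essentially bounded by `‖T‖`
  have hbd : ∀ᵐ x ∂μ, ‖g x‖ ≤ ‖T‖ := by
    set A : Set 𝕋 := {x | ‖T‖ < ‖g x‖} with hAdef
    have hA : MeasurableSet A :=
      measurableSet_lt measurable_const (Lp.stronglyMeasurable g).norm.measurable
    set f : LinfFun := indicatorConstLp ∞ hA (measure_ne_top μ A) (1 : ℂ) with hf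
    have hfx : f =ᵐ[μ] A.indicator fun _ => (1 : ℂ) := indicatorConstLp_coeFn
    have hle : ‖mulOp f g‖ ^ 2 ≤ ‖T‖ ^ 2 * ‖mulOp f (fourierLp 2 0)‖ ^ 2 := by
      rw [← key f, ← mul_pow]
      exact pow_le_pow_left₀ (norm_nonneg _) (T.le_opNorm _) 2
    have hint : Integrable (A.indicator fun x => ‖g x‖ ^ 2) μ :=
      ((memLp_two_iff_integrable_sq_norm (Lp.aestronglyMeasurable g)).1 (Lp.memLp g)).indicator hA
    have hintc : Integrable (A.indicator fun _ => ‖T‖ ^ 2) μ := (integrable_const _).indicator hA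
    have h1 : ‖mulOp f g‖ ^ 2 = ∫ x, A.indicator (fun x => ‖g x‖ ^ 2) x ∂μ := by
      rw [norm_sq_L2]
      apply integral_congr_ae
      filter_upwards [coeFn_mulOp f g, hfx] with x a b
      rw [a, b]
      by_cases hx : x ∈ A <;> simp [hx]
    have h2 : ‖T‖ ^ 2 * ‖mulOp f (fourierLp 2 0)‖ ^ 2 = ∫ x, A.indicator (fun _ => ‖T‖ ^ 2) x ∂μ := by
      rw [norm_sq_L2, ← integral_const_mul]
      apply integral_congr_ae
      filter_upwards [hmul1 f, hfx] with x a b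
      rw [a, b]
      by_cases hx : x ∈ A <;> simp [hx]
    have hnn : ∀ x, 0 ≤ A.indicator (fun x => ‖g x‖ ^ 2) x - A.indicator (fun _ => ‖T‖ ^ 2) x := by
      intro x
      by_cases hx : x ∈ A
      · simp only [hx, Set.indicator_of_mem, sub_nonneg]
        exact pow_le_pow_left₀ (norm_nonneg _) (le_of_lt hx) 2
      · simp [hx]
    have h0 : ∫ x, (A.indicator (fun x => ‖g x‖ ^ 2) x - A.indicator (fun _ => ‖T‖ ^ 2) x) ∂μ = 0 := by
      apply le_antisymm
      · rw [integral_sub hint hintc, ← h1, ← h2]; linarith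
      · exact integral_nonneg hnn
    have h3 := (integral_eq_zero_iff_of_nonneg hnn (hint.sub hintc)).1 h0
    filter_upwards [h3] with x hx
    by_contra hlt
    have hxA : x ∈ A := not_le.1 hlt
    simp only [hxA, Set.indicator_of_mem, Pi.zero_apply] at hx
    have := pow_lt_pow_left₀ (show ‖T‖ < ‖g x‖ from hxA) (norm_nonneg _) two_ne_zero
    linarith
  have hgm : MemLp g ∞ μ := memLp_top_of_bound (Lp.aestronglyMeasurable g) _ hbd
  refine ⟨hgm.toLp g, ?_⟩
  have hgm' : ∀ᵐ x ∂μ, hgm.toLp g x = g x := hgm.coeFn_toLp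
  refine ContinuousLinearMap.ext_on (s := Set.range (fourierLp (T := (1 : ℝ)) 2))
    (by
      have := span_fourierLp_closure_eq_top (T := (1 : ℝ)) (p := 2) (by norm_num)
      exact Submodule.dense_iff_topologicalClosure_eq_top.mpr this) ?_
  rintro _ ⟨n, rfl⟩
  have h1 : (fourierLp 2 n : L2T) = mulOp (fourierLp ∞ n) (fourierLp 2 0) := by
    apply Lp.ext
    filter_upwards [hmul1 (fourierLp ∞ n), coeFn_fourierLp (T := (1 : ℝ)) 2 n,
      coeFn_fourierLp (T := (1 : ℝ)) ∞ n] with x a b c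
    rw [a, b, c]
  conv_rhs => rw [h1, key]
  apply Lp.ext
  filter_upwards [coeFn_mulOp (fourierLp ∞ n) g, coeFn_mulOp (hgm.toLp g) (fourierLp 2 n),
    coeFn_fourierLp (T := (1 : ℝ)) 2 n, coeFn_fourierLp (T := (1 : ℝ)) ∞ n, hgm'] with x a b c d h
  rw [a, b, c, d, h, mul_comm]

theorem commutant_range_mulOp : (Set.range mulOp).centralizer = Set.range mulOp := by
  apply Set.Subset.antisymm
  · intro T hT
    exact mem_range_mulOp_of_commute T fun f => hT _ ⟨f, rfl⟩
  · rintro _ ⟨f, rfl⟩ _ ⟨g, rfl⟩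
    exact mulOp_comm g f

/-- The von Neumann algebra `L^∞(𝕋)`, acting on `L²(𝕋)` by multiplication; see `coe_LinfT`. -/
def LinfT : VonNeumannAlgebra L2T := generatedVN (Set.range mulOp)

theorem coe_LinfT : (LinfT : Set (L2T →L[ℂ] L2T)) = Set.range mulOp := by
  have : star (Set.range mulOp) = Set.range mulOp := by
    apply Set.Subset.antisymm
    · rintro T ⟨f, hf⟩
      exact ⟨star f, by rw [← star_mulOp, hf, star_star]⟩
    · rintro _ ⟨f, rfl⟩
      exact ⟨star f, (star_mulOp f).symm⟩
  rw [LinfT, coe_generatedVN, this, Set.union_self, commutant_range_mulOp, commutant_range_mulOp]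

end Circle

/-! ### Locally compact abelian groups, duality and Drinfeld doubles -/

section Groups

theorem continuous_circle_coe : Continuous fun z : Circle => (z : ℂ) := by
  fun_prop

/-- A continuous bicharacter `X × Y → U(1)`. When `X`, `Y` are the duals of the locally compact abelian
groups `G`, `G'`, this is a bicharacter linking `G` and `G'`. -/
structure Bicharacter (X Y : Type*) [AddCommGroup X] [TopologicalSpace X] [AddCommGroup Y]
    [TopologicalSpace Y] where
  toFun : X → Y → Circle
  map_add_left : ∀ x x' y, toFun (x + x') y = toFun x y * toFun x' y
  map_add_right : ∀ x y y', toFun x (y + y') = toFun x y * toFun x y'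
  continuous_toFun : Continuous fun q : X × Y => toFun q.1 q.2

/-- A bicharacter as a (unitary) element of `C_b(X × Y)`, the multiplier algebra of
`C₀(X) ⊗ C₀(Y)`. -/
def Bicharacter.toBCF {X Y : Type*} [AddCommGroup X] [TopologicalSpace X] [AddCommGroup Y]
    [TopologicalSpace Y] (χ : Bicharacter X Y) : BoundedContinuousFunction (X × Y) ℂ :=
  BoundedContinuousFunction.ofNormedAddCommGroup (fun q => (χ.toFun q.1 q.2 : ℂ))
    (continuous_circle_coe.comp χ.continuous_toFun) 1 fun _ => (Circle.norm_coe _).le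

/-- `X` is the Pontryagin dual of `G` (for `σ`-compact locally compact abelian groups `G`, `X`): a
bicharacter through which every continuous character of `G` is given by a unique element of `X`, and
conversely. The function `toFun : G × X → U(1)` is the Kac-Takesaki operator `W^G`, seen as an element of
`L^∞(G) ⊗ L^∞(Ĝ)`, where `L^∞(Ĝ) = VN(G)` is identified with `L^∞(X)` by sending the left translation
operator `λ_g` to the function `x ↦ toFun g x`. -/
structure DualPairing (G X : Type*) [AddCommGroup G] [TopologicalSpace G] [AddCommGroup X]
    [TopologicalSpace X] extends Bicharacter G X where
  existsUnique_right : ∀ χ : G → Circle, Continuous χ → (∀ g h, χ (g + h) = χ g * χ h) →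
    ∃! x, ∀ g, χ g = toFun g x
  existsUnique_left : ∀ χ : X → Circle, Continuous χ → (∀ x y, χ (x + y) = χ x * χ y) →
    ∃! g, ∀ x, χ x = toFun g x

section Double
variable {A B : Type*} [AddCommGroup A] [TopologicalSpace A] [AddCommGroup B] [TopologicalSpace B]

theorem Bicharacter.zero_left (χ : Bicharacter A B) (b : B) : χ.toFun 0 b = 1 := by
  simpa using χ.map_add_left 0 0 b

theorem Bicharacter.zero_right (χ : Bicharacter A B) (a : A) : χ.toFun a 0 = 1 := by
  simpa using χ.map_add_right a 0 0

theorem Bicharacter.neg_left (χ : Bicharacter A B) (a : A) (b : B) :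
    χ.toFun (-a) b = (χ.toFun a b)⁻¹ := by
  rw [eq_inv_iff_mul_eq_one, ← χ.map_add_left, neg_add_cancel, χ.zero_left]

theorem Bicharacter.neg_right (χ : Bicharacter A B) (a : A) (b : B) :
    χ.toFun a (-b) = (χ.toFun a b)⁻¹ := by
  rw [eq_inv_iff_mul_eq_one, ← χ.map_add_right, neg_add_cancel, χ.zero_right]

/-- Let `B` be the dual of the abelian group `A`, with Kac-Takesaki function `W`. As `A` is abelian,
the Drinfeld double of `A` is the group `D(A) = A × B`; its dual is `B × A`, and its Kac-Takesaki function
is the product of that of `A` and that of `B`, the latter being `(b, a) ↦ W(a, b)⁻¹`. -/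
def drinfeldPairing (W : DualPairing A B) : DualPairing (A × B) (B × A) where
  toFun g x := W.toFun g.1 x.1 * (W.toFun x.2 g.2)⁻¹
  map_add_left g g' x := by
    simp only [Prod.fst_add, Prod.snd_add, W.map_add_left, W.map_add_right, mul_inv]
    exact mul_mul_mul_comm _ _ _ _
  map_add_right g x x' := by
    simp only [Prod.fst_add, Prod.snd_add, W.map_add_left, W.map_add_right, mul_inv]
    exact mul_mul_mul_comm _ _ _ _
  continuous_toFun := by
    have h1 : Continuous fun q : (A × B) × (B × A) => W.toFun q.1.1 q.2.1 :=
      W.continuous_toFun.comp (f := fun q : (A × B) × (B × A) => (q.1.1, q.2.1)) (by fun_prop)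
    have h2 : Continuous fun q : (A × B) × (B × A) => W.toFun q.2.2 q.1.2 :=
      W.continuous_toFun.comp (f := fun q : (A × B) × (B × A) => (q.2.2, q.1.2)) (by fun_prop)
    exact h1.mul h2.inv
  existsUnique_right χ hχ hadd := by
    have h0 : χ (0, 0) = 1 := by simpa using hadd (0, 0) (0, 0)
    obtain ⟨b, hb, hbu⟩ := W.existsUnique_right (fun a => χ (a, 0))
      (hχ.comp (by fun_prop)) (fun g h => by simpa using hadd (g, 0) (h, 0))
    obtain ⟨a, ha, hau⟩ := W.existsUnique_left (fun b => χ (0, b))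
      (hχ.comp (by fun_prop)) (fun g h => by simpa using hadd (0, g) (0, h))
    refine ⟨(b, -a), ?_, ?_⟩
    · rintro ⟨g1, g2⟩
      have := hadd (g1, 0) (0, g2)
      simp only [Prod.mk_add_mk, add_zero, zero_add] at this
      rw [this, hb, ha]
      simp [W.neg_left]
    · rintro ⟨b', a'⟩ h'
      have e1 : b' = b := hbu b' fun g => by simpa [W.zero_right] using h' (g, 0)
      have e2 : -a' = a := hau (-a') fun g => by simpa [W.zero_left, W.neg_left] using h' (0, g)
      rw [e1, ← e2, neg_neg]
  existsUnique_left χ hχ hadd := by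
    have h0 : χ (0, 0) = 1 := by simpa using hadd (0, 0) (0, 0)
    obtain ⟨a, ha, hau⟩ := W.existsUnique_left (fun b => χ (b, 0))
      (hχ.comp (by fun_prop)) (fun g h => by simpa using hadd (g, 0) (h, 0))
    obtain ⟨b, hb, hbu⟩ := W.existsUnique_right (fun a => χ (0, a))
      (hχ.comp (by fun_prop)) (fun g h => by simpa using hadd (0, g) (0, h))
    refine ⟨(a, -b), ?_, ?_⟩
    · rintro ⟨x1, x2⟩
      have := hadd (x1, 0) (0, x2)
      simp only [Prod.mk_add_mk, add_zero, zero_add] at this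
      rw [this, hb, ha]
      simp [W.neg_right]
    · rintro ⟨a', b'⟩ h'
      have e1 : a' = a := hau a' fun g => by simpa [W.zero_left] using h' (g, 0)
      have e2 : -b' = b := hbu (-b') fun g => by simpa [W.zero_right, W.neg_right] using h' (0, g)
      rw [e1, ← e2, neg_neg]

/-- The `R`-matrix of the Drinfeld double `A × B`: the element `W_[23]` of
`L^∞(B × A) ⊗ L^∞(B × A)`. -/
def rMatrix (W : DualPairing A B) : Bicharacter (B × A) (B × A) where
  toFun x y := W.toFun x.2 y.1
  map_add_left x x' y := W.map_add_left _ _ _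
  map_add_right x y y' := W.map_add_right _ _ _
  continuous_toFun :=
    W.continuous_toFun.comp (f := fun q : (B × A) × (B × A) => (q.1.2, q.2.1)) (by fun_prop)

end Double

/-- The group `ℤ` is the dual of `𝕋`, by `(s, n) ↦ exp(2πi n s)`. -/
def torusPairing : DualPairing 𝕋 ℤ where
  toFun s n := (n • s).toCircle
  map_add_left s s' n := by rw [smul_add, AddCircle.toCircle_add]
  map_add_right s n n' := by rw [add_smul, AddCircle.toCircle_add]
  continuous_toFun := by
    have h : Continuous fun q : 𝕋 × ℤ => q.2 • q.1 := by
      rw [continuous_prod_of_discrete_right]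
      intro n; fun_prop
    exact AddCircle.continuous_toCircle.comp h
  existsUnique_right χ hχ hadd := by
    let f : C(𝕋, ℂ) := ⟨fun x => (χ x : ℂ), continuous_circle_coe.comp hχ⟩
    have hex : ∃ n : ℤ, fourierCoeff (f : 𝕋 → ℂ) n ≠ 0 := by
      by_contra! hcon
      have h := tsum_sq_fourierCoeff (T := (1 : ℝ)) (ContinuousMap.toLp 2 haarAddCircle ℂ f)
      simp only [fourierCoeff_toLp, hcon] at h
      have h1 : ∫ t, ‖(ContinuousMap.toLp 2 (haarAddCircle (T := (1 : ℝ))) ℂ f : L2T) t‖ ^ 2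
          ∂haarAddCircle = ∫ _ : 𝕋, (1 : ℝ) ∂haarAddCircle := by
        apply integral_congr_ae
        filter_upwards [ContinuousMap.coeFn_toLp (p := 2) (𝕜 := ℂ) haarAddCircle f] with t ht
        rw [ht]
        simp only [f, ContinuousMap.coe_mk, Circle.norm_coe, one_pow]
      rw [h1] at h
      simp at h
    obtain ⟨n, hn⟩ := hex
    have hpt (y : 𝕋) : χ y = (n • y).toCircle := by
      have h1 : fourierCoeff (f : 𝕋 → ℂ) n =
          (fourier (-n) y * (χ y : ℂ)) * fourierCoeff (f : 𝕋 → ℂ) n := by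
        conv_lhs => rw [fourierCoeff, ← integral_add_right_eq_self _ y]
        rw [fourierCoeff, ← integral_const_mul]
        congr 1
        ext t
        simp only [f, ContinuousMap.coe_mk, hadd, smul_eq_mul, fourier_apply, smul_add,
          AddCircle.toCircle_add, Circle.coe_mul]
        ring
      have h2 : fourier (-n) y * (χ y : ℂ) = 1 := (mul_eq_right₀ hn).1 h1.symm
      apply Circle.ext
      rw [fourier_apply, neg_smul, AddCircle.toCircle_neg, Circle.coe_inv] at h2
      rw [inv_mul_eq_one₀ (Circle.coe_ne_zero _)] at h2
      exact h2.symm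
    refine ⟨n, hpt, fun m hm => ?_⟩
    have h3 : (fourier m : C(𝕋, ℂ)) = fourier n := by
      ext y
      rw [fourier_apply, fourier_apply, ← hpt y, hm y]
    refine (orthonormal_fourier (T := (1 : ℝ))).linearIndependent.injective ?_
    simp only [fourierLp, h3]
  existsUnique_left χ hχ hadd := by
    have h0 : χ 0 = 1 := by simpa using hadd 0 0
    let F : Multiplicative ℤ →* Circle :=
      { toFun := fun n => χ n.toAdd, map_one' := h0, map_mul' := fun m n => hadd _ _ }
    obtain ⟨s, hs⟩ := (AddCircle.homeomorphCircle (T := (1 : ℝ)) one_ne_zero).surjective (χ 1)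
    rw [AddCircle.homeomorphCircle_apply] at hs
    have hχn (n : ℤ) : χ n = χ 1 ^ n := by
      have := map_zpow F (Multiplicative.ofAdd (1 : ℤ)) n
      simpa [F, ← ofAdd_zsmul] using this
    refine ⟨s, fun n => by rw [AddCircle.toCircle_zsmul, hs, hχn], fun t ht => ?_⟩
    apply AddCircle.injective_toCircle (T := (1 : ℝ)) one_ne_zero
    rw [hs, ht 1, one_zsmul]

end Groups

/-! ### Representations, actions and implementations -/

section Actions

/-- A strongly continuous unitary representation of `G` on `H`. -/
structure UnitaryRep (G H : Type*) [AddCommGroup G] [TopologicalSpace G]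
    [NormedAddCommGroup H] [InnerProductSpace ℂ H] where
  toFun : G → H ≃ₗᵢ[ℂ] H
  map_add : ∀ g h ξ, toFun (g + h) ξ = toFun g (toFun h ξ)
  continuous_apply : ∀ ξ, Continuous fun g => toFun g ξ

/-- The operator `U_g`. -/
def UnitaryRep.op {G H : Type*} [AddCommGroup G] [TopologicalSpace G] [NormedAddCommGroup H]
    [InnerProductSpace ℂ H] (U : UnitaryRep G H) (g : G) : H →L[ℂ] H :=
  (U.toFun g).toLinearIsometry.toContinuousLinearMap

/-- An action of the (abelian) group `G` on the von Neumann algebra `M`: a homomorphism from `G` to the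
`*`-automorphisms of `M` with weakly continuous orbits. It corresponds to the map
`α : M → L^∞(G) ⊗ M`, `α(m)(g) = act g m`. -/
structure GroupAction (G : Type*) {H : Type*} [AddCommGroup G] [TopologicalSpace G]
    [NormedAddCommGroup H] [InnerProductSpace ℂ H] [CompleteSpace H]
    (M : VonNeumannAlgebra H) where
  act : G → M.toStarSubalgebra →⋆ₐ[ℂ] M.toStarSubalgebra
  act_zero : ∀ m, act 0 m = m
  act_add : ∀ g h m, act (g + h) m = act h (act g m)
  continuous_act : ∀ m ξ η, Continuous fun g => ⟪ξ, (act g m : H →L[ℂ] H) η⟫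

section
variable {G H : Type*} [AddCommGroup G] [TopologicalSpace G] [NormedAddCommGroup H]
  [InnerProductSpace ℂ H]

theorem UnitaryRep.op_zero (U : UnitaryRep G H) : U.op 0 = 1 := by
  ext ξ
  apply (U.toFun 0).injective
  simpa [UnitaryRep.op] using (U.map_add 0 0 ξ).symm

theorem UnitaryRep.op_add (U : UnitaryRep G H) (g h : G) : U.op (g + h) = U.op g * U.op h := by
  ext ξ
  exact U.map_add g h ξ

end

variable {G H : Type*} [AddCommGroup G] [TopologicalSpace G] [NormedAddCommGroup H]
  [InnerProductSpace ℂ H] [CompleteSpace H]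

/-- A unitary representation implementing an action: `α(m) = U* (1 ⊗ m) U`. -/
structure Implementation {M : VonNeumannAlgebra H} (α : GroupAction G M)
    extends UnitaryRep G H where
  implements : ∀ g m, (α.act g m : H →L[ℂ] H) = star (toUnitaryRep.op g) * m * toUnitaryRep.op g

theorem UnitaryRep.star_op_mul_op (U : UnitaryRep G H) (g : G) : star (U.op g) * U.op g = 1 := by
  rw [ContinuousLinearMap.star_eq_adjoint, ContinuousLinearMap.mul_def]
  exact (ContinuousLinearMap.norm_map_iff_adjoint_comp_self _).1 (U.toFun g).norm_map

theorem UnitaryRep.op_mul_star_op (U : UnitaryRep G H) (g : G) : U.op g * star (U.op g) = 1 := by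
  have h := U.star_op_mul_op g
  have : star (U.op g) = (U.toFun g).symm.toLinearIsometry.toContinuousLinearMap := by
    ext ξ
    obtain ⟨η, rfl⟩ := (U.toFun g).surjective ξ
    have := DFunLike.congr_fun h η
    simpa [UnitaryRep.op] using this
  rw [this]
  ext ξ
  simp [UnitaryRep.op]

/-- The action `m ↦ U_g* m U_g` on a von Neumann algebra that is invariant under it. -/
def UnitaryRep.conjAction (U : UnitaryRep G H) (M : VonNeumannAlgebra H)
    (hM : ∀ g, ∀ m ∈ M, star (U.op g) * m * U.op g ∈ M) : GroupAction G M where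
  act g :=
    { toFun := fun m => ⟨star (U.op g) * m * U.op g, hM g m m.2⟩
      map_one' := by ext1; simp [U.star_op_mul_op]
      map_mul' := fun m n => by
        ext1
        change star (U.op g) * (m * n : H →L[ℂ] H) * U.op g =
          (star (U.op g) * m * U.op g) * (star (U.op g) * n * U.op g)
        rw [show (star (U.op g) * m * U.op g) * (star (U.op g) * n * U.op g) =
          star (U.op g) * m * (U.op g * star (U.op g)) * n * U.op g by simp only [mul_assoc],
          U.op_mul_star_op]
        simp only [mul_assoc, one_mul]
      map_zero' := by ext1; simp
      map_add' := fun m n => by ext1; simp [mul_add, add_mul]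
      commutes' := fun c => by
        ext1
        change star (U.op g) * (algebraMap ℂ (H →L[ℂ] H) c) * U.op g = algebraMap ℂ (H →L[ℂ] H) c
        rw [mul_assoc, Algebra.commutes, ← mul_assoc, U.star_op_mul_op, one_mul]
      map_star' := fun m => by
        ext1
        change star (U.op g) * star (m : H →L[ℂ] H) * U.op g =
          star (star (U.op g) * (m : H →L[ℂ] H) * U.op g)
        simp [mul_assoc] }
  act_zero m := by
    ext1
    change star (U.op 0) * (m : H →L[ℂ] H) * U.op 0 = m
    simp [U.op_zero]
  act_add g h m := by
    ext1
    change star (U.op (g + h)) * (m : H →L[ℂ] H) * U.op (g + h) =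
      star (U.op h) * (star (U.op g) * (m : H →L[ℂ] H) * U.op g) * U.op h
    simp [U.op_add, mul_assoc]
  continuous_act m ξ η := by
    change Continuous fun g => ⟪ξ, (star (U.op g) * (m : H →L[ℂ] H) * U.op g) η⟫
    have h (g : G) : ⟪ξ, (star (U.op g) * (m : H →L[ℂ] H) * U.op g) η⟫ =
        ⟪U.toFun g ξ, (m : H →L[ℂ] H) (U.toFun g η)⟫ := by
      rw [ContinuousLinearMap.star_eq_adjoint]
      exact ContinuousLinearMap.adjoint_inner_right _ _ _
    simp only [h]
    exact (U.continuous_apply ξ).inner ((m : H →L[ℂ] H).continuous.comp (U.continuous_apply η))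

/-- The representation `U` implements its action by conjugation. -/
def UnitaryRep.conjImplementation (U : UnitaryRep G H) (M : VonNeumannAlgebra H)
    (hM : ∀ g, ∀ m ∈ M, star (U.op g) * m * U.op g ∈ M) : Implementation (U.conjAction M hM) where
  toUnitaryRep := U
  implements _ _ := rfl

end Actions

/-! ### Actions on `L^∞(𝕋)` by translations of the circle -/

section Rotation

theorem measurePreserving_add (c : 𝕋) :
    MeasurePreserving (· + c) (haarAddCircle (T := (1 : ℝ))) haarAddCircle :=
  measurePreserving_add_right _ c

/-- The isometry `ξ ↦ ξ(· + c)` of `L²(𝕋)`. -/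
def shift (c : 𝕋) : L2T →ₗᵢ[ℂ] L2T :=
  Lp.compMeasurePreservingₗᵢ ℂ (· + c) (measurePreserving_add c)

/-- The map `f ↦ f(· + c)` on `L^∞(𝕋)`. -/
def shiftFun (c : 𝕋) (f : LinfFun) : LinfFun :=
  Lp.compMeasurePreserving (· + c) (measurePreserving_add c) f

theorem coeFn_shift (c : 𝕋) (ξ : L2T) : shift c ξ =ᵐ[haarAddCircle] fun x => ξ (x + c) :=
  Lp.coeFn_compMeasurePreserving ξ (measurePreserving_add c)

theorem coeFn_shiftFun (c : 𝕋) (f : LinfFun) :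
    shiftFun c f =ᵐ[haarAddCircle] fun x => f (x + c) :=
  Lp.coeFn_compMeasurePreserving f (measurePreserving_add c)

theorem shift_shift (c d : 𝕋) (ξ : L2T) : shift c (shift d ξ) = shift (c + d) ξ := by
  apply Lp.ext
  filter_upwards [coeFn_shift c (shift d ξ), coeFn_shift (c + d) ξ,
    (measurePreserving_add c).quasiMeasurePreserving.ae (coeFn_shift d ξ)] with x h1 h2 h3
  rw [h1, h2, h3, add_assoc]

theorem shift_zero (ξ : L2T) : shift 0 ξ = ξ := by
  apply Lp.ext
  filter_upwards [coeFn_shift 0 ξ] with x h1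
  rw [h1, add_zero]

theorem continuous_shift (ξ : L2T) : Continuous fun c => shift c ξ := by
  refine Continuous.compMeasurePreservingLp (p := 2) (f := fun _ : 𝕋 => ξ)
    (g := fun c : 𝕋 => (⟨(· + c), by fun_prop⟩ : C(𝕋, 𝕋)))
    continuous_const ?_ (fun c => measurePreserving_add c) (by norm_num)
  refine ContinuousMap.continuous_of_continuous_uncurry _ ?_
  exact (continuous_snd.add continuous_fst : Continuous fun q : 𝕋 × 𝕋 => q.2 + q.1)

variable {G : Type*} [AddCommGroup G] [TopologicalSpace G]

/-- For a continuous homomorphism `τ : G → 𝕋`, the representation `(U_g ξ)(x) = ξ(x - τ g)` of `G` on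
`L²(𝕋)`. -/
def koopman (τ : G →ₜ+ 𝕋) : UnitaryRep G L2T where
  toFun g :=
    { (shift (-τ g)) with
      invFun := shift (τ g)
      left_inv := fun ξ => by
        change shift (τ g) (shift (-τ g) ξ) = ξ
        rw [shift_shift, add_neg_cancel, shift_zero]
      right_inv := fun ξ => by
        change shift (-τ g) (shift (τ g) ξ) = ξ
        rw [shift_shift, neg_add_cancel, shift_zero] }
  map_add g h ξ := by
    change shift (-τ (g + h)) ξ = shift (-τ g) (shift (-τ h) ξ)
    rw [shift_shift, map_add, neg_add]
  continuous_apply ξ := (continuous_shift ξ).comp (map_continuous τ).neg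

theorem koopman_conj_mulOp (τ : G →ₜ+ 𝕋) (g : G) (f : LinfFun) :
    star ((koopman τ).op g) * mulOp f * (koopman τ).op g = mulOp (shiftFun (τ g) f) := by
  have key : mulOp f * (koopman τ).op g = (koopman τ).op g * mulOp (shiftFun (τ g) f) := by
    ext1 ξ
    change mulOp f (shift (-τ g) ξ) = shift (-τ g) (mulOp (shiftFun (τ g) f) ξ)
    apply Lp.ext
    have hq := (measurePreserving_add (-τ g)).quasiMeasurePreserving
    filter_upwards [coeFn_mulOp f (shift (-τ g) ξ), coeFn_shift (-τ g) ξ,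
      coeFn_shift (-τ g) (mulOp (shiftFun (τ g) f) ξ), hq.ae (coeFn_mulOp (shiftFun (τ g) f) ξ),
      hq.ae (coeFn_shiftFun (τ g) f)] with x h1 h2 h3 h4 h5
    rw [h1, h2, h3, h4, h5, neg_add_cancel_right]
  rw [mul_assoc, key, ← mul_assoc, UnitaryRep.star_op_mul_op, one_mul]

theorem koopman_conj_mem (τ : G →ₜ+ 𝕋) (g : G) (m : L2T →L[ℂ] L2T) (hm : m ∈ LinfT) :
    star ((koopman τ).op g) * m * (koopman τ).op g ∈ LinfT := by
  rw [← SetLike.mem_coe, coe_LinfT] at hm ⊢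
  obtain ⟨f, rfl⟩ := hm
  exact ⟨_, (koopman_conj_mulOp τ g f).symm⟩

/-- For a continuous homomorphism `τ : G → 𝕋`, the action of `G` on `L^∞(𝕋)` given by
`α(f)(g, x) = f(x + τ g)`; see `rotationAction_mulOp`. -/
def rotationAction (τ : G →ₜ+ 𝕋) : GroupAction G LinfT :=
  (koopman τ).conjAction LinfT (koopman_conj_mem τ)

/-- The standard implementation of `rotationAction τ` on `L²(𝕋)`, by `koopman τ`. -/
def rotationImplementation (τ : G →ₜ+ 𝕋) : Implementation (rotationAction τ) :=
  (koopman τ).conjImplementation LinfT (koopman_conj_mem τ)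

theorem mulOp_mem (f : LinfFun) : mulOp f ∈ LinfT := by
  rw [← SetLike.mem_coe, coe_LinfT]
  exact ⟨f, rfl⟩

theorem rotationAction_mulOp (τ : G →ₜ+ 𝕋) (g : G) (f : LinfFun) :
    ((rotationAction τ).act g ⟨mulOp f, mulOp_mem f⟩ : L2T →L[ℂ] L2T) =
      mulOp (shiftFun (τ g) f) :=
  koopman_conj_mulOp τ g f

end Rotation

/-! ### Braided tensor products and crossed products -/

section BraidedTensor

variable {G X G' X' H K : Type*}
  [AddCommGroup G] [TopologicalSpace G] [AddCommGroup X] [TopologicalSpace X]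
  [AddCommGroup G'] [TopologicalSpace G'] [AddCommGroup X'] [TopologicalSpace X']
  [NormedAddCommGroup H] [InnerProductSpace ℂ H] [CompleteSpace H]
  [NormedAddCommGroup K] [InnerProductSpace ℂ K] [CompleteSpace K]

/-- `φ` is the nondegenerate representation of `C₀(X) = C*(G)` on `H` associated with the representation
`U` of `G`, that is `U = (id ⊗ φ)(W)`: the extension of `φ` to multipliers maps the function
`W(g, ·) ∈ C_b(X)` to `U_g`, for all `g`. -/
structure IsIntegratedForm (W : DualPairing G X) (U : UnitaryRep G H)
    (φ : C₀(X, ℂ) →⋆ₙₐ[ℂ] (H →L[ℂ] H)) : Prop where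
  nondegenerate : Dense (Submodule.span ℂ {η : H | ∃ a ξ, η = φ a ξ} : Set H)
  map_char_mul : ∀ (g : G) (a b : C₀(X, ℂ)), (∀ x, b x = (W.toFun g x : ℂ) * a x) →
    φ b = U.op g * φ a

open Classical in
/-- The (unique) representation of `C₀(X) = C*(G)` associated with the representation `U`. -/
def integratedForm (W : DualPairing G X) (U : UnitaryRep G H) :
    C₀(X, ℂ) →⋆ₙₐ[ℂ] (H →L[ℂ] H) :=
  if h : ∃ φ, IsIntegratedForm W U φ then h.choose else 0

/-- The elementary tensor `a ⊗ b`, as a function on `X × X'`. -/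
def tensorFun (a : C₀(X, ℂ)) (b : C₀(X', ℂ)) : X × X' →ᵇ ℂ :=
  a.toBCF.compContinuous ⟨Prod.fst, continuous_fst⟩ *
    b.toBCF.compContinuous ⟨Prod.snd, continuous_snd⟩

/-- `Φ` extends `φ ⊗ ψ` to the multiplier algebra `C_b(X × X')` of `C₀(X) ⊗ C₀(X')`. For nondegenerate
`φ` and `ψ` there is exactly one such `Φ`. -/
def IsTensorRep (φ : C₀(X, ℂ) →⋆ₙₐ[ℂ] (H →L[ℂ] H)) (ψ : C₀(X', ℂ) →⋆ₙₐ[ℂ] (K →L[ℂ] K))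
    (Φ : (X × X' →ᵇ ℂ) →⋆ₐ[ℂ] (HilbertTensor H K →L[ℂ] HilbertTensor H K)) : Prop :=
  ∀ a b, Φ (tensorFun a b) = opTensor (φ a) (ψ b)

open Classical in
/-- The operator `(φ ⊗ ψ)(F)`, for `F ∈ C_b(X × X')` and nondegenerate `φ`, `ψ`. -/
def tensorRep (φ : C₀(X, ℂ) →⋆ₙₐ[ℂ] (H →L[ℂ] H)) (ψ : C₀(X', ℂ) →⋆ₙₐ[ℂ] (K →L[ℂ] K))
    (F : X × X' →ᵇ ℂ) : HilbertTensor H K →L[ℂ] HilbertTensor H K :=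
  if h : ∃ Φ, IsTensorRep φ ψ Φ then h.choose F else 0

/-- The braided tensor product `M ⊠ N ⊆ B(H ⊗ K)` of von Neumann algebras `M`, `N` with actions of `G`,
`G'`, with respect to a bicharacter `χ` on the dual groups and implementations `U`, `V` of the actions:
the `σ`-weakly closed linear span of the products `ι_M(m) ι_N(n)`, where `ι_M(m) = 𝒳 (m ⊗ 1) 𝒳*`,
`ι_N(n) = 1 ⊗ n` and `𝒳 = (φ_M ⊗ φ_N)(χ)`. -/
def braidedTensorProduct (W : DualPairing G X) (W' : DualPairing G' X') (χ : Bicharacter X X')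
    {M : VonNeumannAlgebra H} {N : VonNeumannAlgebra K} {α : GroupAction G M}
    {β : GroupAction G' N} (U : Implementation α) (V : Implementation β) :
    Set (HilbertTensor H K →L[ℂ] HilbertTensor H K) :=
  let 𝒳 := tensorRep (integratedForm W U.toUnitaryRep) (integratedForm W' V.toUnitaryRep) χ.toBCF
  ultraweakSpan {T | ∃ m ∈ M, ∃ n ∈ N, T = (𝒳 * opTensor m 1 * star 𝒳) * opTensor 1 n}

/-- The crossed product `G ⋉ M` of an action of a discrete group, on `ℓ²(G; H)`: generated by the operators
`α(m)`, `(α(m) ξ)(k) = α_k(m) ξ(k)`, for `m ∈ M`, and the translations `λ_g ⊗ 1`, for `g ∈ G`. -/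
def crossedProduct [DiscreteTopology G] {M : VonNeumannAlgebra H} (α : GroupAction G M) :
    VonNeumannAlgebra (lp (fun _ : G => H) 2) :=
  generatedVN
    ({T | ∃ m, ∀ ξ k, T ξ k = (α.act k m : H →L[ℂ] H) (ξ k)} ∪
      {T | ∃ g, ∀ ξ k, T ξ k = ξ (k - g)})

end BraidedTensor

/-! ### The example -/

section Example

/-- The homomorphism `k ↦ k θ`. -/
def rotHom (θ : 𝕋) : ℤ →ₜ+ 𝕋 where
  toFun k := k • θ
  map_zero' := zero_smul ℤ θ
  map_add' k l := add_smul k l θ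
  continuous_toFun := continuous_of_discreteTopology

/-- `𝕋` acts on `M = L^∞(𝕋)` by translation and `ℤ` trivially: the action of `D(𝕋) = 𝕋 × ℤ` on `M`
is `α(f)((s, k), x) = f(x + s)`, with its implementation on `L²(𝕋)`. -/
def implM : Implementation (rotationAction (ContinuousAddMonoidHom.fst 𝕋 ℤ)) :=
  rotationImplementation _

/-- `ℤ` acts on `N = L^∞(𝕋)` by rotation by `θ` and `𝕋` trivially: the action of `D(𝕋) = 𝕋 × ℤ` on `N`
is `α(f)((s, k), x) = f(x + k θ)`, with its implementation on `L²(𝕋)`. -/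
def implN (θ : 𝕋) :
    Implementation (rotationAction ((rotHom θ).comp (ContinuousAddMonoidHom.snd 𝕋 ℤ))) :=
  rotationImplementation _

/-- The braided tensor product `M ⊠ N`, with respect to the `R`-matrix of `D(𝕋)`. -/
def braidedMN (θ : 𝕋) : Set (HilbertTensor L2T L2T →L[ℂ] HilbertTensor L2T L2T) :=
  braidedTensorProduct (drinfeldPairing torusPairing) (drinfeldPairing torusPairing)
    (rMatrix torusPairing) implM (implN θ)

/-- The braided tensor product `N ⊠ M`, with respect to the `R`-matrix of `D(𝕋)`. -/
def braidedNM (θ : 𝕋) : Set (HilbertTensor L2T L2T →L[ℂ] HilbertTensor L2T L2T) :=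
  braidedTensorProduct (drinfeldPairing torusPairing) (drinfeldPairing torusPairing)
    (rMatrix torusPairing) (implN θ) implM

end Example

end Braided

end

open Braided

/-!
In the Fourier basis `e_n` of `L²(𝕋)` the representations of `D(𝕋)` on `M` and on `N` are diagonal,
hence so are `φ_M` and `φ_N`: they evaluate functions on `ℤ × 𝕋` at the points `(-n, 0)` and `(0, n θ)`
(`integratedForm_implM`, `integratedForm_implN`). Hence `𝒳 = (φ_M ⊗ φ_N)(R)` is diagonal in the basis
`e_n ⊗ e_m` of `L²(𝕋) ⊗ L²(𝕋)`. For `M ⊠ N` its eigenvalues are all `1`. For `N ⊠ M` the eigenvalue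
at `e_n ⊗ e_m` is `exp(-2πi m n θ)`, that is, `𝒳` is the sum over `n` of the operators `p_n ⊗ U_n`,
where `p_n` is the projection onto `e_n` and `U_n` is the translation by `n θ`.

For `M ⊠ N` this leaves the `σ`-weakly closed span of the operators `m ⊗ n`. They form a unital
`*`-closed set that is closed under products, so the bicommutant theorem for the ultraweak topology
(`ultraweakSpan_eq_generatedVN`) identifies the span with the von Neumann tensor product.

For `N ⊠ M`, conjugation by `𝒳` turns `u_k ⊗ 1`, where `u_k` is multiplication by the `k`-th
exponential, into `u_k ⊗ U_k`. So `N ⊠ M` is spanned by the products `(u_k ⊗ U_k)(1 ⊗ u_j)`, which are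
multiples of the operators of the left regular representation of `ℤ²` twisted by the bicharacter
`(k, c) ↦ exp(-2πi k₁ c₂ θ)` (`isTwistedRegular_leftRot`). The right twisted regular representation
commutes with it, and each generates the commutant of the other (`IsTwistedRegular.coe_generatedVN_eq`),
by an application of Parseval's identity. The unitary `e_k ⊗ U_k ξ ↦ δ_k ⊗ ξ` of `L²(𝕋) ⊗ L²(𝕋)` onto
`ℓ²(ℤ; L²(𝕋))` carries the generators `1 ⊗ f` and `u_k ⊗ U_k` of `N ⊠ M` to those of the crossed product.

For irrational rotations the twist is nondegenerate. The vector `δ_0 = e_0 ⊗ e_0` is separating for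
`N ⊠ M` and defines a trace, so isometries are unitary, and central elements are scalars because they
have at most one nonzero Fourier coefficient. A minimal projection `p` is excluded by its conjugates
`p_a` under the unitaries of the representation: all `p_a δ_0` have the inner product `‖p δ_0‖²` with
`δ_0`, yet by minimality and Bessel's inequality a sum of `n` of them has norm at most `√n`
(`IsTwistedRegular.exists_not_smul`). For injectivity, the commutant of `N ⊠ M` is generated by two
unitaries that commute up to a scalar; averaging over the conjugations by the powers of one and then of
the other is a norm one projection onto `N ⊠ M`. Finally `M ⊠ N` is commutative, but `N ⊠ M` is not.
-/

set_option linter.unusedSectionVars false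

noncomputable section
namespace Braided

/-! ### Amplifications and the bicommutant theorem -/

section Bicommutant
variable {H K ι : Type*} [NormedAddCommGroup H] [InnerProductSpace ℂ H] [CompleteSpace H]
  [NormedAddCommGroup K] [InnerProductSpace ℂ K] [CompleteSpace K]

/-- Two vectors that have the same inner products with a total set of vectors are equal. -/
theorem eq_of_inner_left_of_dense {E : Type*} [NormedAddCommGroup E] [InnerProductSpace ℂ E]
    {s : Set E} (hs : Dense (Submodule.span ℂ s : Set E)) {x y : E}
    (h : ∀ v ∈ s, ⟪v, x⟫ = ⟪v, y⟫) : x = y := by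
  refine hs.eq_of_inner_right ℂ fun v hv => ?_
  induction hv using Submodule.span_induction with
  | mem v hv => exact h v hv
  | zero => simp
  | add v w _ _ hv hw => rw [inner_add_left, inner_add_left, hv, hw]
  | smul c v _ hv => rw [inner_smul_left, inner_smul_left, hv]

/-- `π` is an amplification of the operators on `H` to operators on `K`: a `*`-preserving map for which
`K` is spanned by the ranges of operators `J i : H → K` that intertwine `a` and `π a` for all `a`. -/
structure IsAmplification (J : ι → H →L[ℂ] K) (π : (H →L[ℂ] H) → (K →L[ℂ] K)) : Prop where
  dense : Dense (Submodule.span ℂ (⋃ i, Set.range (J i)) : Set K)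
  apply : ∀ a i ξ, π a (J i ξ) = J i (a ξ)
  star : ∀ a, π (star a) = star (π a)

/-- Amplification maps the bicommutant of `S` to the bicommutant of the amplification of `S`: if `Q`
commutes with `π a`, then its matrix entries `(J i)* Q (J j)` commute with `a`. -/
theorem IsAmplification.commute {J : ι → H →L[ℂ] K} {π : (H →L[ℂ] H) → (K →L[ℂ] K)}
    (hJ : IsAmplification J π) {S : Set (H →L[ℂ] H)} {T : H →L[ℂ] H}
    (hT : T ∈ S.centralizer.centralizer) {Q : K →L[ℂ] K} (hQ : ∀ a ∈ S, π a * Q = Q * π a) :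
    π T * Q = Q * π T := by
  have hadj (i : ι) (a : H →L[ℂ] H) (x : K) :
      ContinuousLinearMap.adjoint (J i) (π a x) = a (ContinuousLinearMap.adjoint (J i) x) := by
    refine ext_inner_left ℂ fun ξ => ?_
    rw [ContinuousLinearMap.adjoint_inner_right, ← ContinuousLinearMap.adjoint_inner_left,
      ← ContinuousLinearMap.star_eq_adjoint, ← hJ.star, hJ.apply,
      ← ContinuousLinearMap.adjoint_inner_right, ContinuousLinearMap.star_eq_adjoint,
      ContinuousLinearMap.adjoint_inner_left]
  have hent (i j : ι) :
      (ContinuousLinearMap.adjoint (J i)).comp (Q.comp (J j)) ∈ S.centralizer := by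
    intro a ha
    ext ξ
    have := DFunLike.congr_fun (hQ a ha) (J j ξ)
    simp only [ContinuousLinearMap.mul_def, ContinuousLinearMap.comp_apply] at this ⊢
    rw [← hadj, this, hJ.apply]
  have hcomm (i j : ι) (ξ : H) : ContinuousLinearMap.adjoint (J i) ((π T * Q) (J j ξ)) =
      ContinuousLinearMap.adjoint (J i) ((Q * π T) (J j ξ)) := by
    have := DFunLike.congr_fun (hT _ (hent i j)) ξ
    simp only [ContinuousLinearMap.mul_def, ContinuousLinearMap.comp_apply] at this ⊢
    rw [hadj, hJ.apply, this]
  refine ContinuousLinearMap.ext_on hJ.dense ?_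
  rintro _ ⟨_, ⟨j, rfl⟩, ξ, rfl⟩
  refine eq_of_inner_left_of_dense hJ.dense ?_
  rintro _ ⟨_, ⟨i, rfl⟩, η, rfl⟩
  rw [← ContinuousLinearMap.adjoint_inner_right, ← ContinuousLinearMap.adjoint_inner_right, hcomm]

theorem IsAmplification.mem_bicommutant_image {J : ι → H →L[ℂ] K}
    {π : (H →L[ℂ] H) → (K →L[ℂ] K)} (hJ : IsAmplification J π) {S : Set (H →L[ℂ] H)}
    {T : H →L[ℂ] H} (hT : T ∈ S.centralizer.centralizer) :
    π T ∈ (π '' S).centralizer.centralizer := fun _ hQ =>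
  (hJ.commute hT fun a ha => hQ (π a) ⟨a, ha, rfl⟩).symm

/-- The operator `a ⊗ 1` on `ℓ²(ι; H)`, `(ξ i) ↦ (a (ξ i))`. -/
def ampl (ι : Type*) (a : H →L[ℂ] H) : lp (fun _ : ι => H) 2 →L[ℂ] lp (fun _ : ι => H) 2 :=
  lp.mapCLM 2 (fun _ => a) (norm_nonneg a) fun _ => le_rfl

theorem ampl_apply (a : H →L[ℂ] H) (ξ : lp (fun _ : ι => H) 2) (i : ι) :
    ampl ι a ξ i = a (ξ i) := rfl

theorem dense_span_range_single [DecidableEq ι] : Dense (Submodule.span ℂ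
    (⋃ i, Set.range (lp.singleContinuousLinearMap ℂ (fun _ : ι => H) 2 i)) :
      Set (lp (fun _ : ι => H) 2)) := by
  intro ξ
  refine mem_closure_of_tendsto (lp.hasSum_single (by norm_num) ξ) (Filter.Eventually.of_forall ?_)
  intro s
  exact Submodule.sum_mem _ fun i _ =>
    Submodule.subset_span (Set.mem_iUnion.2 ⟨i, ξ i, rfl⟩)

theorem isAmplification_ampl [DecidableEq ι] :
    IsAmplification (lp.singleContinuousLinearMap ℂ (fun _ : ι => H) 2) (ampl ι) where
  dense := dense_span_range_single
  apply a i ξ := by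
    ext j
    rw [ampl_apply, lp.singleContinuousLinearMap_apply, lp.singleContinuousLinearMap_apply,
      lp.single_apply, lp.single_apply]
    by_cases h : j = i
    · subst h; simp
    · simp [h]
  star a := by
    rw [ContinuousLinearMap.star_eq_adjoint, ContinuousLinearMap.star_eq_adjoint,
      ContinuousLinearMap.eq_adjoint_iff]
    intro ξ η
    simp only [lp.inner_eq_tsum, ampl_apply, ContinuousLinearMap.adjoint_inner_left]

/-- For a unital `*`-closed set `S` of operators closed under products, the bicommutant of `S` maps `ξ`
into the closure of the span of the orbit `S ξ`: the projection onto that closure commutes with `S`. -/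
theorem apply_mem_closure_of_mem_bicommutant {S : Set (H →L[ℂ] H)} (h1 : 1 ∈ S)
    (hmul : ∀ a ∈ S, ∀ b ∈ S, a * b ∈ S) (hstar : ∀ a ∈ S, star a ∈ S) {T : H →L[ℂ] H}
    (hT : T ∈ S.centralizer.centralizer) (ξ : H) :
    T ξ ∈ closure (Submodule.span ℂ ((fun a : H →L[ℂ] H => a ξ) '' S) : Set H) := by
  set C := (Submodule.span ℂ ((fun a : H →L[ℂ] H => a ξ) '' S)).topologicalClosure with hC
  have : CompleteSpace C := (Submodule.isClosed_topologicalClosure _).completeSpace_coe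
  have hinv (a) (ha : a ∈ S) (x) (hx : x ∈ C) : a x ∈ C := by
    have hmaps : Set.MapsTo a
        (Submodule.span ℂ ((fun a : H →L[ℂ] H => a ξ) '' S) : Set H)
        (Submodule.span ℂ ((fun a : H →L[ℂ] H => a ξ) '' S) : Set H) := by
      intro y hy
      induction hy using Submodule.span_induction with
      | mem y hy =>
        obtain ⟨b, hb, rfl⟩ := hy
        exact Submodule.subset_span ⟨a * b, hmul a ha b hb, rfl⟩
      | zero => simp
      | add y z _ _ hy hz => rw [map_add]; exact Submodule.add_mem _ hy hz
      | smul c y _ hy => rw [map_smul]; exact Submodule.smul_mem _ c hy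
    exact map_mem_closure a.continuous hx hmaps
  have hQ : C.starProjection ∈ S.centralizer := by
    intro a ha
    have hidem : IsIdempotentElem C.starProjection := isStarProjection_starProjection.isIdempotentElem
    refine (((ContinuousLinearMap.IsIdempotentElem.commute_iff hidem).2 ⟨?_, ?_⟩).eq).symm
    · rw [Submodule.range_starProjection]
      exact fun x hx => hinv a ha x hx
    · rw [Submodule.ker_starProjection]
      intro x hx
      change a x ∈ Cᗮ
      rw [Submodule.mem_orthogonal] at hx ⊢
      intro u hu
      rw [← ContinuousLinearMap.adjoint_inner_left]
      exact hx _ (hinv _ (hstar a ha) u hu)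
  have hξ : ξ ∈ C := Submodule.le_topologicalClosure _ (Submodule.subset_span ⟨1, h1, rfl⟩)
  have := DFunLike.congr_fun (hT _ hQ) ξ
  simp only [ContinuousLinearMap.mul_def, ContinuousLinearMap.comp_apply,
    Submodule.starProjection_eq_self_iff.2 hξ] at this
  exact Submodule.starProjection_eq_self_iff.1 this

theorem continuous_ultraweak (ξ η : lp (fun _ : ℕ => H) 2) :
    @Continuous _ _ (ultraweakTopology H) _ fun T : H →L[ℂ] H => ∑' n, ⟪ξ n, T (η n)⟫ :=
  continuous_iff_le_induced.2 ((iInf_le _ ξ).trans (iInf_le _ η))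

theorem continuous_ultraweak_inner (ξ η : H) :
    @Continuous _ _ (ultraweakTopology H) _ fun T : H →L[ℂ] H => ⟪ξ, T η⟫ := by
  convert continuous_ultraweak (lp.single 2 0 ξ) (lp.single 2 0 η) using 2 with T
  rw [tsum_eq_single 0 fun n hn => by rw [lp.single_apply_ne _ _ _ hn, inner_zero_left],
    lp.single_apply_self, lp.single_apply_self]

theorem isClosed_centralizer_ultraweak (S : Set (H →L[ℂ] H)) :
    @IsClosed _ (ultraweakTopology H) S.centralizer := by
  let _ := ultraweakTopology H
  have : S.centralizer = ⋂ a ∈ S, ⋂ ξ : H, ⋂ η : H,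
      {T : H →L[ℂ] H | ⟪ContinuousLinearMap.adjoint a ξ, T η⟫ = ⟪ξ, T (a η)⟫} := by
    ext T
    simp only [Set.mem_iInter, Set.mem_ofPred_eq, Set.mem_centralizer_iff,
      ContinuousLinearMap.adjoint_inner_left]
    refine forall₂_congr fun a _ => ⟨fun h ξ η => ?_, fun h => ?_⟩
    · exact congrArg (fun A : H →L[ℂ] H => ⟪ξ, A η⟫) h
    · ext η
      exact ext_inner_left ℂ fun ξ => h ξ η
  rw [this]
  refine isClosed_biInter fun a _ => isClosed_iInter fun ξ => isClosed_iInter fun η => ?_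
  exact isClosed_eq (continuous_ultraweak_inner _ _) (continuous_ultraweak_inner _ _)

theorem isClosed_ultraweak_coe (P : VonNeumannAlgebra H) :
    @IsClosed _ (ultraweakTopology H) (P : Set (H →L[ℂ] H)) := by
  rw [← P.centralizer_centralizer]
  exact isClosed_centralizer_ultraweak _

theorem ultraweakSpan_subset {S : Set (H →L[ℂ] H)} {P : VonNeumannAlgebra H}
    (h : S ⊆ (P : Set (H →L[ℂ] H))) : ultraweakSpan S ⊆ (P : Set (H →L[ℂ] H)) := by
  let _ := ultraweakTopology H
  refine closure_minimal ?_ (isClosed_ultraweak_coe P)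
  intro T hT
  exact (Submodule.span_le (p := P.toStarSubalgebra.toSubalgebra.toSubmodule)).2 h hT

theorem ultraweakSpan_mono {S S' : Set (H →L[ℂ] H)}
    (h : S ⊆ (Submodule.span ℂ S' : Set (H →L[ℂ] H))) : ultraweakSpan S ⊆ ultraweakSpan S' := by
  let _ := ultraweakTopology H
  exact closure_mono (Submodule.span_le.2 h)

theorem subset_generatedVN (S : Set (H →L[ℂ] H)) : S ⊆ (generatedVN S : Set (H →L[ℂ] H)) := by
  rw [coe_generatedVN]
  exact fun a ha => Set.subset_centralizer_centralizer (Or.inl ha)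

theorem generatedVN_subset {S : Set (H →L[ℂ] H)} {P : VonNeumannAlgebra H}
    (h : S ⊆ (P : Set (H →L[ℂ] H))) :
    (generatedVN S : Set (H →L[ℂ] H)) ⊆ (P : Set (H →L[ℂ] H)) := by
  rw [coe_generatedVN, ← P.centralizer_centralizer]
  refine Set.centralizer_subset (Set.centralizer_subset (Set.union_subset h fun a ha => ?_))
  rw [← star_star a]
  exact star_mem (h ha)

/-- The bicommutant theorem: for a unital `*`-closed set `S` of operators closed under products, the
von Neumann algebra generated by `S` is the ultraweak closure of the span of `S`. -/
theorem ultraweakSpan_eq_generatedVN {S : Set (H →L[ℂ] H)} (h1 : 1 ∈ S)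
    (hmul : ∀ a ∈ S, ∀ b ∈ S, a * b ∈ S) (hstar : ∀ a ∈ S, star a ∈ S) :
    ultraweakSpan S = (generatedVN S : Set (H →L[ℂ] H)) := by
  classical
  refine Set.Subset.antisymm (ultraweakSpan_subset (subset_generatedVN S)) fun T hT => ?_
  have hSS : S ∪ star S = S := Set.union_eq_left.2 fun a ha => star_star a ▸ hstar _ ha
  rw [coe_generatedVN, hSS] at hT
  have htop : ultraweakTopology H = TopologicalSpace.induced
      (fun (T : H →L[ℂ] H) (p : lp (fun _ : ℕ => H) 2 × lp (fun _ : ℕ => H) 2) =>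
        ∑' n, ⟪p.1 n, T (p.2 n)⟫) Pi.topologicalSpace := by
    rw [induced_to_pi, iInf_prod]
  rw [ultraweakSpan, htop, closure_induced, mem_closure_iff_nhds]
  intro t ht
  rw [nhds_pi, Filter.mem_pi'] at ht
  obtain ⟨I, u, hu, hut⟩ := ht
  -- the finitely many vectors `η` of the neighbourhood are the components of one vector `v`
  let v : lp (fun _ : I => lp (fun _ : ℕ => H) 2) 2 := ⟨fun i => i.1.2, Memℓp.all _⟩
  let π : (H →L[ℂ] H) → _ := fun a => ampl I (ampl ℕ a)
  have hπT : π T ∈ (π '' S).centralizer.centralizer := by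
    have := isAmplification_ampl (ι := I).mem_bicommutant_image
      (isAmplification_ampl (ι := ℕ).mem_bicommutant_image hT)
    rwa [Set.image_image] at this
  have hπmul (a b : H →L[ℂ] H) : π (a * b) = π a * π b := rfl
  have hπ1 : π 1 = 1 := rfl
  have hπstar (a : H →L[ℂ] H) : π (star a) = star (π a) := by
    simp only [π]; rw [isAmplification_ampl.star, isAmplification_ampl.star]
  have hcl := apply_mem_closure_of_mem_bicommutant (S := π '' S) ⟨1, h1, hπ1⟩
    (by rintro _ ⟨a, ha, rfl⟩ _ ⟨b, hb, rfl⟩; exact ⟨a * b, hmul a ha b hb, hπmul a b⟩)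
    (by rintro _ ⟨a, ha, rfl⟩; exact ⟨star a, hstar a ha, hπstar a⟩) hπT v
  have hinner (a : H →L[ℂ] H) (i : I) :
      ⟪i.1.1, π a v i⟫ = ∑' n, ⟪i.1.1 n, a (i.1.2 n)⟫ := lp.inner_eq_tsum _ _
  have hnhds : (⋂ i : I, {w : lp (fun _ : I => lp (fun _ : ℕ => H) 2) 2 | ⟪i.1.1, w i⟫ ∈ u i}) ∈
      nhds (π T v) := by
    refine Filter.iInter_mem.2 fun i => ?_
    have hc : Continuous fun w : lp (fun _ : I => lp (fun _ : ℕ => H) 2) 2 => ⟪i.1.1, w i⟫ :=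
      continuous_const.inner (lp.evalCLM ℂ (fun _ : I => lp (fun _ : ℕ => H) 2) 2 i).continuous
    refine hc.continuousAt.preimage_mem_nhds ?_
    rw [hinner]
    exact hu i
  obtain ⟨w, hw, hwS⟩ := mem_closure_iff_nhds.1 hcl _ hnhds
  have hspan : ∃ a ∈ Submodule.span ℂ S, π a v = w := by
    clear hw
    induction hwS using Submodule.span_induction with
    | mem y hy =>
      obtain ⟨_, ⟨a, ha, rfl⟩, rfl⟩ := hy
      exact ⟨a, Submodule.subset_span ha, rfl⟩
    | zero => exact ⟨0, Submodule.zero_mem _, rfl⟩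
    | add y z _ _ hy hz =>
      obtain ⟨a, ha, rfl⟩ := hy
      obtain ⟨b, hb, rfl⟩ := hz
      exact ⟨a + b, Submodule.add_mem _ ha hb, rfl⟩
    | smul c y _ hy =>
      obtain ⟨a, ha, rfl⟩ := hy
      exact ⟨c • a, Submodule.smul_mem _ c ha, rfl⟩
  obtain ⟨a, ha, rfl⟩ := hspan
  refine ⟨_, hut fun i hi => ?_, a, ha, rfl⟩
  have := Set.mem_iInter.1 hw ⟨i, hi⟩
  rw [Set.mem_ofPred_eq, hinner] at this
  exact this

/-- A von Neumann algebra generated by a commutative `*`-closed set is commutative. -/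
theorem generatedVN_comm {S : Set (H →L[ℂ] H)} (hstar : ∀ a ∈ S, star a ∈ S)
    (hcomm : ∀ a ∈ S, ∀ b ∈ S, a * b = b * a) {x y : H →L[ℂ] H} (hx : x ∈ generatedVN S)
    (hy : y ∈ generatedVN S) : x * y = y * x := by
  have hSS : S ∪ star S = S := Set.union_eq_left.2 fun a ha => star_star a ▸ hstar _ ha
  rw [← SetLike.mem_coe, coe_generatedVN, hSS] at hx hy
  have hS : S ⊆ S.centralizer := fun a ha b hb => hcomm b hb a ha
  exact hy x (Set.centralizer_subset hS hx)

end Bicommutant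

/-! ### Averaging over commuting unitaries -/

section Averaging
open Filter Topology
variable {H : Type*} [NormedAddCommGroup H] [InnerProductSpace ℂ H] [CompleteSpace H]

/-- Bounded sequences of operators converge weakly along ultrafilters. -/
theorem exists_weak_limit (l : Ultrafilter ℕ) (T : ℕ → H →L[ℂ] H) (C : ℝ) (hC : ∀ n, ‖T n‖ ≤ C) :
    ∃ L : H →L[ℂ] H, ‖L‖ ≤ C ∧ ∀ ξ η, Tendsto (fun n => ⟪ξ, T n η⟫) l (𝓝 ⟪ξ, L η⟫) := by
  have hC0 : 0 ≤ C := (norm_nonneg _).trans (hC 0)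
  have hbd (ξ η : H) (n : ℕ) : ‖⟪ξ, T n η⟫‖ ≤ C * ‖ξ‖ * ‖η‖ := by
    calc ‖⟪ξ, T n η⟫‖ ≤ ‖ξ‖ * ‖T n η‖ := norm_inner_le_norm _ _
      _ ≤ ‖ξ‖ * (C * ‖η‖) := by gcongr; exact (T n).le_of_opNorm_le (hC n) η
      _ = C * ‖ξ‖ * ‖η‖ := by ring
  have hex (ξ η : H) : ∃ z, Tendsto (fun n => ⟪ξ, T n η⟫) l (𝓝 z) := by
    obtain ⟨z, -, hz⟩ := (isCompact_closedBall (0 : ℂ) (C * ‖ξ‖ * ‖η‖)).ultrafilter_le_nhds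
      (l.map fun n => ⟪ξ, T n η⟫) (by
        rw [le_principal_iff]
        exact Filter.mem_map.2 (Filter.Eventually.of_forall fun n => by
          simpa using hbd ξ η n))
    exact ⟨z, hz⟩
  choose B hB using hex
  let B' : H →L⋆[ℂ] H →L[ℂ] ℂ := LinearMap.mkContinuous₂
    (LinearMap.mk₂'ₛₗ (starRingEnd ℂ) (RingHom.id ℂ) B
      (fun ξ ξ' η => tendsto_nhds_unique (hB _ _) (by
        simpa only [inner_add_left] using (hB ξ η).add (hB ξ' η)))
      (fun c ξ η => tendsto_nhds_unique (hB _ _) (by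
        simpa only [inner_smul_left, smul_eq_mul] using (hB ξ η).const_mul (starRingEnd ℂ c)))
      (fun ξ η η' => tendsto_nhds_unique (hB _ _) (by
        simpa only [map_add, inner_add_right] using (hB ξ η).add (hB ξ η')))
      (fun c ξ η => tendsto_nhds_unique (hB _ _) (by
        simpa only [map_smul, inner_smul_right, smul_eq_mul, RingHom.id_apply] using (hB ξ η).const_mul c)))
    C (fun ξ η => le_of_tendsto (hB ξ η).norm (Eventually.of_forall (hbd ξ η)))
  have hL (ξ η : H) :
      ⟪ξ, ContinuousLinearMap.adjoint (InnerProductSpace.continuousLinearMapOfBilin B') η⟫ =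
        B ξ η := by
    rw [ContinuousLinearMap.adjoint_inner_right,
      InnerProductSpace.continuousLinearMapOfBilin_apply]
    rfl
  refine ⟨ContinuousLinearMap.adjoint (InnerProductSpace.continuousLinearMapOfBilin B'), ?_,
    fun ξ η => by rw [hL]; exact hB ξ η⟩
  refine ContinuousLinearMap.opNorm_le_of_re_inner_le hC0 fun η ξ hη hξ => ?_
  rw [← inner_conj_symm, RCLike.conj_re, hL]
  refine (RCLike.re_le_norm _).trans
    (le_of_tendsto (hB ξ η).norm (Eventually.of_forall fun n => ?_))
  simpa [hη, hξ] using hbd ξ η n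

/-- The averages `(N + 1)⁻¹ ∑ k ≤ N, S^k x S*^k`. -/
def conjAverage (S x : H →L[ℂ] H) (N : ℕ) : H →L[ℂ] H :=
  ((N : ℂ) + 1)⁻¹ • ∑ k ∈ Finset.range (N + 1), S ^ k * x * star S ^ k

variable {S : H →L[ℂ] H}

theorem norm_le_one_of_isometry (hS : star S * S = 1) : ‖S‖ ≤ 1 := by
  have h := CStarRing.norm_star_mul_self (x := S)
  rw [hS] at h
  have h1 : ‖(1 : H →L[ℂ] H)‖ ≤ 1 := ContinuousLinearMap.norm_id_le
  nlinarith [norm_nonneg S]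

theorem norm_conj_pow_le (hS : star S * S = 1) (x : H →L[ℂ] H) (k : ℕ) :
    ‖S ^ k * x * star S ^ k‖ ≤ ‖x‖ := by
  have h1 : ‖S‖ ≤ 1 := norm_le_one_of_isometry hS
  induction k with
  | zero => simp
  | succ k ih =>
    have : S ^ (k + 1) * x * star S ^ (k + 1) = S * (S ^ k * x * star S ^ k) * star S := by
      rw [pow_succ', pow_succ]; simp only [mul_assoc]
    rw [this]
    calc _ ≤ ‖S‖ * ‖S ^ k * x * star S ^ k‖ * ‖star S‖ :=
          (norm_mul_le _ _).trans (by gcongr; exact norm_mul_le _ _)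
      _ ≤ 1 * ‖x‖ * 1 := by
          gcongr
          rw [norm_star]; exact h1
      _ = ‖x‖ := by ring

theorem norm_conjAverage_le (hS : star S * S = 1) (x : H →L[ℂ] H) (N : ℕ) :
    ‖conjAverage S x N‖ ≤ ‖x‖ := by
  have h : ‖∑ k ∈ Finset.range (N + 1), S ^ k * x * star S ^ k‖ ≤ (N + 1) * ‖x‖ := by
    refine (norm_sum_le_of_le _ fun k _ => norm_conj_pow_le hS x k).trans ?_
    simp
  have hN : ‖((N : ℂ) + 1)⁻¹‖ = ((N : ℝ) + 1)⁻¹ := by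
    rw [norm_inv]
    norm_cast
  rw [conjAverage, norm_smul, hN]
  calc ((N : ℝ) + 1)⁻¹ * ‖∑ k ∈ Finset.range (N + 1), S ^ k * x * star S ^ k‖
      ≤ ((N : ℝ) + 1)⁻¹ * ((N + 1) * ‖x‖) := by gcongr
    _ = ‖x‖ := by field_simp

theorem conj_conjAverage_sub (x : H →L[ℂ] H) (N : ℕ) :
    S * conjAverage S x N * star S - conjAverage S x N =
      ((N : ℂ) + 1)⁻¹ • (S ^ (N + 1) * x * star S ^ (N + 1) - x) := by
  have h (k : ℕ) : S * (S ^ k * x * star S ^ k) * star S =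
      S ^ (k + 1) * x * star S ^ (k + 1) := by
    rw [pow_succ', pow_succ]; simp only [mul_assoc]
  rw [conjAverage, mul_smul_comm, smul_mul_assoc, ← smul_sub, Finset.mul_sum, Finset.sum_mul]
  simp only [h]
  rw [← Finset.sum_sub_distrib,
    Finset.sum_range_sub (fun k => S ^ k * x * star S ^ k)]
  simp

/-- For a unitary `S`, an invariant mean over the powers of `S` gives a norm one projection of `B(H)`
onto the commutant of `S`. It preserves the commutants of the operators commuting with `S` up to a
scalar. -/
theorem exists_average (hS : star S * S = 1) (hS' : S * star S = 1) :
    ∃ E : (H →L[ℂ] H) →ₗ[ℂ] (H →L[ℂ] H), (∀ x, ‖E x‖ ≤ ‖x‖) ∧ (∀ x, S * E x = E x * S) ∧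
      (∀ x, S * x = x * S → E x = x) ∧
      ∀ (A : H →L[ℂ] H) (c : ℂ), A * S = c • (S * A) → A * star S = c⁻¹ • (star S * A) → c ≠ 0 →
        ∀ x, A * x = x * A → A * E x = E x * A := by
  choose L hLn hL using fun x : H →L[ℂ] H => exists_weak_limit (Filter.hyperfilter ℕ)
    (conjAverage S x) ‖x‖ (norm_conjAverage_le hS x)
  have hle : ((Filter.hyperfilter ℕ : Ultrafilter ℕ) : Filter ℕ) ≤ atTop :=
    Nat.hyperfilter_le_atTop
  have huniq (x y : H →L[ℂ] H)
      (h : ∀ ξ η, Tendsto (fun n => ⟪ξ, conjAverage S x n η⟫) (Filter.hyperfilter ℕ) (𝓝 ⟪ξ, y η⟫)) :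
      L x = y := by
    ext η
    exact ext_inner_left ℂ fun ξ => tendsto_nhds_unique (hL x ξ η) (h ξ η)
  refine ⟨{ toFun := L, map_add' := fun x y => ?_, map_smul' := fun c x => ?_ }, hLn, fun x => ?_,
    fun x hx => ?_, fun A c hA hA' hc x hx => ?_⟩
  · refine huniq _ _ fun ξ η => ?_
    have hadd (n : ℕ) : conjAverage S (x + y) n = conjAverage S x n + conjAverage S y n := by
      simp only [conjAverage, mul_add, add_mul, Finset.sum_add_distrib, smul_add]
    simpa only [hadd, add_apply, inner_add_right] using
      (hL x ξ η).add (hL y ξ η)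
  · refine huniq _ _ fun ξ η => ?_
    have hsmul (n : ℕ) : conjAverage S (c • x) n = c • conjAverage S x n := by
      simp only [conjAverage, mul_smul_comm, smul_mul_assoc, ← Finset.smul_sum]
      rw [smul_comm]
    simpa only [hsmul, smul_apply, inner_smul_right, RingHom.id_apply] using
      (hL x ξ η).const_mul c
  · change S * L x = L x * S
    have hinv : S * L x * star S = L x := by
      refine (huniq x _ fun ξ η => ?_).symm
      have h1 := hL x (ContinuousLinearMap.adjoint S ξ) (star S η)
      simp only [ContinuousLinearMap.adjoint_inner_left] at h1
      have h2 : Tendsto (fun n : ℕ => ⟪ξ, (((n : ℂ) + 1)⁻¹ •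
          (S ^ (n + 1) * x * star S ^ (n + 1) - x)) η⟫) atTop (𝓝 0) := by
        have h3 : Tendsto (fun n : ℕ => 1 / ((n : ℝ) + 1) * (‖ξ‖ * ((‖x‖ + ‖x‖) * ‖η‖))) atTop
            (𝓝 0) := by
          simpa using tendsto_one_div_add_atTop_nhds_zero_nat.mul_const
            (‖ξ‖ * ((‖x‖ + ‖x‖) * ‖η‖))
        refine squeeze_zero_norm (fun n => ?_) h3
        have hN : ‖((n : ℂ) + 1)⁻¹‖ = 1 / ((n : ℝ) + 1) := by
          rw [norm_inv, one_div]; norm_cast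
        rw [smul_apply, inner_smul_right, norm_mul, hN]
        gcongr
        refine (norm_inner_le_norm _ _).trans ?_
        gcongr
        refine ContinuousLinearMap.le_of_opNorm_le _ ?_ η
        exact (norm_sub_le _ _).trans (add_le_add_left (norm_conj_pow_le hS x _) _)
      have h4 := h1.sub (h2.mono_left hle)
      rw [sub_zero] at h4
      refine h4.congr fun n => ?_
      rw [← conj_conjAverage_sub]
      simp only [sub_apply, inner_sub_right, ContinuousLinearMap.mul_def,
        ContinuousLinearMap.comp_apply, sub_sub_cancel]
    calc S * L x = S * L x * (star S * S) := by rw [hS, mul_one]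
      _ = S * L x * star S * S := by simp only [mul_assoc]
      _ = L x * S := by rw [hinv]
  · refine huniq _ _ fun ξ η => ?_
    have hk (k : ℕ) : S ^ k * x * star S ^ k = x := by
      have hx' : S ^ k * x = x * S ^ k := (Commute.pow_left (show Commute S x from hx) k).eq
      have hk1 : S ^ k * star S ^ k = 1 := by
        rw [← Commute.mul_pow (hS'.trans hS.symm), hS', one_pow]
      rw [hx', mul_assoc, hk1, mul_one]
    have hn (n : ℕ) : conjAverage S x n = x := by
      simp only [conjAverage, hk, Finset.sum_const, Finset.card_range, ← Nat.cast_smul_eq_nsmul ℂ,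
        smul_smul]
      rw [Nat.cast_add, Nat.cast_one, inv_mul_cancel₀ (Nat.cast_add_one_ne_zero n), one_smul]
    simp only [hn]
    exact tendsto_const_nhds
  · change A * L x = L x * A
    have hk (k : ℕ) : A * (S ^ k * x * star S ^ k) = S ^ k * x * star S ^ k * A := by
      induction k with
      | zero => simpa using hx
      | succ k ih =>
        have : S ^ (k + 1) * x * star S ^ (k + 1) = S * (S ^ k * x * star S ^ k) * star S := by
          rw [pow_succ', pow_succ]; simp only [mul_assoc]
        rw [this]
        generalize S ^ k * x * star S ^ k = y at ih
        calc A * (S * y * star S) = A * S * y * star S := by simp only [mul_assoc]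
          _ = c • (S * (A * y) * star S) := by rw [hA]; simp only [smul_mul_assoc, mul_assoc]
          _ = c • (S * y * (A * star S)) := by rw [ih]; simp only [mul_assoc]
          _ = S * y * star S * A := by
            rw [hA', mul_smul_comm, smul_smul, mul_inv_cancel₀ hc, one_smul]
            simp only [mul_assoc]
    have hn (n : ℕ) : A * conjAverage S x n = conjAverage S x n * A := by
      simp only [conjAverage, mul_smul_comm, smul_mul_assoc, Finset.mul_sum, Finset.sum_mul, hk]
    ext η
    refine ext_inner_left ℂ fun ξ => ?_
    have h1 := hL x (ContinuousLinearMap.adjoint A ξ) η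
    simp only [ContinuousLinearMap.adjoint_inner_left] at h1
    refine tendsto_nhds_unique h1 ((hL x ξ (A η)).congr fun n => ?_)
    exact congrArg (fun T : H →L[ℂ] H => ⟪ξ, T η⟫) (hn n).symm

/-- A von Neumann algebra whose commutant is generated by two unitaries that commute up to a scalar is
injective. -/
theorem isInjectiveVN_of_unitaries {P : VonNeumannAlgebra H} {S₁ S₂ : H →L[ℂ] H} {c : ℂ}
    (h₁ : star S₁ * S₁ = 1) (h₁' : S₁ * star S₁ = 1) (h₂ : star S₂ * S₂ = 1)
    (h₂' : S₂ * star S₂ = 1) (hc : c ≠ 0) (h₁₂ : S₁ * S₂ = c • (S₂ * S₁))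
    (hP : ∀ x, x ∈ P ↔ S₁ * x = x * S₁ ∧ S₂ * x = x * S₂) : IsInjectiveVN P := by
  obtain ⟨E₁, hn₁, hS₁, hf₁, -⟩ := exists_average h₁ h₁'
  obtain ⟨E₂, hn₂, hS₂, hf₂, hA₂⟩ := exists_average h₂ h₂'
  have hstar : S₁ * star S₂ = c⁻¹ • (star S₂ * S₁) := by
    have : star S₂ * (S₁ * S₂) * star S₂ = star S₂ * (c • (S₂ * S₁)) * star S₂ := by rw [h₁₂]
    rw [mul_smul_comm, smul_mul_assoc,
      show star S₂ * (S₁ * S₂) * star S₂ = star S₂ * S₁ * (S₂ * star S₂) by simp only [mul_assoc],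
      show star S₂ * (S₂ * S₁) * star S₂ = star S₂ * S₂ * (S₁ * star S₂) by simp only [mul_assoc],
      h₂, h₂', mul_one, one_mul] at this
    rw [this, smul_smul, inv_mul_cancel₀ hc, one_smul]
  refine ⟨E₂ ∘ₗ E₁, fun x => ?_, fun x hx => ?_, fun x => ?_⟩
  · exact (hP _).2 ⟨hA₂ S₁ c h₁₂ hstar hc _ (hS₁ x), hS₂ _⟩
  · rw [LinearMap.comp_apply, hf₁ x ((hP x).1 hx).1, hf₂ x ((hP x).1 hx).2]
  · exact (hn₂ _).trans (hn₁ x)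

end Averaging

/-! ### Twisted regular representations of abelian groups -/

section Twisted
variable {G H : Type*} [AddCommGroup G] [TopologicalSpace G] [NormedAddCommGroup H]
  [InnerProductSpace ℂ H] [CompleteSpace H]

theorem inner_mul_eq (A B : H →L[ℂ] H) (ξ η : H) : ⟪ξ, (A * B) η⟫ = ⟪star A ξ, B η⟫ := by
  rw [ContinuousLinearMap.star_eq_adjoint, ContinuousLinearMap.adjoint_inner_left]; rfl

theorem HilbertBasis.operator_ext {ι : Type*} (b : HilbertBasis ι ℂ H) {S T : H →L[ℂ] H}
    (h : ∀ i, S (b i) = T (b i)) : S = T := by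
  refine ContinuousLinearMap.ext_on (s := Set.range b)
    (Submodule.dense_iff_topologicalClosure_eq_top.2 b.dense_span) ?_
  rintro _ ⟨i, rfl⟩
  exact h i

theorem HilbertBasis.ext_inner {ι : Type*} (b : HilbertBasis ι ℂ H) {x y : H}
    (h : ∀ i, ⟪b i, x⟫ = ⟪b i, y⟫) : x = y := by
  refine eq_of_inner_left_of_dense
    (Submodule.dense_iff_topologicalClosure_eq_top.2 b.dense_span) ?_
  rintro _ ⟨i, rfl⟩
  exact h i

/-- The bicharacter with exchanged arguments. -/
def Bicharacter.flip (σ : Bicharacter G G) : Bicharacter G G where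
  toFun a c := σ.toFun c a
  map_add_left _ _ _ := σ.map_add_right _ _ _
  map_add_right _ _ _ := σ.map_add_left _ _ _
  continuous_toFun := σ.continuous_toFun.comp continuous_swap

/-- `L` is the regular representation of the abelian group `G` twisted by the bicharacter `σ`:
`L a δ_c = σ(a, c) δ_{a + c}`, for an orthonormal basis `δ` indexed by `G`. The operators of the right
regular representation are those for the bicharacter `σ.flip`; they commute with those for `σ`. -/
def IsTwistedRegular (b : HilbertBasis G ℂ H) (σ : Bicharacter G G) (L : G → H →L[ℂ] H) : Prop :=
  ∀ a c, L a (b c) = (σ.toFun a c : ℂ) • b (a + c)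

namespace IsTwistedRegular
variable {b : HilbertBasis G ℂ H} {σ : Bicharacter G G} {L R : G → H →L[ℂ] H}

theorem apply_zero (hL : IsTwistedRegular b σ L) (a : G) : L a (b 0) = b a := by
  rw [hL, σ.zero_right, Circle.coe_one, one_smul, add_zero]

theorem zero (hL : IsTwistedRegular b σ L) : L 0 = 1 := by
  refine b.operator_ext fun c => ?_
  rw [hL, σ.zero_left, Circle.coe_one, one_smul, zero_add]; rfl

theorem mul (hL : IsTwistedRegular b σ L) (a d : G) :
    L a * L d = (σ.toFun a d : ℂ) • L (a + d) := by
  refine b.operator_ext fun c => ?_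
  change L a (L d (b c)) = (σ.toFun a d : ℂ) • L (a + d) (b c)
  rw [hL, map_smul, hL, hL, σ.map_add_right, σ.map_add_left, smul_smul, smul_smul, add_assoc]
  congr 1
  push_cast
  ring

theorem star_eq (hL : IsTwistedRegular b σ L) (a : G) :
    star (L a) = (σ.toFun a a : ℂ) • L (-a) := by
  classical
  refine b.operator_ext fun c => b.ext_inner fun d => ?_
  rw [ContinuousLinearMap.star_eq_adjoint, ContinuousLinearMap.adjoint_inner_right, hL, smul_apply,
    hL, inner_smul_left, inner_smul_right, inner_smul_right,
    orthonormal_iff_ite.1 b.orthonormal, orthonormal_iff_ite.1 b.orthonormal]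
  by_cases h : d = -a + c
  · have h' : a + d = c := by rw [h]; abel
    rw [if_pos h', if_pos h, ← h', σ.map_add_right, σ.neg_left, σ.neg_left, ← Circle.coe_inv_eq_conj]
    rw [mul_one, mul_one, ← Circle.coe_mul]
    congr 1
    rw [mul_inv_cancel_left]
  · have h' : ¬ a + d = c := fun e => h (by rw [← e]; abel)
    rw [if_neg h', if_neg h]
    simp

theorem star_mul_self (hL : IsTwistedRegular b σ L) (a : G) : star (L a) * L a = 1 := by
  rw [hL.star_eq, smul_mul_assoc, hL.mul, neg_add_cancel, hL.zero, smul_smul, σ.neg_left,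
    ← Circle.coe_mul, mul_inv_cancel, Circle.coe_one, one_smul]

theorem mul_star_self (hL : IsTwistedRegular b σ L) (a : G) : L a * star (L a) = 1 := by
  rw [hL.star_eq, mul_smul_comm, hL.mul, add_neg_cancel, hL.zero, smul_smul, σ.neg_right,
    ← Circle.coe_mul, mul_inv_cancel, Circle.coe_one, one_smul]

theorem inner_apply (hL : IsTwistedRegular b σ L) (a : G) (ξ η : H) : ⟪L a ξ, L a η⟫ = ⟪ξ, η⟫ := by
  rw [← ContinuousLinearMap.adjoint_inner_right]
  exact congrArg (fun T : H →L[ℂ] H => ⟪ξ, T η⟫) (hL.star_mul_self a)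

theorem star_apply_zero (hL : IsTwistedRegular b σ L) (a : G) :
    star (L a) (b 0) = (σ.toFun a a : ℂ) • b (-a) := by
  rw [hL.star_eq, smul_apply, hL.apply_zero]

theorem mul_comm_right (hL : IsTwistedRegular b σ L) (hR : IsTwistedRegular b σ.flip R) (a d : G) :
    L a * R d = R d * L a := by
  refine b.operator_ext fun c => ?_
  change L a (R d (b c)) = R d (L a (b c))
  rw [hR, map_smul, hL, hL, map_smul, hR, smul_smul, smul_smul, add_left_comm]
  congr 1
  change (σ.toFun c d : ℂ) * σ.toFun a (d + c) = σ.toFun a c * σ.toFun (a + c) d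
  rw [σ.map_add_right, σ.map_add_left]
  push_cast
  ring

theorem comm_star (hL : IsTwistedRegular b σ L) {T : H →L[ℂ] H}
    (hT : T ∈ (Set.range L).centralizer) (a : G) : star (L a) * T = T * star (L a) := by
  rw [hL.star_eq, smul_mul_assoc, mul_smul_comm, hT _ ⟨-a, rfl⟩]

theorem centralizer_union_star (hL : IsTwistedRegular b σ L) :
    (Set.range L ∪ star (Set.range L)).centralizer = (Set.range L).centralizer := by
  refine Set.Subset.antisymm (Set.centralizer_subset Set.subset_union_left) fun T hT => ?_
  rintro m (hm | ⟨a, ha⟩)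
  · exact hT m hm
  · rw [← star_star m, ← ha]
    exact hL.comm_star hT a

/-- The identity behind both the commutation theorem and the trace property: expand the inner product
in the two orthonormal bases `L a δ_0` and `(L a)* δ_0`. -/
theorem inner_mul_apply {σ' : Bicharacter G G} {X Y : G → H →L[ℂ] H} (hX : IsTwistedRegular b σ X)
    (hY : IsTwistedRegular b σ' Y) (hdiag : ∀ a, σ.toFun a a = σ'.toFun a a) {T A : H →L[ℂ] H}
    (hT : T ∈ (Set.range X).centralizer) (hA : A ∈ (Set.range Y).centralizer) :
    ⟪b 0, (T * A) (b 0)⟫ = ⟪b 0, (A * T) (b 0)⟫ := by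
  rw [inner_mul_eq, inner_mul_eq, ← b.tsum_inner_mul_inner (star T (b 0)), ← b.tsum_inner_mul_inner (star A (b 0)),
    ← (Equiv.neg G).tsum_eq fun a => ⟪star A (b 0), b a⟫ * ⟪b a, T (b 0)⟫]
  refine tsum_congr fun a => ?_
  have h1 : ⟪star T (b 0), b a⟫ = starRingEnd ℂ (σ.toFun a a : ℂ) * ⟪b (-a), T (b 0)⟫ := by
    rw [← hX.apply_zero a, ContinuousLinearMap.star_eq_adjoint,
      ContinuousLinearMap.adjoint_inner_left, ← inner_smul_left, ← hX.star_apply_zero,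
      ContinuousLinearMap.star_eq_adjoint, ContinuousLinearMap.adjoint_inner_left]
    exact congrArg (fun B : H →L[ℂ] H => ⟪b 0, B (b 0)⟫) (hT _ ⟨a, rfl⟩).symm
  have h2 : ⟪b a, A (b 0)⟫ = (σ'.toFun a a : ℂ) * ⟪star A (b 0), b (-a)⟫ := by
    rw [← hY.apply_zero a, ← inner_smul_right, ← hY.star_apply_zero,
      ContinuousLinearMap.star_eq_adjoint, ContinuousLinearMap.adjoint_inner_left,
      ← ContinuousLinearMap.adjoint_inner_right]
    exact congrArg (fun B : H →L[ℂ] H => ⟪b 0, B (b 0)⟫) (hY.comm_star hA a)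
  rw [h1, h2, hdiag, Equiv.neg_apply]
  have : starRingEnd ℂ (σ'.toFun a a : ℂ) * (σ'.toFun a a : ℂ) = 1 := by
    rw [← Circle.coe_inv_eq_conj, ← Circle.coe_mul, inv_mul_cancel, Circle.coe_one]
  linear_combination ⟪b (-a), T (b 0)⟫ * ⟪star A (b 0), b (-a)⟫ * this

/-- The commutation theorem: the left twisted regular representation generates the commutant of the
right twisted regular representation. -/
theorem coe_generatedVN_eq (hL : IsTwistedRegular b σ L) (hR : IsTwistedRegular b σ.flip R) :
    (generatedVN (Set.range L) : Set (H →L[ℂ] H)) = (Set.range R).centralizer := by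
  rw [coe_generatedVN, hL.centralizer_union_star]
  refine Set.Subset.antisymm (Set.centralizer_subset ?_) fun T hT A hA => ?_
  · rintro _ ⟨d, rfl⟩ _ ⟨a, rfl⟩
    exact hL.mul_comm_right hR a d
  refine b.operator_ext fun j => b.ext_inner fun i => ?_
  have hT1 : T * L j ∈ (Set.range R).centralizer := by
    rintro _ ⟨d, rfl⟩
    rw [← mul_assoc, hT _ ⟨d, rfl⟩, mul_assoc, ← hL.mul_comm_right hR, mul_assoc]
  have hA1 : star (R i) * A ∈ (Set.range L).centralizer := by
    rintro _ ⟨a, rfl⟩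
    rw [hR.star_eq, smul_mul_assoc, mul_smul_comm, smul_mul_assoc, ← mul_assoc,
      hL.mul_comm_right hR, mul_assoc, hA _ ⟨a, rfl⟩, mul_assoc]
  have key := inner_mul_apply hR hL (fun a => rfl) hT1 hA1
  have e1 : T * L j * (star (R i) * A) = star (R i) * (T * A * L j) := by
    rw [mul_assoc, ← mul_assoc (L j), hR.star_eq, mul_smul_comm, smul_mul_assoc,
      hL.mul_comm_right hR, smul_mul_assoc, mul_smul_comm, mul_assoc (R (-i)), hA _ ⟨j, rfl⟩,
      ← mul_assoc, ← hT _ ⟨-i, rfl⟩]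
    simp only [mul_assoc]
  have e2 : star (R i) * A * (T * L j) = star (R i) * (A * T * L j) := by simp only [mul_assoc]
  have h (B : H →L[ℂ] H) : ⟪b 0, (star (R i) * (B * L j)) (b 0)⟫ = ⟪b i, B (b j)⟫ := by
    rw [← hR.apply_zero i, ← hL.apply_zero j, inner_mul_eq, star_star]; rfl
  rw [← h, ← h, ← e1, ← e2]
  exact key.symm

theorem coe_generatedVN_subset_ultraweakSpan (hL : IsTwistedRegular b σ L) :
    (generatedVN (Set.range L) : Set (H →L[ℂ] H)) ⊆ ultraweakSpan (Set.range L) := by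
  let S : Set (H →L[ℂ] H) := {x | ∃ (c : ℂ) (a : G), x = c • L a}
  have h1 : 1 ∈ S := ⟨1, 0, by rw [hL.zero, one_smul]⟩
  have hmul : ∀ x ∈ S, ∀ y ∈ S, x * y ∈ S := by
    rintro _ ⟨c, a, rfl⟩ _ ⟨c', a', rfl⟩
    exact ⟨_, a + a', by rw [smul_mul_smul_comm, hL.mul, smul_smul]⟩
  have hstar : ∀ x ∈ S, star x ∈ S := by
    rintro _ ⟨c, a, rfl⟩
    exact ⟨_, -a, by rw [star_smul, hL.star_eq, smul_smul]⟩
  have hsub : Set.range L ⊆ S := by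
    rintro _ ⟨a, rfl⟩
    exact ⟨1, a, (one_smul ℂ _).symm⟩
  refine (generatedVN_subset (hsub.trans (subset_generatedVN S))).trans ?_
  rw [← ultraweakSpan_eq_generatedVN h1 hmul hstar]
  refine ultraweakSpan_mono ?_
  rintro _ ⟨c, a, rfl⟩
  exact Submodule.smul_mem _ c (Submodule.subset_span ⟨a, rfl⟩)

theorem mem_generatedVN_iff (hL : IsTwistedRegular b σ L) (hR : IsTwistedRegular b σ.flip R)
    {x : H →L[ℂ] H} : x ∈ generatedVN (Set.range L) ↔ x ∈ (Set.range R).centralizer := by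
  rw [← SetLike.mem_coe, hL.coe_generatedVN_eq hR]

/-- The vector state at `δ_0` is a trace. -/
theorem inner_mul_comm (hR : IsTwistedRegular b σ R) {x y : H →L[ℂ] H}
    (hx : x ∈ (Set.range R).centralizer) (hy : y ∈ (Set.range R).centralizer) :
    ⟪b 0, (x * y) (b 0)⟫ = ⟪b 0, (y * x) (b 0)⟫ :=
  inner_mul_apply hR hR (fun _ => rfl) hx hy

theorem apply_basis (hR : IsTwistedRegular b σ R) {x : H →L[ℂ] H}
    (hx : x ∈ (Set.range R).centralizer) (a : G) : x (b a) = R a (x (b 0)) := by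
  rw [← hR.apply_zero a]
  exact (DFunLike.congr_fun (hx _ ⟨a, rfl⟩) (b 0)).symm

/-- The vector `δ_0` is separating for the commutant. -/
theorem eq_of_apply_zero (hR : IsTwistedRegular b σ R) {x y : H →L[ℂ] H}
    (hx : x ∈ (Set.range R).centralizer) (hy : y ∈ (Set.range R).centralizer)
    (h : x (b 0) = y (b 0)) : x = y :=
  b.operator_ext fun a => by rw [hR.apply_basis hx, hR.apply_basis hy, h]

theorem inner_add_apply (hL : IsTwistedRegular b σ L) (a c : G) (ξ : H) :
    ⟪b (a + c), L a ξ⟫ = σ.toFun a c * ⟪b c, ξ⟫ := by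
  have h : b (a + c) = starRingEnd ℂ (σ.toFun a c : ℂ) • L a (b c) := by
    rw [hL, smul_smul, ← Circle.coe_inv_eq_conj, ← Circle.coe_mul, inv_mul_cancel, Circle.coe_one,
      one_smul]
  rw [h, inner_smul_left, Complex.conj_conj, hL.inner_apply]

/-- If `σ` is nondegenerate, only scalars commute with both regular representations. -/
theorem eq_smul_one_of_comm (hL : IsTwistedRegular b σ L) (hR : IsTwistedRegular b σ.flip R)
    (hσ : ∀ c, (∀ a, σ.toFun a c = σ.toFun c a) → c = 0) {z : H →L[ℂ] H}
    (hzL : z ∈ (Set.range L).centralizer) (hzR : z ∈ (Set.range R).centralizer) :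
    ∃ c : ℂ, z = c • (1 : H →L[ℂ] H) := by
  classical
  refine ⟨⟪b 0, z (b 0)⟫, hR.eq_of_apply_zero hzR ?_ (b.ext_inner fun c => ?_)⟩
  · intro x _
    rw [mul_smul_comm, smul_mul_assoc, mul_one, one_mul]
  rw [smul_apply, inner_smul_right, one_apply_eq_self, orthonormal_iff_ite.1 b.orthonormal]
  by_cases hc : c = 0
  · rw [hc, if_pos rfl, mul_one]
  rw [if_neg hc, mul_zero]
  by_contra hne
  refine hc (hσ c fun a => ?_)
  have h1 := hL.inner_add_apply a c (z (b 0))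
  have h2 := hR.inner_add_apply a c (z (b 0))
  rw [← hL.apply_basis hzL, hR.apply_basis hzR, h2] at h1
  exact (Circle.ext (mul_right_cancel₀ hne h1)).symm

/-- Isometries in the commutant are unitary, as it has a faithful trace. -/
theorem mul_star_eq_one (hR : IsTwistedRegular b σ R) {v : H →L[ℂ] H}
    (hv : v ∈ (Set.range R).centralizer) (h : star v * v = 1) : v * star v = 1 := by
  have hv' : star v ∈ (Set.range R).centralizer := by
    rintro _ ⟨a, rfl⟩
    have := congrArg star (hR.comm_star hv a)
    rw [star_mul, star_mul, star_star] at this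
    exact this.symm
  have hmem : v * star v ∈ (Set.range R).centralizer := Set.mul_mem_centralizer hv hv'
  refine hR.eq_of_apply_zero hmem (Set.one_mem_centralizer) ?_
  -- the projection `1 - v v*` has trace zero
  have htr := hR.inner_mul_comm hv hv'
  rw [h] at htr
  have hn : ‖star v (b 0)‖ ^ 2 = 1 := by
    have h2 : ⟪b 0, (v * star v) (b 0)⟫ = ⟪star v (b 0), star v (b 0)⟫ :=
      inner_mul_eq _ _ _ _
    rw [htr, inner_self_eq_norm_sq_to_K] at h2
    have h3 : ⟪b 0, (1 : H →L[ℂ] H) (b 0)⟫ = 1 := by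
      rw [one_apply_eq_self, inner_self_eq_norm_sq_to_K, b.orthonormal.1 0]; simp
    rw [h3] at h2
    have h6 : ((‖star v (b 0)‖ ^ 2 : ℝ) : ℂ) = 1 := by rw [Complex.ofReal_pow]; exact h2.symm
    exact_mod_cast h6
  have hv1 : ‖(v * star v) (b 0)‖ = 1 := by
    have h4 : ‖v (star v (b 0))‖ = ‖star v (b 0)‖ :=
      (ContinuousLinearMap.norm_map_iff_adjoint_comp_self v).2 h _
    change ‖v (star v (b 0))‖ = 1
    rw [h4]
    nlinarith [norm_nonneg (star v (b 0))]
  have h5 : ⟪(v * star v) (b 0), b 0⟫ = 1 := by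
    rw [← inner_conj_symm, htr]
    rw [one_apply_eq_self, inner_self_eq_norm_sq_to_K, b.orthonormal.1 0]; simp
  exact (inner_eq_one_iff_of_norm_eq_one hv1 (b.orthonormal.1 0)).1 h5

/-- For the vectors `L a (R (-a) ξ)`, the absolute values of inner products depend on the differences of
the indices only. -/
theorem norm_inner_mul_apply (hL : IsTwistedRegular b σ L) (hR : IsTwistedRegular b σ.flip R)
    (a d : G) (ξ : H) :
    ‖⟪L a (R (-a) ξ), L (a + d) (R (-(a + d)) ξ)⟫‖ = ‖⟪R d ξ, L d ξ⟫‖ := by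
  have h1 : L (a + d) = (σ.toFun a d : ℂ)⁻¹ • (L a * L d) := by
    rw [hL.mul, smul_smul, inv_mul_cancel₀ (Circle.coe_ne_zero _), one_smul]
  have h2 : R (-a) = (σ.flip.toFun (-(a + d)) d : ℂ)⁻¹ • (R (-(a + d)) * R d) := by
    rw [hR.mul, smul_smul, inv_mul_cancel₀ (Circle.coe_ne_zero _), one_smul]
    congr 1; abel
  rw [h1, h2]
  simp only [smul_apply, ContinuousLinearMap.mul_def, ContinuousLinearMap.comp_apply, map_smul,
    inner_smul_left, inner_smul_right, norm_mul, norm_inv, Circle.norm_coe, inv_one, one_mul,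
    RCLike.norm_conj, hL.inner_apply]
  have h3 : L d (R (-(a + d)) ξ) = R (-(a + d)) (L d ξ) :=
    DFunLike.congr_fun (hL.mul_comm_right hR _ _) ξ
  rw [h3, hR.inner_apply]

theorem sum_norm_inner_sq_le (b : HilbertBasis G ℂ H) {s : Finset G} {f : G → G}
    (hf : Function.Injective f) (ξ : H) : ∑ d ∈ s, ‖⟪b (f d), ξ⟫‖ ^ 2 ≤ ‖ξ‖ ^ 2 := by
  simpa using (b.orthonormal.comp f hf).sum_inner_products_le ξ (s := s)

/-- For infinite `G`, the von Neumann algebra of the twisted regular representation has no minimal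
projections. If `p` is one, with trace `t`, then the vectors `L a p (L a)* δ_0` have inner product `t`
with `δ_0`, while the entries in a row of their Gram matrix have absolute values with sum at most `1`, by
minimality and Bessel's inequality. Hence `(n t)² ≤ n` for all `n`. -/
theorem exists_not_smul (hL : IsTwistedRegular b σ L) (hR : IsTwistedRegular b σ.flip R)
    [Infinite G] {p : H →L[ℂ] H} (hp : p ∈ (Set.range R).centralizer) (hproj : IsStarProjection p)
    (hp0 : p ≠ 0) : ∃ x ∈ (Set.range R).centralizer, ∀ c : ℂ, p * x * p ≠ c • p := by
  by_contra! hcon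
  have hpp : p * p = p := hproj.isIdempotentElem
  have hsa : ContinuousLinearMap.adjoint p = p := hproj.isSelfAdjoint
  have hLmem (a : G) : L a ∈ (Set.range R).centralizer := by
    rintro _ ⟨d, rfl⟩
    exact (hL.mul_comm_right hR a d).symm
  have hpi (x y : H) : ⟪p x, y⟫ = ⟪x, p y⟫ := by
    conv_lhs => rw [← hsa]
    exact ContinuousLinearMap.adjoint_inner_left _ _ _
  set u := p (b 0) with hu
  have hpu : p u = u := DFunLike.congr_fun hpp (b 0)
  have hu0 : u ≠ 0 := fun h => hp0 (hR.eq_of_apply_zero hp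
    (Set.zero_mem_centralizer) (by rw [← hu, h]; rfl))
  set t := ‖u‖ ^ 2 with ht
  have ht0 : 0 < t := by positivity
  -- by minimality `p (L d) p = c p`, and `c t` is up to a phase the coefficient `⟪b (-d), u⟫`
  have hent (d : G) : ‖⟪R d u, L d u⟫‖ * t ≤
      (‖⟪b d, u⟫‖ ^ 2 + ‖⟪b (-d), u⟫‖ ^ 2) / 2 := by
    obtain ⟨c, hc⟩ := hcon (L d) (hLmem d)
    have h1 : ⟪R d u, L d u⟫ = c * ⟪b d, u⟫ := by
      have e1 : R d u = p (b d) := (hR.apply_basis hp d).symm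
      have e2 : p (L d u) = c • u := DFunLike.congr_fun hc (b 0)
      rw [e1, hpi, e2, inner_smul_right]
    have h2 : c * (t : ℂ) = ⟪star (L d) (b 0), u⟫ := by
      have e1 : c * (t : ℂ) = ⟪b 0, (p * (L d * p)) (b 0)⟫ := by
        rw [← mul_assoc, hc, smul_apply, inner_smul_right, ← hu, ht,
          Complex.ofReal_pow]
        congr 1
        have := inner_self_eq_norm_sq_to_K (𝕜 := ℂ) u
        nth_rw 1 [hu] at this
        rw [hpi, hpu] at this
        exact this.symm
      rw [e1, hR.inner_mul_comm hp (Set.mul_mem_centralizer (hLmem d) hp), mul_assoc, hpp]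
      exact inner_mul_eq _ _ _ _
    have h3 : ‖c‖ * t = ‖⟪b (-d), u⟫‖ := by
      have := congrArg norm h2
      rwa [hL.star_apply_zero, inner_smul_left, norm_mul, norm_mul, RCLike.norm_conj,
        Circle.norm_coe, one_mul, Complex.norm_real, Real.norm_of_nonneg ht0.le] at this
    rw [h1, norm_mul, mul_right_comm, h3]
    nlinarith [sq_nonneg (‖⟪b d, u⟫‖ - ‖⟪b (-d), u⟫‖)]
  -- the vectors `L a p (L a)* δ_0`
  let q : G → H := fun a => (σ.toFun a a : ℂ) • L a (R (-a) u)
  have hq0 (a : G) : ⟪b 0, q a⟫ = (t : ℂ) := by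
    have e1 : (σ.toFun a a : ℂ) • L a (R (-a) u) = L a (p (star (L a) (b 0))) := by
      rw [hL.star_apply_zero, map_smul, map_smul, hR.apply_basis hp]
    change ⟪b 0, (σ.toFun a a : ℂ) • L a (R (-a) u)⟫ = _
    rw [e1, ← ContinuousLinearMap.adjoint_inner_left, ← ContinuousLinearMap.star_eq_adjoint,
      hL.star_apply_zero, map_smul, inner_smul_left, inner_smul_right]
    conv_lhs => rw [← hpp]
    rw [ContinuousLinearMap.mul_def, ContinuousLinearMap.comp_apply, ← hpi, hR.apply_basis hp,
      ← hu, hR.inner_apply, inner_self_eq_norm_sq_to_K, ← mul_assoc, ← Circle.coe_inv_eq_conj,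
      ← Circle.coe_mul, inv_mul_cancel, Circle.coe_one, one_mul, ht]
    simp
  have hgram (s : Finset G) : ‖∑ a ∈ s, q a‖ ^ 2 ≤ s.card := by
    have h1 : ‖∑ a ∈ s, q a‖ ^ 2 ≤ ∑ a ∈ s, ∑ d ∈ s, ‖⟪q a, q d⟫‖ := by
      have : ((‖∑ a ∈ s, q a‖ ^ 2 : ℝ) : ℂ) = ∑ a ∈ s, ∑ d ∈ s, ⟪q a, q d⟫ := by
        have e := inner_self_eq_norm_sq_to_K (𝕜 := ℂ) (∑ a ∈ s, q a)
        rw [sum_inner] at e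
        simp only [inner_sum] at e
        rw [e]
        simp
      calc ‖∑ a ∈ s, q a‖ ^ 2 = ‖((‖∑ a ∈ s, q a‖ ^ 2 : ℝ) : ℂ)‖ := by
            rw [Complex.norm_real, Real.norm_of_nonneg (by positivity)]
        _ ≤ _ := by
            rw [this]
            exact norm_sum_le_of_le _ fun a _ => norm_sum_le _ _
    have h2 (a d : G) : ‖⟪q a, q d⟫‖ * t ≤
        (‖⟪b (d - a), u⟫‖ ^ 2 + ‖⟪b (-(d - a)), u⟫‖ ^ 2) / 2 := by
      have e : ‖⟪q a, q d⟫‖ = ‖⟪R (d - a) u, L (d - a) u⟫‖ := by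
        simp only [q, inner_smul_left, inner_smul_right, norm_mul, RCLike.norm_conj,
          Circle.norm_coe, one_mul]
        have := hL.norm_inner_mul_apply hR a (d - a) u
        rwa [add_sub_cancel] at this
      rw [e]
      exact hent _
    have h3 (a : G) : ∑ d ∈ s, ‖⟪q a, q d⟫‖ ≤ 1 := by
      refine le_of_mul_le_mul_right ?_ ht0
      rw [one_mul, Finset.sum_mul]
      refine (Finset.sum_le_sum fun d _ => h2 a d).trans ?_
      rw [← Finset.sum_div, Finset.sum_add_distrib]
      have e1 := sum_norm_inner_sq_le b (s := s) (f := fun d => d - a) (sub_left_injective) u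
      have e2 := sum_norm_inner_sq_le b (s := s) (f := fun d => -(d - a))
        (neg_injective.comp sub_left_injective) u
      rw [ht]
      linarith
    calc _ ≤ ∑ a ∈ s, ∑ d ∈ s, ‖⟪q a, q d⟫‖ := h1
      _ ≤ ∑ a ∈ s, (1 : ℝ) := Finset.sum_le_sum fun a _ => h3 a
      _ = s.card := by simp
  obtain ⟨n, hn⟩ := exists_nat_gt (t ^ 2)⁻¹
  obtain ⟨s, hs⟩ := Infinite.exists_subset_card_eq G n
  have h1 : (n : ℝ) * t ≤ ‖∑ a ∈ s, q a‖ := by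
    have e : ⟪b 0, ∑ a ∈ s, q a⟫ = ((n * t : ℝ) : ℂ) := by
      rw [inner_sum, Finset.sum_congr rfl fun a _ => hq0 a, Finset.sum_const, hs]
      simp
    calc (n : ℝ) * t = ‖⟪b 0, ∑ a ∈ s, q a⟫‖ := by
          rw [e, Complex.norm_real, Real.norm_of_nonneg (by positivity)]
      _ ≤ ‖b 0‖ * ‖∑ a ∈ s, q a‖ := norm_inner_le_norm _ _
      _ = _ := by rw [b.orthonormal.1 0, one_mul]
  have h2 := hgram s
  rw [hs] at h2
  have hn0 : (0 : ℝ) < n := lt_trans (by positivity) hn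
  have h3 : ((n : ℝ) * t) ^ 2 ≤ n := (pow_le_pow_left₀ (by positivity) h1 2).trans h2
  have h4 : (n : ℝ) * t ^ 2 ≤ 1 := by
    refine le_of_mul_le_mul_left ?_ hn0
    calc (n : ℝ) * (n * t ^ 2) = ((n : ℝ) * t) ^ 2 := by ring
      _ ≤ (n : ℝ) * 1 := by rw [mul_one]; exact h3
  rw [inv_lt_iff_one_lt_mul₀ (by positivity)] at hn
  linarith

/-- For an infinite group and a nondegenerate bicharacter, the von Neumann algebra of the twisted regular
representation is a `II₁` factor. -/
theorem isTypeIIOneFactor (hL : IsTwistedRegular b σ L) (hR : IsTwistedRegular b σ.flip R)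
    [Infinite G] (hσ : ∀ c, (∀ a, σ.toFun a c = σ.toFun c a) → c = 0) :
    IsTypeIIOneFactor (generatedVN (Set.range L)) where
  nontrivial := ⟨b 0, 0, b.orthonormal.ne_zero 0⟩
  center z hz hz' := hL.eq_smul_one_of_comm hR hσ
    (fun m hm => VonNeumannAlgebra.mem_commutant_iff.1 hz' m (subset_generatedVN _ hm))
    ((hL.mem_generatedVN_iff hR).1 hz)
  finite v hv h := hR.mul_star_eq_one ((hL.mem_generatedVN_iff hR).1 hv) h
  no_minimal p hp hproj hp0 := by
    obtain ⟨x, hx, h⟩ := hL.exists_not_smul hR ((hL.mem_generatedVN_iff hR).1 hp) hproj hp0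
    exact ⟨x, (hL.mem_generatedVN_iff hR).2 hx, h⟩

/-- If `G` is generated by two elements, the von Neumann algebra of the twisted regular representation is
injective. -/
theorem isInjectiveVN (hL : IsTwistedRegular b σ L) (hR : IsTwistedRegular b σ.flip R)
    {g₁ g₂ : G} (hg : AddSubgroup.closure {g₁, g₂} = ⊤) :
    IsInjectiveVN (generatedVN (Set.range L)) := by
  refine isInjectiveVN_of_unitaries (S₁ := R g₁) (S₂ := R g₂)
    (c := (σ.toFun g₂ g₁ : ℂ) * (σ.toFun g₁ g₂ : ℂ)⁻¹)
    (hR.star_mul_self _) (hR.mul_star_self _) (hR.star_mul_self _) (hR.mul_star_self _)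
    (mul_ne_zero (Circle.coe_ne_zero _) (inv_ne_zero (Circle.coe_ne_zero _))) ?_ fun x => ?_
  · rw [hR.mul, hR.mul, smul_smul, add_comm g₂ g₁]
    change (σ.toFun g₂ g₁ : ℂ) • _ = (σ.toFun g₂ g₁ * (σ.toFun g₁ g₂ : ℂ)⁻¹ * σ.toFun g₁ g₂ : ℂ) • _
    rw [inv_mul_cancel_right₀ (Circle.coe_ne_zero _)]
  · rw [hL.mem_generatedVN_iff hR]
    refine ⟨fun h => ⟨h _ ⟨g₁, rfl⟩, h _ ⟨g₂, rfl⟩⟩, ?_⟩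
    rintro ⟨h1, h2⟩ _ ⟨a, rfl⟩
    have ha : a ∈ AddSubgroup.closure {g₁, g₂} := hg ▸ AddSubgroup.mem_top a
    induction ha using AddSubgroup.closure_induction with
    | mem a ha =>
      rcases ha with rfl | rfl
      · exact h1
      · exact h2
    | zero => rw [hR.zero, one_mul, mul_one]
    | add a d _ _ ha hd =>
      have e : R (a + d) = (σ.flip.toFun a d : ℂ)⁻¹ • (R a * R d) := by
        rw [hR.mul, smul_smul, inv_mul_cancel₀ (Circle.coe_ne_zero _), one_smul]
      rw [e, smul_mul_assoc, mul_smul_comm, mul_assoc, hd, ← mul_assoc, ha, mul_assoc]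
    | neg a _ ha =>
      have e : R (-a) * R a = (σ.flip.toFun (-a) a : ℂ) • (1 : H →L[ℂ] H) := by
        rw [hR.mul, neg_add_cancel, hR.zero]
      have e' : R a * R (-a) = (σ.flip.toFun (-a) a : ℂ) • (1 : H →L[ℂ] H) := by
        rw [hR.mul, add_neg_cancel, hR.zero, σ.flip.neg_left, σ.flip.neg_right]
      have h := congrArg (fun y => R (-a) * y * R (-a)) ha
      beta_reduce at h
      rw [← mul_assoc, e, mul_assoc, mul_assoc, mul_assoc, e'] at h
      simp only [smul_mul_assoc, one_mul, mul_smul_comm, mul_one] at h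
      exact (smul_right_injective _ (Circle.coe_ne_zero _) h).symm

end IsTwistedRegular
end Twisted

/-! ### Operators on Hilbert space tensor products -/

section Tensor
variable {H K : Type*} [NormedAddCommGroup H] [InnerProductSpace ℂ H]
  [NormedAddCommGroup K] [InnerProductSpace ℂ K]

/-- The elementary tensor `ξ ⊗ η` in the completed tensor product. -/
def pureTensor (ξ : H) (η : K) : HilbertTensor H K := ((ξ ⊗ₜ[ℂ] η : H ⊗[ℂ] K) : HilbertTensor H K)

/-- The map `η ↦ ξ ⊗ η`. -/
def tensorLeft (ξ : H) : K →L[ℂ] HilbertTensor H K :=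
  (UniformSpace.Completion.toComplL (𝕜 := ℂ) (E := H ⊗[ℂ] K)).comp (TensorProduct.mkL ℂ H K ξ)

/-- The map `ξ ↦ ξ ⊗ η`. -/
def tensorRight (η : K) : H →L[ℂ] HilbertTensor H K :=
  (UniformSpace.Completion.toComplL (𝕜 := ℂ) (E := H ⊗[ℂ] K)).comp
    ((TensorProduct.mkL ℂ H K).flip η)

theorem tensorLeft_apply (ξ : H) (η : K) : tensorLeft ξ η = pureTensor ξ η := rfl

theorem tensorRight_apply (ξ : H) (η : K) : tensorRight η ξ = pureTensor ξ η := rfl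

theorem pureTensor_smul_left (c : ℂ) (ξ : H) (η : K) :
    pureTensor (c • ξ) η = c • pureTensor ξ η := by
  rw [← tensorRight_apply, map_smul, tensorRight_apply]

theorem pureTensor_smul_right (c : ℂ) (ξ : H) (η : K) :
    pureTensor ξ (c • η) = c • pureTensor ξ η := by
  rw [← tensorLeft_apply, map_smul, tensorLeft_apply]

theorem inner_pureTensor (ξ ξ' : H) (η η' : K) :
    ⟪pureTensor ξ η, pureTensor ξ' η'⟫ = ⟪ξ, ξ'⟫ * ⟪η, η'⟫ := by
  rw [pureTensor, pureTensor, UniformSpace.Completion.inner_coe, TensorProduct.inner_tmul]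

theorem opTensor_pureTensor (S : H →L[ℂ] H) (T : K →L[ℂ] K) (ξ : H) (η : K) :
    opTensor S T (pureTensor ξ η) = pureTensor (S ξ) (T η) := opTensor_tmul S T ξ η

theorem dense_span_pureTensor :
    Dense (Submodule.span ℂ {x : HilbertTensor H K | ∃ ξ η, x = pureTensor ξ η} :
      Set (HilbertTensor H K)) := by
  refine UniformSpace.Completion.denseRange_coe.mono ?_
  rintro _ ⟨x, rfl⟩
  induction x using TensorProduct.induction_on with
  | zero => rw [UniformSpace.Completion.coe_zero]; exact Submodule.zero_mem _
  | tmul ξ η => exact Submodule.subset_span ⟨ξ, η, rfl⟩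
  | add x y hx hy => rw [UniformSpace.Completion.coe_add]; exact Submodule.add_mem _ hx hy

theorem ext_pureTensor {E : Type*} [NormedAddCommGroup E] [NormedSpace ℂ E]
    {S T : HilbertTensor H K →L[ℂ] E}
    (h : ∀ ξ η, S (pureTensor ξ η) = T (pureTensor ξ η)) : S = T := by
  refine ContinuousLinearMap.ext_on dense_span_pureTensor ?_
  rintro _ ⟨ξ, η, rfl⟩
  exact h ξ η

theorem opTensor_mul (S S' : H →L[ℂ] H) (T T' : K →L[ℂ] K) :
    opTensor S T * opTensor S' T' = opTensor (S * S') (T * T') := by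
  refine ext_pureTensor fun ξ η => ?_
  simp only [mul_apply_eq_comp, opTensor_pureTensor]

theorem opTensor_one : opTensor (1 : H →L[ℂ] H) (1 : K →L[ℂ] K) = 1 := by
  refine ext_pureTensor fun ξ η => ?_
  simp only [opTensor_pureTensor, one_apply_eq_self]

variable [CompleteSpace H] [CompleteSpace K]

theorem opTensor_star (S : H →L[ℂ] H) (T : K →L[ℂ] K) :
    star (opTensor S T) = opTensor (star S) (star T) := by
  refine ext_pureTensor fun ξ η => eq_of_inner_left_of_dense dense_span_pureTensor ?_
  rintro _ ⟨ξ', η', rfl⟩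
  simp only [ContinuousLinearMap.star_eq_adjoint, ContinuousLinearMap.adjoint_inner_right,
    opTensor_pureTensor, inner_pureTensor]

theorem isAmplification_left :
    IsAmplification (fun η : K => tensorRight (H := H) η) fun a => opTensor a 1 where
  dense := by
    refine dense_span_pureTensor.mono (Submodule.span_mono ?_)
    rintro _ ⟨ξ, η, rfl⟩
    exact Set.mem_iUnion.2 ⟨η, ξ, rfl⟩
  apply a η ξ := opTensor_pureTensor _ _ _ _
  star a := by rw [opTensor_star, star_one]

theorem isAmplification_right :
    IsAmplification (fun ξ : H => tensorLeft (K := K) ξ) fun a => opTensor 1 a where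
  dense := by
    refine dense_span_pureTensor.mono (Submodule.span_mono ?_)
    rintro _ ⟨ξ, η, rfl⟩
    exact Set.mem_iUnion.2 ⟨ξ, η, rfl⟩
  apply a ξ η := opTensor_pureTensor _ _ _ _
  star a := by rw [opTensor_star, star_one]

theorem span_pureTensor_basis {ι κ : Type*} (b : HilbertBasis ι ℂ H) (b' : HilbertBasis κ ℂ K) :
    ⊤ ≤ (Submodule.span ℂ
      (Set.range fun k : ι × κ => pureTensor (b k.1) (b' k.2))).topologicalClosure := by
  set C := (Submodule.span ℂ
    (Set.range fun k : ι × κ => pureTensor (b k.1) (b' k.2))).topologicalClosure with hC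
  have hCc : IsClosed (C : Set (HilbertTensor H K)) := Submodule.isClosed_topologicalClosure _
  have h1 (i : ι) (η : K) : pureTensor (b i) η ∈ C := by
    have hle : (Submodule.span ℂ (Set.range b')).topologicalClosure ≤
        C.comap (tensorLeft (K := K) (b i)).toLinearMap := by
      refine Submodule.topologicalClosure_minimal _ ?_ (hCc.preimage (tensorLeft (b i)).continuous)
      rw [Submodule.span_le]
      rintro _ ⟨j, rfl⟩
      exact Submodule.le_topologicalClosure _ (Submodule.subset_span ⟨(i, j), rfl⟩)
    rw [b'.dense_span] at hle
    exact hle (Submodule.mem_top (x := η))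
  have h2 (ξ : H) (η : K) : pureTensor ξ η ∈ C := by
    have hle : (Submodule.span ℂ (Set.range b)).topologicalClosure ≤
        C.comap (tensorRight (H := H) η).toLinearMap := by
      refine Submodule.topologicalClosure_minimal _ ?_ (hCc.preimage (tensorRight η).continuous)
      rw [Submodule.span_le]
      rintro _ ⟨i, rfl⟩
      exact h1 i η
    rw [b.dense_span] at hle
    exact hle (Submodule.mem_top (x := ξ))
  intro x _
  have hsub : Submodule.span ℂ {x : HilbertTensor H K | ∃ ξ η, x = pureTensor ξ η} ≤ C := by
    rw [Submodule.span_le]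
    rintro _ ⟨ξ, η, rfl⟩
    exact h2 ξ η
  exact closure_minimal hsub hCc (dense_span_pureTensor x)

/-- The orthonormal basis of the elementary tensors of basis vectors. -/
def tensorBasis {ι κ : Type*} (b : HilbertBasis ι ℂ H) (b' : HilbertBasis κ ℂ K) :
    HilbertBasis (ι × κ) ℂ (HilbertTensor H K) :=
  HilbertBasis.mk (v := fun k : ι × κ => pureTensor (b k.1) (b' k.2))
    (by
      classical
      rw [orthonormal_iff_ite]
      rintro ⟨i, j⟩ ⟨i', j'⟩
      rw [inner_pureTensor, orthonormal_iff_ite.1 b.orthonormal,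
        orthonormal_iff_ite.1 b'.orthonormal]
      by_cases h : i = i' <;> by_cases h' : j = j' <;> simp [h, h'])
    (span_pureTensor_basis b b')

theorem tensorBasis_apply {ι κ : Type*} (b : HilbertBasis ι ℂ H) (b' : HilbertBasis κ ℂ K)
    (k : ι × κ) : tensorBasis b b' k = pureTensor (b k.1) (b' k.2) := by
  rw [tensorBasis, HilbertBasis.coe_mk]

end Tensor

/-! ### Diagonal representations of algebras of functions -/

section Diagonal
variable {X H ι : Type*} [TopologicalSpace X] [NormedAddCommGroup H] [InnerProductSpace ℂ H]
  [CompleteSpace H]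

/-- The operator that is diagonal in the basis `b`, with eigenvalues `F (p i)`. -/
def diagOp (b : HilbertBasis ι ℂ H) (p : ι → X) (F : X →ᵇ ℂ) : H →L[ℂ] H :=
  b.repr.conjStarAlgEquiv.symm
    (lp.mapCLM 2 (fun i => F (p i) • (1 : ℂ →L[ℂ] ℂ)) (norm_nonneg F) fun i => by
      rw [norm_smul, norm_one, mul_one]; exact F.norm_coe_le_norm _)

theorem diagOp_apply (b : HilbertBasis ι ℂ H) (p : ι → X) (F : X →ᵇ ℂ) (i : ι) :
    diagOp b p F (b i) = F (p i) • b i := by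
  classical
  rw [diagOp, LinearIsometryEquiv.symm_conjStarAlgEquiv_apply_apply, b.repr_self,
    LinearIsometryEquiv.symm_apply_eq, map_smul, b.repr_self]
  ext j
  change F (p j) * (lp.single 2 i (1 : ℂ) : lp (fun _ : ι => ℂ) 2) j =
    F (p i) * (lp.single 2 i (1 : ℂ) : lp (fun _ : ι => ℂ) 2) j
  rw [lp.single_apply]
  by_cases h : j = i
  · subst h; simp
  · simp [h]

/-- The representation of `C_b(X)` by operators that are diagonal in the basis `b`. -/
def diagHom (b : HilbertBasis ι ℂ H) (p : ι → X) : (X →ᵇ ℂ) →⋆ₐ[ℂ] (H →L[ℂ] H) where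
  toFun := diagOp b p
  map_one' := b.operator_ext fun i => by
    rw [diagOp_apply]; exact one_smul ℂ _
  map_mul' F F' := b.operator_ext fun i => by
    rw [mul_apply_eq_comp, diagOp_apply, diagOp_apply, map_smul, diagOp_apply, smul_smul,
      BoundedContinuousFunction.mul_apply, mul_comm]
  map_zero' := b.operator_ext fun i => by
    rw [diagOp_apply]; exact zero_smul ℂ _
  map_add' F F' := b.operator_ext fun i => by
    rw [add_apply, diagOp_apply, diagOp_apply, diagOp_apply, BoundedContinuousFunction.add_apply,
      add_smul]
  commutes' c := b.operator_ext fun i => by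
    rw [diagOp_apply, Algebra.algebraMap_eq_smul_one (A := H →L[ℂ] H), smul_apply,
      one_apply_eq_self]; rfl
  map_star' F := b.operator_ext fun i => b.ext_inner fun j => by
    classical
    rw [diagOp_apply, ContinuousLinearMap.star_eq_adjoint, ContinuousLinearMap.adjoint_inner_right,
      diagOp_apply, inner_smul_left, inner_smul_right, orthonormal_iff_ite.1 b.orthonormal]
    by_cases h : j = i
    · subst h; rfl
    · simp [h]

theorem diagHom_apply (b : HilbertBasis ι ℂ H) (p : ι → X) (F : X →ᵇ ℂ) (i : ι) :
    diagHom b p F (b i) = F (p i) • b i := diagOp_apply b p F i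

/-- The product of a bounded continuous function and a function that vanishes at infinity. -/
def bcfMul (F : X →ᵇ ℂ) (a : C₀(X, ℂ)) : C₀(X, ℂ) where
  toFun x := F x * a x
  continuous_toFun := F.continuous.mul a.continuous
  zero_at_infty' := by
    refine squeeze_zero_norm (a := fun x => ‖F‖ * ‖a x‖) (fun x => ?_) ?_
    · rw [norm_mul]
      gcongr
      exact F.norm_coe_le_norm x
    · simpa using (zero_at_infty a).norm.const_mul ‖F‖

theorem bcfMul_apply (F : X →ᵇ ℂ) (a : C₀(X, ℂ)) (x : X) : bcfMul F a x = F x * a x := rfl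

theorem C0_norm_le {a : C₀(X, ℂ)} {C : ℝ} (hC : 0 ≤ C) (h : ∀ x, ‖a x‖ ≤ C) : ‖a‖ ≤ C := by
  rw [← ZeroAtInftyContinuousMap.norm_toBCF_eq_norm]
  exact (BoundedContinuousFunction.norm_le hC).2 h

theorem C0_norm_apply_le (a : C₀(X, ℂ)) (x : X) : ‖a x‖ ≤ ‖a‖ := by
  rw [← ZeroAtInftyContinuousMap.norm_toBCF_eq_norm]
  exact a.toBCF.norm_coe_le_norm x

theorem exists_bump [T2Space X] [LocallyCompactSpace X] {V : Set X} (hV : IsOpen V) {x₀ : X}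
    (hx₀ : x₀ ∈ V) : ∃ a : C₀(X, ℂ), a x₀ = 1 ∧ (∀ x, ‖a x‖ ≤ 1) ∧ ∀ x, x ∉ V → a x = 0 := by
  obtain ⟨f, h1, h0, hc, hI⟩ := exists_continuous_one_zero_of_isCompact (isCompact_singleton (x := x₀))
    hV.isClosed_compl (Set.disjoint_singleton_left.2 fun h => h hx₀)
  have hc' : HasCompactSupport fun x => (f x : ℂ) := hc.comp_left Complex.ofReal_zero
  refine ⟨⟨⟨fun x => (f x : ℂ), by fun_prop⟩, hc'.is_zero_at_infty⟩, ?_, fun x => ?_, fun x hx => ?_⟩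
  · change (f x₀ : ℂ) = 1
    rw [h1 rfl]; simp
  · change ‖(f x : ℂ)‖ ≤ 1
    rw [Complex.norm_real, Real.norm_of_nonneg (hI x).1]
    exact (hI x).2
  · change (f x : ℂ) = 0
    rw [h0 hx]; simp

/-- A function in `C₀(X)` that vanishes at the zeros of `h ≥ 0` is a uniform limit of products of `h`
and functions in `C₀(X)`, namely of `h a / (h + ε)`. -/
theorem exists_norm_sub_bcfMul_le {h : X →ᵇ ℂ} {r : X → ℝ} (hr : ∀ x, h x = r x)
    (hr0 : ∀ x, 0 ≤ r x) {a : C₀(X, ℂ)} (ha : ∀ x, r x = 0 → a x = 0) {δ : ℝ} (hδ : 0 < δ) :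
    ∃ a' : C₀(X, ℂ), ‖a - bcfMul h a'‖ ≤ δ := by
  have hrc : Continuous r := by
    have : r = fun x => (h x).re := by ext x; rw [hr, Complex.ofReal_re]
    rw [this]; fun_prop
  have hKc : IsCompact {x | δ ≤ ‖a x‖} := by
    have h1 : {x | ‖a x‖ < δ} ∈ Filter.cocompact X := by
      have := (zero_at_infty a).norm
      rw [norm_zero] at this
      exact this.eventually (gt_mem_nhds hδ)
    obtain ⟨t, ht, hts⟩ := Filter.mem_cocompact.1 h1
    refine ht.of_isClosed_subset (isClosed_le continuous_const a.continuous.norm) fun x hx => ?_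
    by_contra hxt
    exact absurd (show ‖a x‖ < δ from hts hxt) (not_lt.2 hx)
  obtain ⟨m, hm0, hm⟩ : ∃ m : ℝ, 0 < m ∧ ∀ x, δ ≤ ‖a x‖ → m ≤ r x := by
    rcases Set.eq_empty_or_nonempty {x | δ ≤ ‖a x‖} with he | hne
    · exact ⟨1, one_pos, fun x hx => absurd (show x ∈ {x | δ ≤ ‖a x‖} from hx) (by simp [he])⟩
    · obtain ⟨x, hx, hmin⟩ := hKc.exists_isMinOn hne hrc.continuousOn
      refine ⟨r x, lt_of_le_of_ne (hr0 x) fun e => ?_, fun y hy => hmin hy⟩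
      have hx' : δ ≤ ‖a x‖ := hx
      rw [ha x e.symm, norm_zero] at hx'
      exact absurd hδ (not_lt.2 hx')
  set ε : ℝ := m * δ / (‖a‖ + 1) with hε
  have hε0 : 0 < ε := by positivity
  have hpos (x : X) : 0 < r x + ε := add_pos_of_nonneg_of_pos (hr0 x) hε0
  let k : X →ᵇ ℂ := BoundedContinuousFunction.ofNormedAddCommGroup
    (fun x => (((r x + ε)⁻¹ : ℝ) : ℂ))
    (Complex.continuous_ofReal.comp ((hrc.add continuous_const).inv₀ fun x => (hpos x).ne')) ε⁻¹
    (fun x => by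
      rw [Complex.norm_real, Real.norm_of_nonneg (inv_nonneg.2 (hpos x).le)]
      exact inv_anti₀ hε0 (by linarith [hr0 x]))
  refine ⟨bcfMul k a, C0_norm_le hδ.le fun x => ?_⟩
  have h1 : (a - bcfMul h (bcfMul k a)) x = ((ε / (r x + ε) : ℝ) : ℂ) * a x := by
    change a x - h x * ((((r x + ε)⁻¹ : ℝ) : ℂ) * a x) = _
    have hne : ((r x : ℂ) + ε) ≠ 0 := by exact_mod_cast (hpos x).ne'
    rw [hr]
    push_cast
    field_simp
    ring
  rw [h1, norm_mul, Complex.norm_real, Real.norm_of_nonneg (by have := hpos x; positivity)]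
  by_cases hx : δ ≤ ‖a x‖
  · have h2 : ε / (r x + ε) ≤ ε / m := by
      gcongr
      linarith [hm x hx]
    calc ε / (r x + ε) * ‖a x‖ ≤ ε / m * ‖a‖ := by gcongr; exact C0_norm_apply_le a x
      _ = δ * (‖a‖ / (‖a‖ + 1)) := by rw [hε]; field_simp
      _ ≤ δ * 1 := by
        gcongr
        rw [div_le_one (by positivity)]; linarith
      _ = δ := mul_one δ
  · calc ε / (r x + ε) * ‖a x‖ ≤ 1 * ‖a x‖ := by
          gcongr
          rw [div_le_one (hpos x)]; linarith [hr0 x]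
      _ ≤ δ := by rw [one_mul]; exact (not_le.1 hx).le

theorem norm_starAlgHom_apply_le (Φ : (X →ᵇ ℂ) →⋆ₐ[ℂ] (H →L[ℂ] H)) (F : X →ᵇ ℂ) :
    ‖Φ F‖ ≤ ‖F‖ := NonUnitalStarAlgHom.norm_apply_le Φ F

end Diagonal

section IntegratedForm
variable {G X H ι : Type*} [AddCommGroup G] [TopologicalSpace G] [AddCommGroup X]
  [TopologicalSpace X] [T2Space X] [LocallyCompactSpace X] [NormedAddCommGroup H]
  [InnerProductSpace ℂ H] [CompleteSpace H]

/-- The function `W(g, ·)`. -/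
def DualPairing.char (W : DualPairing G X) (g : G) : X →ᵇ ℂ :=
  BoundedContinuousFunction.ofNormedAddCommGroup (fun x => (W.toFun g x : ℂ))
    (continuous_circle_coe.comp (W.continuous_toFun.comp (by fun_prop : Continuous fun x => (g, x))))
    1 fun _ => (Circle.norm_coe _).le

variable {W : DualPairing G X} {U : UnitaryRep G H} {φ : C₀(X, ℂ) →⋆ₙₐ[ℂ] (H →L[ℂ] H)}

theorem IsIntegratedForm.apply_bcfMul_char (hφ : IsIntegratedForm W U φ) (g : G) (a : C₀(X, ℂ)) :
    φ (bcfMul (W.char g) a) = φ a * U.op g := by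
  refine ContinuousLinearMap.ext_on hφ.nondegenerate ?_
  rintro _ ⟨a', ξ, rfl⟩
  have h1 : φ (bcfMul (W.char g) a') = U.op g * φ a' := hφ.map_char_mul g a' _ fun _ => rfl
  change (φ (bcfMul (W.char g) a) * φ a') ξ = φ a ((U.op g * φ a') ξ)
  rw [← h1, ← map_mul, ← mul_apply_eq_comp, ← map_mul]
  congr 2
  ext x
  rw [ZeroAtInftyContinuousMap.mul_apply, ZeroAtInftyContinuousMap.mul_apply, bcfMul_apply,
    bcfMul_apply]
  ring

/-- If `ξ` is a common eigenvector of the operators `U g`, with eigenvalues `W(g, x₀)`, then it is an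
eigenvector of all `φ a`, with eigenvalues `a x₀`. The points of `X` have to be separated from `x₀` by
finitely many of the characters `W(g, ·)`. -/
theorem IsIntegratedForm.apply_eigenvector (hφ : IsIntegratedForm W U φ) {x₀ : X} {ξ : H}
    (hξ : ∀ g, U.op g ξ = (W.toFun g x₀ : ℂ) • ξ)
    (hsep : ∃ s : Finset G, ∀ x, (∀ g ∈ s, W.toFun g x = W.toFun g x₀) → x = x₀) (a : C₀(X, ℂ)) :
    φ a ξ = a x₀ • ξ := by
  obtain ⟨s, hs⟩ := hsep
  let f : G → X →ᵇ ℂ := fun g => W.char g - BoundedContinuousFunction.const X (W.toFun g x₀ : ℂ)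
  have hf (g : G) (a : C₀(X, ℂ)) : φ (bcfMul (f g) a) ξ = 0 := by
    have h1 : bcfMul (f g) a = bcfMul (W.char g) a - (W.toFun g x₀ : ℂ) • a := by
      ext x
      exact sub_mul _ _ _
    rw [h1, map_sub, map_smul, hφ.apply_bcfMul_char, sub_apply, smul_apply, mul_apply_eq_comp, hξ,
      map_smul, sub_self]
  let h : X →ᵇ ℂ := ∑ g ∈ s, f g * star (f g)
  let r : X → ℝ := fun x => ∑ g ∈ s, ‖f g x‖ ^ 2
  have hh (a : C₀(X, ℂ)) : φ (bcfMul h a) ξ = 0 := by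
    have h1 (t : Finset G) : φ (bcfMul (∑ g ∈ t, f g * star (f g)) a) ξ = 0 := by
      classical
      induction t using Finset.induction_on with
      | empty =>
        have e : bcfMul (0 : X →ᵇ ℂ) a = 0 := by ext x; exact zero_mul _
        rw [Finset.sum_empty, e, map_zero, zero_apply]
      | insert g t hg ih =>
        have e : bcfMul (f g * star (f g) + ∑ g ∈ t, f g * star (f g)) a =
            bcfMul (f g) (bcfMul (star (f g)) a) + bcfMul (∑ g ∈ t, f g * star (f g)) a := by
          ext x
          change (f g x * star (f g) x + _) * a x = f g x * (star (f g) x * a x) + _ * a x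
          rw [add_mul, mul_assoc]
        rw [Finset.sum_insert hg, e, map_add, add_apply, hf, ih, add_zero]
    exact h1 s
  have hhr (x : X) : h x = r x := by
    simp only [h, r, BoundedContinuousFunction.coe_sum, Finset.sum_apply,
      BoundedContinuousFunction.mul_apply, Complex.ofReal_sum]
    exact Finset.sum_congr rfl fun g _ => by
      rw [Complex.ofReal_pow]; exact RCLike.mul_conj (f g x)
  have hr0 (x : X) (hx : r x = 0) : x = x₀ := by
    refine hs x fun g hg => ?_
    have h1 := (Finset.sum_eq_zero_iff_of_nonneg fun g _ => sq_nonneg ‖f g x‖).1 hx g hg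
    have h2 : f g x = 0 := by simpa using h1
    exact Circle.ext (sub_eq_zero.1 h2)
  have hvan (a : C₀(X, ℂ)) (ha : a x₀ = 0) : φ a ξ = 0 := by
    rw [← norm_le_zero_iff]
    refine le_of_forall_pos_le_add fun δ hδ => ?_
    obtain ⟨a', ha'⟩ := exists_norm_sub_bcfMul_le (δ := δ / (‖ξ‖ + 1)) hhr
      (fun x => Finset.sum_nonneg fun g _ => sq_nonneg _) (fun x hx => by rw [hr0 x hx, ha])
      (by positivity)
    have h1 : φ a ξ = φ (a - bcfMul h a') ξ := by rw [map_sub, sub_apply, hh, sub_zero]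
    rw [h1, zero_add]
    calc ‖φ (a - bcfMul h a') ξ‖ ≤ δ / (‖ξ‖ + 1) * ‖ξ‖ := by
          refine ContinuousLinearMap.le_of_opNorm_le _ ?_ ξ
          exact (NonUnitalStarAlgHom.norm_apply_le φ _).trans ha'
      _ ≤ δ := by
          rw [div_mul_eq_mul_div, div_le_iff₀ (by positivity)]
          gcongr
          linarith
  obtain ⟨a₁, h1, -, -⟩ := exists_bump isOpen_univ (Set.mem_univ x₀)
  set v := φ a₁ ξ with hv
  have hav (a : C₀(X, ℂ)) : φ a ξ = a x₀ • v := by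
    have h2 := hvan (a - a x₀ • a₁) (by simp [h1])
    rwa [map_sub, map_smul, sub_apply, smul_apply, sub_eq_zero] at h2
  have hv' : v = ξ := by
    refine hφ.nondegenerate.eq_of_inner_right ℂ fun w hw => ?_
    induction hw using Submodule.span_induction with
    | mem w hw =>
      obtain ⟨a, η, rfl⟩ := hw
      have h3 (ζ : H) : ⟪φ a η, ζ⟫ = ⟪η, φ (star a) ζ⟫ := by
        rw [map_star, ContinuousLinearMap.star_eq_adjoint, ContinuousLinearMap.adjoint_inner_right]
      rw [h3, h3, hav, hv, ← mul_apply_eq_comp, ← map_mul, hav,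
        ZeroAtInftyContinuousMap.mul_apply, h1, mul_one]
    | zero => simp
    | add w w' _ _ hw hw' => rw [inner_add_left, inner_add_left, hw, hw']
    | smul c w _ hw => rw [inner_smul_left, inner_smul_left, hw]
  rw [hav, hv']

/-- The representation of `C₀(X)` associated with a diagonal representation of `G` is diagonal. -/
theorem integratedForm_apply {b : HilbertBasis ι ℂ H} {p : ι → X}
    (hU : ∀ g i, U.op g (b i) = (W.toFun g (p i) : ℂ) • b i)
    (hsep : ∀ x₀, ∃ s : Finset G, ∀ x, (∀ g ∈ s, W.toFun g x = W.toFun g x₀) → x = x₀)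
    (a : C₀(X, ℂ)) (i : ι) : integratedForm W U a (b i) = a (p i) • b i := by
  let φ : C₀(X, ℂ) →⋆ₙₐ[ℂ] (H →L[ℂ] H) :=
    { toFun := fun a => diagHom b p a.toBCF
      map_smul' := fun c a => map_smul (diagHom b p) c a.toBCF
      map_zero' := map_zero (diagHom b p)
      map_add' := fun a a' => map_add (diagHom b p) a.toBCF a'.toBCF
      map_mul' := fun a a' => map_mul (diagHom b p) a.toBCF a'.toBCF
      map_star' := fun a => map_star (diagHom b p) a.toBCF }
  have hφ (a : C₀(X, ℂ)) (i : ι) : φ a (b i) = a (p i) • b i := diagHom_apply b p a.toBCF i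
  have hex : ∃ φ, IsIntegratedForm W U φ := by
    refine ⟨φ, ?_, fun g a a' h => b.operator_ext fun i => ?_⟩
    · refine (Submodule.dense_iff_topologicalClosure_eq_top.2 b.dense_span).mono
        (Submodule.span_mono ?_)
      rintro _ ⟨i, rfl⟩
      obtain ⟨a, h1, -, -⟩ := exists_bump isOpen_univ (Set.mem_univ (p i))
      exact ⟨a, b i, by rw [hφ, h1, one_smul]⟩
    · rw [mul_apply_eq_comp, hφ, hφ, map_smul, hU, h, smul_smul, mul_comm]
  rw [integratedForm, dif_pos hex]
  exact hex.choose_spec.apply_eigenvector (fun g => hU g i) (hsep _) a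

end IntegratedForm

section TensorRep
variable {X X' H K ι κ : Type*} [TopologicalSpace X] [T2Space X] [LocallyCompactSpace X]
  [TopologicalSpace X'] [T2Space X'] [LocallyCompactSpace X'] [NormedAddCommGroup H]
  [InnerProductSpace ℂ H] [CompleteSpace H] [NormedAddCommGroup K] [InnerProductSpace ℂ K]
  [CompleteSpace K]

/-- The extension of `φ ⊗ ψ` to bounded functions, for diagonal representations `φ` and `ψ`. A function
`F` is compared with its value at a point by localizing with bump functions, on which the extension is
determined. -/
theorem tensorRep_eq_diagHom {φ : C₀(X, ℂ) →⋆ₙₐ[ℂ] (H →L[ℂ] H)}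
    {ψ : C₀(X', ℂ) →⋆ₙₐ[ℂ] (K →L[ℂ] K)} {b : HilbertBasis ι ℂ H} {b' : HilbertBasis κ ℂ K}
    {p : ι → X} {p' : κ → X'} (hφ : ∀ a i, φ a (b i) = a (p i) • b i)
    (hψ : ∀ a i, ψ a (b' i) = a (p' i) • b' i) (F : X × X' →ᵇ ℂ) :
    tensorRep φ ψ F = diagHom (tensorBasis b b') (fun k => (p k.1, p' k.2)) F := by
  have htens (a : C₀(X, ℂ)) (a' : C₀(X', ℂ)) (k : ι × κ) :
      opTensor (φ a) (ψ a') (tensorBasis b b' k) =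
        (a (p k.1) * a' (p' k.2)) • tensorBasis b b' k := by
    rw [tensorBasis_apply, opTensor_pureTensor, hφ, hψ, pureTensor_smul_left,
      pureTensor_smul_right, smul_smul]
  have hex : ∃ Φ, IsTensorRep φ ψ Φ := by
    refine ⟨diagHom (tensorBasis b b') fun k => (p k.1, p' k.2), fun a a' => ?_⟩
    refine (tensorBasis b b').operator_ext fun k => ?_
    rw [diagHom_apply, htens]
    rfl
  rw [tensorRep, dif_pos hex]
  have hΦ := hex.choose_spec
  generalize hex.choose = Φ at hΦ
  refine (tensorBasis b b').operator_ext fun k => ?_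
  rw [diagHom_apply, ← sub_eq_zero, ← norm_le_zero_iff]
  refine le_of_forall_pos_le_add fun ε hε => ?_
  set x₀ : X × X' := (p k.1, p' k.2) with hx₀
  have hnhds : {x | ‖F x - F x₀‖ < ε} ∈ nhds x₀ := by
    have : Continuous fun x => ‖F x - F x₀‖ := by fun_prop
    exact this.continuousAt.preimage_mem_nhds (gt_mem_nhds (by simpa using hε))
  obtain ⟨V, V', hV, hxV, hV', hxV', hVV⟩ := mem_nhds_prod_iff'.1 hnhds
  obtain ⟨a, ha1, han, ha0⟩ := exists_bump hV hxV
  obtain ⟨a', ha1', han', ha0'⟩ := exists_bump hV' hxV'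
  have hfix : Φ (tensorFun a a') (tensorBasis b b' k) = tensorBasis b b' k := by
    rw [hΦ a a', htens, ha1, ha1', mul_one, one_smul]
  set F' : X × X' →ᵇ ℂ := (F - F x₀ • 1) * tensorFun a a' with hF'
  have h1 : Φ F (tensorBasis b b' k) - F x₀ • tensorBasis b b' k =
      Φ F' (tensorBasis b b' k) := by
    rw [hF', map_mul, mul_apply_eq_comp, hfix, map_sub, map_smul, map_one, sub_apply, smul_apply,
      one_apply_eq_self]
  have h2 : ‖F'‖ ≤ ε := by
    refine (BoundedContinuousFunction.norm_le hε.le).2 fun x => ?_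
    have e : F' x = (F x - F x₀) * (a x.1 * a' x.2) := by
      change (F x - F x₀ * 1) * (a x.1 * a' x.2) = _
      rw [mul_one]
    rw [e, norm_mul, norm_mul]
    by_cases hx : x ∈ V ×ˢ V'
    · calc ‖F x - F x₀‖ * (‖a x.1‖ * ‖a' x.2‖) ≤ ε * (1 * 1) := by
            gcongr
            · exact (hVV hx).le
            · exact han _
            · exact han' _
        _ = ε := by ring
    · rw [Set.mem_prod, not_and_or] at hx
      rcases hx with hx | hx
      · rw [ha0 _ hx]; simpa using hε.le
      · rw [ha0' _ hx]; simpa using hε.le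
  rw [h1, zero_add]
  calc ‖Φ F' (tensorBasis b b' k)‖ ≤ ε * ‖tensorBasis b b' k‖ :=
        ContinuousLinearMap.le_of_opNorm_le _
          ((norm_starAlgHom_apply_le Φ F').trans h2) _
    _ = ε := by rw [(tensorBasis b b').orthonormal.1 k, mul_one]

end TensorRep

/-! ### Multiplication and translation operators in the Fourier basis -/

section Fourier

/-- The orthonormal basis of the exponentials in `L²(𝕋)`. -/
abbrev expBasis : HilbertBasis ℤ ℂ L2T := fourierBasis

/-- The operator of multiplication by the `k`-th exponential. -/
def expOp (k : ℤ) : L2T →L[ℂ] L2T := mulOp (fourierLp ∞ k)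

theorem expBasis_ae (n : ℤ) : expBasis n =ᵐ[haarAddCircle] fourier n := by
  rw [coe_fourierBasis]
  exact coeFn_fourierLp 2 n

theorem expOp_apply (k n : ℤ) : expOp k (expBasis n) = expBasis (k + n) := by
  apply Lp.ext
  filter_upwards [coeFn_mulOp (fourierLp ∞ k) (expBasis n), expBasis_ae n, expBasis_ae (k + n),
    coeFn_fourierLp (T := (1 : ℝ)) ∞ k] with x h1 h2 h3 h4
  rw [expOp, h1, h2, h3, h4, fourier_add]

theorem expOp_zero : expOp 0 = 1 := expBasis.operator_ext fun n => by
  rw [expOp_apply, zero_add, one_apply_eq_self]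

theorem shift_expBasis (c : 𝕋) (n : ℤ) :
    shift c (expBasis n) = ((n • c).toCircle : ℂ) • expBasis n := by
  apply Lp.ext
  filter_upwards [coeFn_shift c (expBasis n), expBasis_ae n,
    (measurePreserving_add c).quasiMeasurePreserving.ae (expBasis_ae n),
    Lp.coeFn_smul ((n • c).toCircle : ℂ) (expBasis n)] with x h1 h2 h3 h4
  rw [h1, h3, h4, Pi.smul_apply, h2, fourier_apply, fourier_apply, smul_add, AddCircle.toCircle_add,
    Circle.coe_mul, smul_eq_mul, mul_comm]

theorem koopman_op_expBasis {G : Type*} [AddCommGroup G] [TopologicalSpace G] (τ : G →ₜ+ 𝕋) (g : G)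
    (n : ℤ) : (koopman τ).op g (expBasis n) = ((n • -τ g).toCircle : ℂ) • expBasis n :=
  shift_expBasis _ _

theorem mem_LinfT_iff {m : L2T →L[ℂ] L2T} : m ∈ LinfT ↔ ∃ f, mulOp f = m := by
  rw [← SetLike.mem_coe, coe_LinfT]; rfl

theorem expOp_mem (k : ℤ) : expOp k ∈ LinfT := mulOp_mem _

theorem inner_expBasis_mulOp (f : LinfFun) (g : L2T) (j : ℤ) :
    ⟪expBasis j, mulOp f g⟫ = ⟪expOp j (star g), mulOp f (expBasis 0)⟫ := by
  rw [L2.inner_def, L2.inner_def]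
  apply integral_congr_ae
  filter_upwards [coeFn_mulOp f g, coeFn_mulOp f (expBasis 0), coeFn_mulOp (fourierLp ∞ j) (star g),
    coeFn_fourierLp (T := (1 : ℝ)) ∞ j, expBasis_ae j, expBasis_ae 0, Lp.coeFn_star g]
    with x h1 h2 h3 h4 h5 h6 h7
  rw [expOp, h1, h2, h3, h4, h5, h6, h7, fourier_zero, Pi.star_apply]
  simp only [RCLike.inner_apply, mul_one, map_mul, RCLike.star_def, Complex.conj_conj]
  ring

/-- The exponentials generate `L^∞(𝕋)`: if `T` commutes with them and `g = T 1`, then `T f` and `f g`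
have inner products with the basis vector `e_j` given by pairing `f` with `T* e_j` and with `e_j ḡ`, and
these two functions have the same Fourier coefficients. -/
theorem mem_bicommutant_expOp {m : L2T →L[ℂ] L2T} (hm : m ∈ LinfT) :
    m ∈ (Set.range expOp).centralizer.centralizer := by
  obtain ⟨f, rfl⟩ := mem_LinfT_iff.1 hm
  intro T hT
  set g := T (expBasis 0) with hg
  have hexp (k : ℤ) : expBasis k = expOp k (expBasis 0) := by rw [expOp_apply, add_zero]
  have hTk (k : ℤ) (ξ : L2T) : T (expOp k ξ) = expOp k (T ξ) :=
    (DFunLike.congr_fun (hT _ ⟨k, rfl⟩) ξ).symm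
  have hadj (j : ℤ) : ContinuousLinearMap.adjoint T (expBasis j) = expOp j (star g) := by
    refine ext_inner_right ℂ fun v => ?_
    rw [← inner_conj_symm, ← inner_conj_symm _ v]
    congr 1
    revert v
    rw [← ext_iff_inner_left ℂ]
    refine expBasis.ext_inner fun k => ?_
    rw [← inner_conj_symm, ← inner_conj_symm (expBasis k)]
    congr 1
    rw [ContinuousLinearMap.adjoint_inner_left, hexp k, hTk]
    exact inner_expBasis_mulOp _ _ _
  have h0 : T (mulOp f (expBasis 0)) = mulOp f g := by
    refine expBasis.ext_inner fun j => ?_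
    rw [inner_expBasis_mulOp, ← hadj, ContinuousLinearMap.adjoint_inner_left]
  have hcomm (k : ℤ) (ξ : L2T) : mulOp f (expOp k ξ) = expOp k (mulOp f ξ) :=
    DFunLike.congr_fun (mulOp_comm f (fourierLp ∞ k)) ξ
  refine expBasis.operator_ext fun k => ?_
  rw [mul_apply_eq_comp, mul_apply_eq_comp, hexp, hcomm, hTk, hTk, hcomm, h0]

end Fourier

/-! ### The operators `𝒳` for the double of the circle -/

section Example

theorem zsmul_irrational_eq_zero {x : ℝ} (hx : Irrational x) {k : ℤ} (h : k • (x : 𝕋) = 0) :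
    k = 0 := by
  rw [← AddCircle.coe_zsmul, AddCircle.coe_eq_zero_iff] at h
  obtain ⟨n, hn⟩ := h
  by_contra hk
  refine hx ⟨(n : ℚ) / k, ?_⟩
  have hk' : (k : ℝ) ≠ 0 := by exact_mod_cast hk
  push_cast
  rw [div_eq_iff hk']
  simp only [zsmul_eq_mul, mul_one] at hn
  rw [hn, mul_comm]

theorem toCircle_eq_iff {s t : 𝕋} : s.toCircle = t.toCircle ↔ s = t :=
  (AddCircle.injective_toCircle (T := (1 : ℝ)) one_ne_zero).eq_iff

/-- Two characters of `D(𝕋)`, evaluated at `(s, 0)` with `s` irrational and at `(0, 1)`, suffice to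
separate the points of the dual group. -/
theorem exists_separating (x₀ : ℤ × 𝕋) : ∃ s : Finset (𝕋 × ℤ), ∀ x,
    (∀ g ∈ s, (drinfeldPairing torusPairing).toFun g x =
      (drinfeldPairing torusPairing).toFun g x₀) → x = x₀ := by
  classical
  refine ⟨{(((√2 : ℝ) : 𝕋), 0), (0, 1)}, fun x hx => ?_⟩
  have h1 := hx (((√2 : ℝ) : 𝕋), 0) (by simp)
  have h2 := hx (0, 1) (by simp)
  simp only [drinfeldPairing, torusPairing, zero_smul, one_smul, smul_zero, AddCircle.toCircle_zero,
    inv_one, mul_one, one_mul, inv_inj, toCircle_eq_iff] at h1 h2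
  refine Prod.ext ?_ h2
  rw [← sub_eq_zero]
  refine zsmul_irrational_eq_zero irrational_sqrt_two ?_
  rw [sub_smul, h1, sub_self]

theorem integratedForm_implM (a : C₀(ℤ × 𝕋, ℂ)) (n : ℤ) :
    integratedForm (drinfeldPairing torusPairing) implM.toUnitaryRep a (expBasis n) =
      a (-n, 0) • expBasis n := by
  refine integratedForm_apply (b := expBasis) (p := fun n => (-n, 0)) (fun g n => ?_)
    exists_separating a n
  refine (koopman_op_expBasis (ContinuousAddMonoidHom.fst 𝕋 ℤ) g n).trans ?_
  simp [drinfeldPairing, torusPairing]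

theorem integratedForm_implN (θ : 𝕋) (a : C₀(ℤ × 𝕋, ℂ)) (n : ℤ) :
    integratedForm (drinfeldPairing torusPairing) (implN θ).toUnitaryRep a (expBasis n) =
      a (0, n • θ) • expBasis n := by
  refine integratedForm_apply (b := expBasis) (p := fun n => (0, n • θ)) (fun g n => ?_)
    exists_separating a n
  refine (koopman_op_expBasis ((rotHom θ).comp (ContinuousAddMonoidHom.snd 𝕋 ℤ)) g n).trans ?_
  congr 2
  change (n • -(g.2 • θ)).toCircle = ((0 : ℤ) • g.1).toCircle * ((g.2 • n • θ).toCircle)⁻¹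
  rw [zero_smul, AddCircle.toCircle_zero, one_mul, ← AddCircle.toCircle_neg, smul_neg,
    smul_comm]

/-- The orthonormal basis of the exponentials in `L²(𝕋) ⊗ L²(𝕋)`. -/
abbrev expBasis₂ : HilbertBasis (ℤ × ℤ) ℂ (HilbertTensor L2T L2T) := tensorBasis expBasis expBasis

/-- For `M ⊠ N` the operator `𝒳` is trivial. -/
theorem tensorRep_MN (θ : 𝕋) :
    tensorRep (integratedForm (drinfeldPairing torusPairing) implM.toUnitaryRep)
      (integratedForm (drinfeldPairing torusPairing) (implN θ).toUnitaryRep)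
      (rMatrix torusPairing).toBCF = 1 := by
  rw [tensorRep_eq_diagHom integratedForm_implM (integratedForm_implN θ)]
  refine expBasis₂.operator_ext fun k => ?_
  rw [diagHom_apply]
  change ((((0 : ℤ) • (0 : 𝕋)).toCircle : Circle) : ℂ) • _ = _
  rw [smul_zero, AddCircle.toCircle_zero, Circle.coe_one, one_smul, one_apply_eq_self]

theorem one_conj_opTensor_mul {H K : Type*} [NormedAddCommGroup H] [InnerProductSpace ℂ H]
    [CompleteSpace H] [NormedAddCommGroup K] [InnerProductSpace ℂ K] [CompleteSpace K]
    (m : H →L[ℂ] H) (n : K →L[ℂ] K) :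
    ((1 : HilbertTensor H K →L[ℂ] HilbertTensor H K) * opTensor m 1 * star 1) * opTensor 1 n =
      opTensor m n := by
  have h : star (1 : HilbertTensor H K →L[ℂ] HilbertTensor H K) = 1 := by
    rw [← opTensor_one, opTensor_star, star_one, star_one]
  rw [h, one_mul, mul_one, opTensor_mul, mul_one, one_mul]

theorem braidedMN_eq (θ : 𝕋) : braidedMN θ =
    (vnTensor LinfT LinfT : Set (HilbertTensor L2T L2T →L[ℂ] HilbertTensor L2T L2T)) := by
  have h : braidedMN θ = ultraweakSpan {T | ∃ m ∈ LinfT, ∃ n ∈ LinfT, T = opTensor m n} := by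
    unfold braidedMN braidedTensorProduct
    rw [tensorRep_MN]
    simp only [one_conj_opTensor_mul]
  rw [h, vnTensor]
  refine ultraweakSpan_eq_generatedVN ⟨1, one_mem _, 1, one_mem _, opTensor_one.symm⟩ ?_ ?_
  · rintro _ ⟨m, hm, n, hn, rfl⟩ _ ⟨m', hm', n', hn', rfl⟩
    exact ⟨_, mul_mem hm hm', _, mul_mem hn hn', opTensor_mul _ _ _ _⟩
  · rintro _ ⟨m, hm, n, hn, rfl⟩
    exact ⟨_, star_mem hm, _, star_mem hn, opTensor_star _ _⟩

theorem vnTensor_comm {x y : HilbertTensor L2T L2T →L[ℂ] HilbertTensor L2T L2T}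
    (hx : x ∈ vnTensor LinfT LinfT) (hy : y ∈ vnTensor LinfT LinfT) : x * y = y * x := by
  refine generatedVN_comm ?_ ?_ hx hy
  · rintro _ ⟨m, hm, n, hn, rfl⟩
    exact ⟨_, star_mem hm, _, star_mem hn, opTensor_star _ _⟩
  · rintro _ ⟨m, hm, n, hn, rfl⟩ _ ⟨m', hm', n', hn', rfl⟩
    have hc {m m' : L2T →L[ℂ] L2T} (hm : m ∈ LinfT) (hm' : m' ∈ LinfT) : m * m' = m' * m := by
      obtain ⟨f, rfl⟩ := mem_LinfT_iff.1 hm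
      obtain ⟨f', rfl⟩ := mem_LinfT_iff.1 hm'
      exact mulOp_comm f f'
    rw [opTensor_mul, opTensor_mul, hc hm hm', hc hn hn']

/-! ### The rotation algebra -/

/-- The translation by `k θ` on `L²(𝕋)`. -/
abbrev rotOp (θ : 𝕋) (k : ℤ) : L2T →L[ℂ] L2T := (koopman (rotHom θ)).op k

theorem rotOp_apply (θ : 𝕋) (k n : ℤ) :
    rotOp θ k (expBasis n) = ((n • -(k • θ)).toCircle : ℂ) • expBasis n :=
  koopman_op_expBasis (rotHom θ) k n

theorem rotOp_zero (θ : 𝕋) : rotOp θ 0 = 1 := UnitaryRep.op_zero _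

/-- The bicharacter `(k, c) ↦ exp(-2πi k₁ c₂ θ)` on `ℤ²`. -/
def rotBichar (θ : 𝕋) : Bicharacter (ℤ × ℤ) (ℤ × ℤ) where
  toFun k c := (c.2 • -(k.1 • θ)).toCircle
  map_add_left k k' c := by
    rw [Prod.fst_add, add_smul, neg_add, smul_add, AddCircle.toCircle_add]
  map_add_right k c c' := by
    rw [Prod.snd_add, add_smul, AddCircle.toCircle_add]
  continuous_toFun := continuous_of_discreteTopology

/-- The unitaries that generate `N ⊠ M`; the left twisted regular representation of `ℤ²`. -/
def leftRot (θ : 𝕋) (k : ℤ × ℤ) : HilbertTensor L2T L2T →L[ℂ] HilbertTensor L2T L2T :=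
  opTensor (expOp k.1) (expOp k.2 * rotOp θ k.1)

/-- The unitaries that generate the commutant of `N ⊠ M`; the right twisted regular representation. -/
def rightRot (θ : 𝕋) (k : ℤ × ℤ) : HilbertTensor L2T L2T →L[ℂ] HilbertTensor L2T L2T :=
  opTensor (expOp k.1 * rotOp θ k.2) (expOp k.2)

theorem isTwistedRegular_leftRot (θ : 𝕋) :
    IsTwistedRegular expBasis₂ (rotBichar θ) (leftRot θ) := by
  intro k c
  rw [leftRot, tensorBasis_apply, tensorBasis_apply, opTensor_pureTensor, mul_apply_eq_comp,
    rotOp_apply, map_smul, expOp_apply, expOp_apply, pureTensor_smul_right]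
  rfl

theorem isTwistedRegular_rightRot (θ : 𝕋) :
    IsTwistedRegular expBasis₂ (rotBichar θ).flip (rightRot θ) := by
  intro k c
  rw [rightRot, tensorBasis_apply, tensorBasis_apply, opTensor_pureTensor, mul_apply_eq_comp,
    rotOp_apply, map_smul, expOp_apply, expOp_apply, pureTensor_smul_left, smul_neg, smul_comm,
    ← smul_neg]
  rfl

/-- The von Neumann algebra generated by the left twisted regular representation of `ℤ²`. -/
abbrev rotAlgebra (θ : 𝕋) : VonNeumannAlgebra (HilbertTensor L2T L2T) :=
  generatedVN (Set.range (leftRot θ))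

theorem leftRot_snd (θ : 𝕋) (j : ℤ) : leftRot θ (0, j) = opTensor 1 (expOp j) := by
  change opTensor (expOp 0) (expOp j * rotOp θ 0) = _
  rw [expOp_zero, rotOp_zero, mul_one]

theorem leftRot_fst (θ : 𝕋) (k : ℤ) : leftRot θ (k, 0) = opTensor (expOp k) (rotOp θ k) := by
  change opTensor (expOp k) (expOp 0 * rotOp θ k) = _
  rw [expOp_zero, one_mul]

theorem leftRot_mem (θ : 𝕋) (k : ℤ × ℤ) : leftRot θ k ∈ rotAlgebra θ :=
  subset_generatedVN _ ⟨k, rfl⟩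

theorem mem_rotAlgebra_iff (θ : 𝕋) {x : HilbertTensor L2T L2T →L[ℂ] HilbertTensor L2T L2T} :
    x ∈ rotAlgebra θ ↔ x ∈ (Set.range (leftRot θ)).centralizer.centralizer := by
  rw [← SetLike.mem_coe, coe_generatedVN, (isTwistedRegular_leftRot θ).centralizer_union_star]

theorem opTensor_one_mem (θ : 𝕋) {n : L2T →L[ℂ] L2T} (hn : n ∈ LinfT) :
    opTensor 1 n ∈ rotAlgebra θ := by
  rw [mem_rotAlgebra_iff]
  intro Q hQ
  refine (isAmplification_right.commute (mem_bicommutant_expOp hn) ?_).symm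
  rintro _ ⟨j, rfl⟩
  rw [← leftRot_snd θ]
  exact hQ _ ⟨_, rfl⟩

/-- The operator `𝒳` for `N ⊠ M`: it is diagonal, with eigenvalues `exp(-2πi n m θ)`. -/
def rotX (θ : 𝕋) : HilbertTensor L2T L2T →L[ℂ] HilbertTensor L2T L2T :=
  tensorRep (integratedForm (drinfeldPairing torusPairing) (implN θ).toUnitaryRep)
    (integratedForm (drinfeldPairing torusPairing) implM.toUnitaryRep) (rMatrix torusPairing).toBCF

theorem rotX_eq (θ : 𝕋) : rotX θ = diagHom expBasis₂
    (fun k => (((0, k.1 • θ) : ℤ × 𝕋), ((-k.2, 0) : ℤ × 𝕋))) (rMatrix torusPairing).toBCF :=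
  tensorRep_eq_diagHom (integratedForm_implN θ) integratedForm_implM _

theorem rotX_apply (θ : 𝕋) (k : ℤ × ℤ) :
    rotX θ (expBasis₂ k) = ((-k.2 • k.1 • θ).toCircle : ℂ) • expBasis₂ k := by
  rw [rotX_eq, diagHom_apply]
  rfl

theorem rotX_pureTensor (θ : 𝕋) (n m : ℤ) : rotX θ (pureTensor (expBasis n) (expBasis m)) =
    ((-m • n • θ).toCircle : ℂ) • pureTensor (expBasis n) (expBasis m) := by
  have := rotX_apply θ (n, m)
  rwa [tensorBasis_apply] at this

theorem star_toBCF_mul_self {X Y : Type*} [AddCommGroup X] [TopologicalSpace X] [AddCommGroup Y]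
    [TopologicalSpace Y] (χ : Bicharacter X Y) : star χ.toBCF * χ.toBCF = 1 := by
  ext q
  change starRingEnd ℂ (χ.toFun q.1 q.2 : ℂ) * (χ.toFun q.1 q.2 : ℂ) = 1
  rw [← Circle.coe_inv_eq_conj, ← Circle.coe_mul, inv_mul_cancel, Circle.coe_one]

theorem star_rotX_mul_self (θ : 𝕋) : star (rotX θ) * rotX θ = 1 := by
  rw [rotX_eq, ← map_star, ← map_mul, star_toBCF_mul_self, map_one]

theorem rotX_mul_star_self (θ : 𝕋) : rotX θ * star (rotX θ) = 1 := by
  rw [rotX_eq, ← map_star, ← map_mul, mul_comm, star_toBCF_mul_self, map_one]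

theorem rotX_conj_expOp (θ : 𝕋) (k : ℤ) :
    rotX θ * opTensor (expOp k) 1 * star (rotX θ) = leftRot θ (k, 0) := by
  have h : rotX θ * opTensor (expOp k) 1 = leftRot θ (k, 0) * rotX θ := by
    refine expBasis₂.operator_ext fun c => ?_
    rw [tensorBasis_apply, leftRot_fst, mul_apply_eq_comp, mul_apply_eq_comp, opTensor_pureTensor,
      expOp_apply, one_apply_eq_self, rotX_pureTensor, rotX_pureTensor, map_smul,
      opTensor_pureTensor, expOp_apply, rotOp_apply, pureTensor_smul_right, smul_smul (M := ℂ),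
      ← Circle.coe_mul, ← AddCircle.toCircle_add, add_smul, smul_add, smul_neg, neg_smul, neg_smul,
      add_comm]
  rw [h, mul_assoc, rotX_mul_star_self, mul_one]

theorem rotX_conj_mem (θ : 𝕋) {m : L2T →L[ℂ] L2T} (hm : m ∈ LinfT) :
    rotX θ * opTensor m 1 * star (rotX θ) ∈ rotAlgebra θ := by
  rw [mem_rotAlgebra_iff]
  intro Q hQ
  set X := rotX θ
  have h1 : star X * X = 1 := star_rotX_mul_self θ
  have h2 : X * star X = 1 := rotX_mul_star_self θ
  have key : opTensor m 1 * (star X * Q * X) = star X * Q * X * opTensor m 1 := by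
    refine isAmplification_left.commute (mem_bicommutant_expOp hm) ?_
    rintro _ ⟨k, rfl⟩
    have h : X * opTensor (expOp k) 1 * star X * Q = Q * (X * opTensor (expOp k) 1 * star X) := by
      rw [rotX_conj_expOp]
      exact hQ _ ⟨(k, 0), rfl⟩
    calc opTensor (expOp k) 1 * (star X * Q * X)
        = star X * X * opTensor (expOp k) 1 * star X * Q * X := by
          rw [h1, one_mul]; simp only [mul_assoc]
      _ = star X * (X * opTensor (expOp k) 1 * star X * Q) * X := by simp only [mul_assoc]
      _ = star X * Q * X * opTensor (expOp k) 1 * (star X * X) := by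
          rw [h]; simp only [mul_assoc]
      _ = star X * Q * X * opTensor (expOp k) 1 := by rw [h1, mul_one]
  calc Q * (X * opTensor m 1 * star X) = X * star X * Q * X * opTensor m 1 * star X := by
        rw [h2, one_mul]; simp only [mul_assoc]
    _ = X * (star X * Q * X * opTensor m 1) * star X := by simp only [mul_assoc]
    _ = X * opTensor m 1 * star X * Q * (X * star X) := by rw [← key]; simp only [mul_assoc]
    _ = X * opTensor m 1 * star X * Q := by rw [h2, mul_one]

theorem coe_rotAlgebra (θ : 𝕋) :
    (rotAlgebra θ : Set (HilbertTensor L2T L2T →L[ℂ] HilbertTensor L2T L2T)) = braidedNM θ := by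
  have hdef : braidedNM θ = ultraweakSpan {T | ∃ m ∈ LinfT, ∃ n ∈ LinfT,
      T = (rotX θ * opTensor m 1 * star (rotX θ)) * opTensor 1 n} := rfl
  rw [hdef]
  refine Set.Subset.antisymm ?_ (ultraweakSpan_subset ?_)
  · refine ((isTwistedRegular_leftRot θ).coe_generatedVN_subset_ultraweakSpan).trans
      (ultraweakSpan_mono ?_)
    rintro _ ⟨⟨k, j⟩, rfl⟩
    have h := (isTwistedRegular_leftRot θ).mul (k, 0) (0, j)
    rw [Prod.mk_add_mk, add_zero, zero_add] at h
    rw [← inv_smul_smul₀ (Circle.coe_ne_zero ((rotBichar θ).toFun (k, 0) (0, j)))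
      (leftRot θ (k, j)), ← h]
    refine Submodule.smul_mem _ _ (Submodule.subset_span
      ⟨expOp k, expOp_mem k, expOp j, expOp_mem j, ?_⟩)
    rw [rotX_conj_expOp, leftRot_snd]
  · rintro _ ⟨m, hm, n, hn, rfl⟩
    exact mul_mem (rotX_conj_mem θ hm) (opTensor_one_mem θ hn)

end Example

/-! ### The crossed product -/

section Conjugation
variable {H K : Type*} [NormedAddCommGroup H] [InnerProductSpace ℂ H] [CompleteSpace H]
  [NormedAddCommGroup K] [InnerProductSpace ℂ K] [CompleteSpace K]

theorem map_mem_centralizer {Φ : (H →L[ℂ] H) ≃⋆ₐ[ℂ] (K →L[ℂ] K)} {S : Set (H →L[ℂ] H)}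
    {x : H →L[ℂ] H} : Φ x ∈ (Φ '' S).centralizer ↔ x ∈ S.centralizer := by
  constructor
  · intro h a ha
    apply Φ.injective
    rw [map_mul, map_mul]
    exact h _ ⟨a, ha, rfl⟩
  · rintro h _ ⟨a, ha, rfl⟩
    rw [← map_mul, ← map_mul, h a ha]

theorem centralizer_image (Φ : (H →L[ℂ] H) ≃⋆ₐ[ℂ] (K →L[ℂ] K)) (S : Set (H →L[ℂ] H)) :
    (Φ '' S).centralizer = Φ '' S.centralizer := by
  ext y
  obtain ⟨x, rfl⟩ : ∃ x, Φ x = y := ⟨Φ.symm y, Φ.apply_symm_apply y⟩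
  have hinj : Function.Injective Φ := Φ.injective
  rw [map_mem_centralizer, hinj.mem_set_image]

theorem map_mem_generatedVN {Φ : (H →L[ℂ] H) ≃⋆ₐ[ℂ] (K →L[ℂ] K)} {S : Set (H →L[ℂ] H)}
    {x : H →L[ℂ] H} : Φ x ∈ generatedVN (Φ '' S) ↔ x ∈ generatedVN S := by
  have hinj : Function.Injective Φ := Φ.injective
  have hstar : star (Φ '' S) = Φ '' star S := by
    ext y
    obtain ⟨x, rfl⟩ : ∃ x, Φ x = y := ⟨Φ.symm y, Φ.apply_symm_apply y⟩
    have hx : star (Φ x) = Φ (star x) := (Φ.map_star' x).symm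
    rw [Set.mem_star, hx, hinj.mem_set_image, hinj.mem_set_image, Set.mem_star]
  rw [← SetLike.mem_coe, ← SetLike.mem_coe, coe_generatedVN, coe_generatedVN, hstar,
    ← Set.image_union, centralizer_image, map_mem_centralizer]

theorem nonempty_starAlgEquiv {P : VonNeumannAlgebra H} {Q : VonNeumannAlgebra K}
    (Φ : (H →L[ℂ] H) ≃⋆ₐ[ℂ] (K →L[ℂ] K)) (h : ∀ x, Φ x ∈ Q ↔ x ∈ P) :
    Nonempty (P.toStarSubalgebra ≃⋆ₐ[ℂ] Q.toStarSubalgebra) :=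
  ⟨{ toFun := fun x => ⟨Φ x, (h x).2 x.2⟩
     invFun := fun y => ⟨Φ.symm y, (h _).1 (by rw [Φ.apply_symm_apply]; exact y.2)⟩
     left_inv := fun x => Subtype.ext (Φ.symm_apply_apply _)
     right_inv := fun y => Subtype.ext (Φ.apply_symm_apply _)
     map_mul' := fun x y => Subtype.ext (Φ.map_mul' x.1 y.1)
     map_add' := fun x y => Subtype.ext (Φ.map_add' x.1 y.1)
     map_star' := fun x => Subtype.ext (Φ.map_star' x.1)
     map_smul' := fun c x => Subtype.ext (Φ.map_smul' c x.1) }⟩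

theorem mul_comm_of_starAlgEquiv {P : VonNeumannAlgebra H} {Q : VonNeumannAlgebra K}
    (e : P.toStarSubalgebra ≃⋆ₐ[ℂ] Q.toStarSubalgebra) (hP : ∀ x ∈ P, ∀ y ∈ P, x * y = y * x)
    {u v : K →L[ℂ] K} (hu : u ∈ Q) (hv : v ∈ Q) : u * v = v * u := by
  obtain ⟨a, ha⟩ : ∃ a, e a = ⟨u, hu⟩ := ⟨e.symm _, e.apply_symm_apply _⟩
  obtain ⟨b, hb⟩ : ∃ b, e b = ⟨v, hv⟩ := ⟨e.symm _, e.apply_symm_apply _⟩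
  have hab : a * b = b * a := Subtype.ext (hP a.1 a.2 b.1 b.2)
  have h : e a * e b = e b * e a :=
    (e.map_mul' a b).symm.trans ((congrArg e hab).trans (e.map_mul' b a))
  rw [ha, hb] at h
  exact congrArg Subtype.val h

end Conjugation

section CrossedProduct

/-- The isometry `ξ ↦ e_k ⊗ U_k ξ`, where `U_k` is the translation by `k θ`. -/
def rotSummand (θ : 𝕋) (k : ℤ) : L2T →ₗᵢ[ℂ] HilbertTensor L2T L2T where
  toLinearMap := ((tensorLeft (K := L2T) (expBasis k)).comp (rotOp θ k)).toLinearMap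
  norm_map' ξ := by
    have h : ‖rotOp θ k ξ‖ = ‖ξ‖ := ((koopman (rotHom θ)).toFun k).norm_map ξ
    change ‖((expBasis k ⊗ₜ[ℂ] rotOp θ k ξ : L2T ⊗[ℂ] L2T) : HilbertTensor L2T L2T)‖ = ‖ξ‖
    rw [UniformSpace.Completion.norm_coe, TensorProduct.norm_tmul, h, expBasis.orthonormal.1 k,
      one_mul]

theorem rotSummand_apply (θ : 𝕋) (k : ℤ) (ξ : L2T) :
    rotSummand θ k ξ = pureTensor (expBasis k) (rotOp θ k ξ) := rfl

theorem rotOp_surjective (θ : 𝕋) (k : ℤ) : Function.Surjective (rotOp θ k) :=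
  ((koopman (rotHom θ)).toFun k).surjective

theorem isHilbertSum_rotSummand (θ : 𝕋) : IsHilbertSum ℂ (fun _ : ℤ => L2T) (rotSummand θ) := by
  refine IsHilbertSum.mk (fun k l hkl ξ η => ?_) ?_
  · rw [rotSummand_apply, rotSummand_apply, inner_pureTensor, expBasis.orthonormal.2 hkl, zero_mul]
  · refine (span_pureTensor_basis expBasis expBasis).trans (Submodule.topologicalClosure_mono ?_)
    rw [Submodule.span_le]
    rintro _ ⟨⟨k, j⟩, rfl⟩
    obtain ⟨ξ, hξ⟩ := rotOp_surjective θ k (expBasis j)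
    refine Submodule.mem_iSup_of_mem k ⟨ξ, ?_⟩
    change pureTensor (expBasis k) (rotOp θ k ξ) = _
    rw [hξ]

/-- The unitary `L²(𝕋) ⊗ L²(𝕋) → ℓ²(ℤ; L²(𝕋))` that maps `e_k ⊗ U_k ξ` to `δ_k ⊗ ξ`; it transforms
`N ⊠ M` into the crossed product. -/
def rotUnitary (θ : 𝕋) : HilbertTensor L2T L2T ≃ₗᵢ[ℂ] lp (fun _ : ℤ => L2T) 2 :=
  (isHilbertSum_rotSummand θ).linearIsometryEquiv

theorem rotUnitary_symm_single (θ : 𝕋) (k : ℤ) (ξ : L2T) :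
    (rotUnitary θ).symm (lp.single 2 k ξ) = pureTensor (expBasis k) (rotOp θ k ξ) :=
  (isHilbertSum_rotSummand θ).linearIsometryEquiv_symm_apply_single ξ

theorem rotUnitary_pureTensor (θ : 𝕋) (k : ℤ) (ξ : L2T) :
    rotUnitary θ (pureTensor (expBasis k) (rotOp θ k ξ)) = lp.single 2 k ξ := by
  rw [← rotUnitary_symm_single, LinearIsometryEquiv.apply_symm_apply]

theorem lp_clm_ext {E : Type*} [NormedAddCommGroup E] [NormedSpace ℂ E]
    {S T : lp (fun _ : ℤ => L2T) 2 →L[ℂ] E}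
    (h : ∀ k ξ, S (lp.single 2 k ξ) = T (lp.single 2 k ξ)) : S = T :=
  lp.ext_continuousLinearMap (by norm_num) fun k => ContinuousLinearMap.ext fun ξ => h k ξ

theorem conj_opTensor_one_apply (θ : 𝕋) (m : LinfT.toStarSubalgebra)
    (ξ : lp (fun _ : ℤ => L2T) 2) (k : ℤ) :
    (rotUnitary θ).conjStarAlgEquiv (opTensor 1 (m : L2T →L[ℂ] L2T)) ξ k =
      ((rotationAction (rotHom θ)).act k m : L2T →L[ℂ] L2T) (ξ k) := by
  have h : (lp.evalCLM ℂ (fun _ : ℤ => L2T) 2 k).comp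
      ((rotUnitary θ).conjStarAlgEquiv (opTensor 1 (m : L2T →L[ℂ] L2T))) =
      ((rotationAction (rotHom θ)).act k m : L2T →L[ℂ] L2T).comp
        (lp.evalCLM ℂ (fun _ : ℤ => L2T) 2 k) := by
    refine lp_clm_ext fun l η => ?_
    have hact : rotOp θ l (((rotationAction (rotHom θ)).act l m : L2T →L[ℂ] L2T) η) =
        (m : L2T →L[ℂ] L2T) (rotOp θ l η) := by
      change (rotOp θ l * (star (rotOp θ l) * (m : L2T →L[ℂ] L2T) * rotOp θ l)) η = _
      rw [← mul_assoc, ← mul_assoc, UnitaryRep.op_mul_star_op, one_mul]; rfl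
    change ((rotUnitary θ) (opTensor 1 (m : L2T →L[ℂ] L2T)
      ((rotUnitary θ).symm (lp.single 2 l η)))) k =
      ((rotationAction (rotHom θ)).act k m : L2T →L[ℂ] L2T)
        ((lp.single 2 l η : lp (fun _ : ℤ => L2T) 2) k)
    rw [rotUnitary_symm_single, opTensor_pureTensor, ← hact, one_apply_eq_self,
      rotUnitary_pureTensor, lp.single_apply, lp.single_apply]
    by_cases hkl : k = l
    · subst hkl; simp
    · simp [hkl]
  exact DFunLike.congr_fun h ξ

theorem conj_leftRot_apply (θ : 𝕋) (g : ℤ) (ξ : lp (fun _ : ℤ => L2T) 2) (k : ℤ) :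
    (rotUnitary θ).conjStarAlgEquiv (leftRot θ (g, 0)) ξ k = ξ (k - g) := by
  have h : (lp.evalCLM ℂ (fun _ : ℤ => L2T) 2 k).comp
      ((rotUnitary θ).conjStarAlgEquiv (leftRot θ (g, 0))) =
      lp.evalCLM ℂ (fun _ : ℤ => L2T) 2 (k - g) := by
    refine lp_clm_ext fun l η => ?_
    have hadd : rotOp θ g (rotOp θ l η) = rotOp θ (g + l) η :=
      ((koopman (rotHom θ)).map_add g l η).symm
    change ((rotUnitary θ) (leftRot θ (g, 0) ((rotUnitary θ).symm (lp.single 2 l η)))) k =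
      (lp.single 2 l η : lp (fun _ : ℤ => L2T) 2) (k - g)
    rw [rotUnitary_symm_single, leftRot_fst, opTensor_pureTensor, expOp_apply, hadd,
      rotUnitary_pureTensor, lp.single_apply, lp.single_apply]
    by_cases hkl : k = g + l
    · subst hkl; simp
    · have h' : k - g ≠ l := fun e => hkl (by rw [← e]; abel)
      simp [hkl, h']
  exact DFunLike.congr_fun h ξ

/-- The generators of `N ⊠ M` that correspond to the generators of the crossed product. -/
def crossedGenerators (θ : 𝕋) : Set (HilbertTensor L2T L2T →L[ℂ] HilbertTensor L2T L2T) :=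
  {T | ∃ n ∈ LinfT, T = opTensor 1 n} ∪ {T | ∃ g, T = leftRot θ (g, 0)}

theorem generatedVN_crossedGenerators (θ : 𝕋) :
    generatedVN (crossedGenerators θ) = rotAlgebra θ := by
  refine SetLike.coe_injective (Set.Subset.antisymm (generatedVN_subset ?_) (generatedVN_subset ?_))
  · rintro _ (⟨n, hn, rfl⟩ | ⟨g, rfl⟩)
    · exact opTensor_one_mem θ hn
    · exact leftRot_mem θ _
  · rintro _ ⟨⟨k, j⟩, rfl⟩
    have h : leftRot θ (k, j) = opTensor 1 (expOp j) * leftRot θ (k, 0) := by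
      rw [leftRot_fst, opTensor_mul, one_mul]; rfl
    rw [h, SetLike.mem_coe]
    exact mul_mem (subset_generatedVN _ (Or.inl ⟨_, expOp_mem j, rfl⟩))
      (subset_generatedVN _ (Or.inr ⟨k, rfl⟩))

theorem nonempty_equiv_crossedProduct (θ : 𝕋) : Nonempty ((rotAlgebra θ).toStarSubalgebra ≃⋆ₐ[ℂ]
    (crossedProduct (rotationAction (rotHom θ))).toStarSubalgebra) := by
  refine nonempty_starAlgEquiv (rotUnitary θ).conjStarAlgEquiv fun x => ?_
  rw [← generatedVN_crossedGenerators, ← map_mem_generatedVN (Φ := (rotUnitary θ).conjStarAlgEquiv),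
    crossedProduct]
  have hgen : {T : lp (fun _ : ℤ => L2T) 2 →L[ℂ] lp (fun _ : ℤ => L2T) 2 |
        ∃ m, ∀ ξ k, T ξ k = ((rotationAction (rotHom θ)).act k m : L2T →L[ℂ] L2T) (ξ k)} ∪
      {T | ∃ g, ∀ ξ k, T ξ k = ξ (k - g)} =
      (rotUnitary θ).conjStarAlgEquiv '' crossedGenerators θ := by
    ext T
    constructor
    · rintro (⟨m, hm⟩ | ⟨g, hg⟩)
      · refine ⟨_, Or.inl ⟨m, m.2, rfl⟩, ?_⟩
        ext1 ξ
        ext1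
        funext k
        rw [conj_opTensor_one_apply, hm]
      · refine ⟨_, Or.inr ⟨g, rfl⟩, ?_⟩
        ext1 ξ
        ext1
        funext k
        rw [conj_leftRot_apply, hg]
    · rintro ⟨_, ⟨n, hn, rfl⟩ | ⟨g, rfl⟩, rfl⟩
      · exact Or.inl ⟨⟨n, hn⟩, conj_opTensor_one_apply θ ⟨n, hn⟩⟩
      · exact Or.inr ⟨g, conj_leftRot_apply θ g⟩
  rw [hgen]

end CrossedProduct

/-! ### Irrational rotations -/

section Irrational

theorem rotBichar_nondegenerate {x : ℝ} (hx : Irrational x) (c : ℤ × ℤ)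
    (h : ∀ a, (rotBichar (x : 𝕋)).toFun a c = (rotBichar (x : 𝕋)).toFun c a) : c = 0 := by
  have h1 := h (1, 0)
  have h2 := h (0, 1)
  simp only [rotBichar, one_smul, zero_smul, neg_zero, smul_zero, AddCircle.toCircle_zero] at h1 h2
  rw [← AddCircle.toCircle_zero (T := (1 : ℝ)), toCircle_eq_iff] at h1 h2
  rw [smul_neg, neg_eq_zero] at h1
  exact Prod.ext (zsmul_irrational_eq_zero hx (neg_eq_zero.1 h2.symm))
    (zsmul_irrational_eq_zero hx h1)

theorem closure_int_prod : AddSubgroup.closure {((1 : ℤ), (0 : ℤ)), (0, 1)} = ⊤ := by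
  rw [eq_top_iff]
  rintro ⟨a, c⟩ -
  have h : ((a, c) : ℤ × ℤ) = a • (1, 0) + c • (0, 1) := by simp
  rw [h]
  exact add_mem (zsmul_mem (AddSubgroup.subset_closure (by simp)) a)
    (zsmul_mem (AddSubgroup.subset_closure (by simp)) c)

theorem separableSpace_of_hilbertBasis {ι H : Type*} [Countable ι] [NormedAddCommGroup H]
    [InnerProductSpace ℂ H] (b : HilbertBasis ι ℂ H) : TopologicalSpace.SeparableSpace H := by
  have h := ((Set.countable_range b).isSeparable.span (R := ℂ)).closure
  rw [← Submodule.topologicalClosure_coe, b.dense_span, Submodule.top_coe] at h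
  exact TopologicalSpace.isSeparable_univ_iff.1 h

theorem isEmpty_equiv_vnTensor {x : ℝ} (hx : Irrational x) :
    IsEmpty ((vnTensor LinfT LinfT).toStarSubalgebra ≃⋆ₐ[ℂ]
      (rotAlgebra (x : 𝕋)).toStarSubalgebra) := by
  refine ⟨fun e => ?_⟩
  have hL := isTwistedRegular_leftRot (x : 𝕋)
  have h1 := mul_comm_of_starAlgEquiv e (fun _ ha _ hb => vnTensor_comm ha hb)
    (leftRot_mem (x : 𝕋) (1, 0)) (leftRot_mem (x : 𝕋) (0, 1))
  rw [hL.mul, hL.mul, add_comm (0, 1)] at h1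
  have h2 := DFunLike.congr_fun h1 (expBasis₂ 0)
  rw [smul_apply, smul_apply, hL.apply_zero] at h2
  have h3 := Circle.ext (smul_left_injective ℂ (expBasis₂.orthonormal.ne_zero _) h2)
  change toCircle ((1 : ℤ) • -((1 : ℤ) • (x : 𝕋)) : 𝕋) =
    toCircle ((0 : ℤ) • -((0 : ℤ) • (x : 𝕋)) : 𝕋) at h3
  rw [toCircle_eq_iff, zero_smul, one_smul, neg_eq_zero] at h3
  exact one_ne_zero (zsmul_irrational_eq_zero hx h3)

end Irrational
end Braided

end

open Braided

theorem proposition18 (θ : 𝕋) :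
    braidedMN θ = (vnTensor LinfT LinfT : Set (HilbertTensor L2T L2T →L[ℂ] HilbertTensor L2T L2T)) ∧
    ∃ P : VonNeumannAlgebra (HilbertTensor L2T L2T),
      (P : Set (HilbertTensor L2T L2T →L[ℂ] HilbertTensor L2T L2T)) = braidedNM θ ∧
      Nonempty (P.toStarSubalgebra ≃⋆ₐ[ℂ]
        (crossedProduct (rotationAction (rotHom θ))).toStarSubalgebra) ∧
      ∀ x : ℝ, Irrational x → θ = (x : 𝕋) →
        IsTypeIIOneFactor P ∧ IsInjectiveVN P ∧
        TopologicalSpace.SeparableSpace (HilbertTensor L2T L2T) ∧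
        IsEmpty ((vnTensor LinfT LinfT).toStarSubalgebra ≃⋆ₐ[ℂ] P.toStarSubalgebra) := by
  refine ⟨braidedMN_eq θ, rotAlgebra θ, coe_rotAlgebra θ, nonempty_equiv_crossedProduct θ, ?_⟩
  rintro x hx rfl
  have hL := isTwistedRegular_leftRot (x : 𝕋)
  have hR := isTwistedRegular_rightRot (x : 𝕋)
  exact ⟨hL.isTypeIIOneFactor hR (rotBichar_nondegenerate hx), hL.isInjectiveVN hR closure_int_prod,
    separableSpace_of_hilbertBasis expBasis₂, isEmpty_equiv_vnTensor hx⟩
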